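/- **Notation.** Let $K_0(\mathrm{Var}_{\mathbb C})$ be the Grothendieck ring of complex algebraic varieties (generated by isomorphism classes $[X]$ of reduced separated $\mathbb C$-schemes of finite type, with $[X]=[X\setminus Y]+[Y]$ for $Y\subset X$ closed and $[X\times Y]=[X][Y]$), let $\mathbb L=[\mathbf A^1]$ and $\mathcal M_{\mathbb C}=K_0(\mathrm{Var}_{\mathbb C})[\mathbb L^{-1}]$. The class of a constructible set $C=\bigsqcup_j Y_j$, with finitely many locally closed $Y_j$, is $[C]=\sum_j[Y_j]$. For a nonzero $f=\sum_\omega a_\omega x^\omega\in\mathbb C[x_1,\dots,x_n]$ with $f(0)=0$, put for $l\ge 1$ $$\mathcal X_l^0=\{\phi\in (t\mathbb C[t]/t^{l+1}\mathbb C[t])^n\mid \operatorname{ord}_t f(\phi)=l\},\qquad Z_f^{\mathrm{mot},0}(T)=\mathbb L^{-n}\sum_{l\ge1}[\mathcal X_l^0](\mathbb L^{-n}T)^l\in\mathcal M_{\mathbb C}[[T]].$$ Let $\Gamma_f$ be the convex hull of $\bigcup_{a_\omega\ne0}(\omega+\mathbb R_{\ge0}^n)$; its faces are $\Gamma_f$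 and its nonempty intersections with supporting hyperplanes, and a facet is a face of codimension one. For $k\in\mathbb R_{\ge0}^n$ put $m(k)=\inf_{x\in\Gamma_f}k\cdot x$, $F(k)=\{x\in\Gamma_f\mid k\cdot x=m(k)\}$, $\sigma(k)=k_1+\dots+k_n$. For a face $\tau$ put $f_\tau=\sum_{\omega\in\tau}a_\omega x^\omega$, $\Delta_\tau=\{k\in\mathbb R_{\ge0}^n\mid F(k)=\tau\}$, $P_\tau=\{\rho\mid \tau\subset\{x_\rho=0\}\}$, and call *rays* of $\Delta_\tau$ the primitive vectors in $\mathbb Z_{\ge0}^n\setminus\{0\}$ perpendicular to the facets of $\Gamma_f$ containing $\tau$. Write $\operatorname{cone}(v_j)_j=\{\sum_j\lambda_jv_j\mid\lambda_j>0\}$. A *simplicial decomposition* of $\Delta_\tau$ (without new rays) is a finite partition of $\Delta_\tau$ into cones $\delta_i=\operatorname{cone}(v)_{v\in V_i}$, $i\in I$, with each $V_i$ a linearly independent set of rays of $\Delta_\tau$. Put $P_i=\{\rho\in P_\tau\mid e_\rho\in V_i\}$ and let $(v_j)_{j\in J_i}$ be the elements of $V_i$ other than the $e_\rho$, $\rho\in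 P_\tau$ (with $(e_\rho)$ the standard basis). Put $$\tilde\Sigma(\delta_i)=\sum_h\mathbb L^{-\sigma(h)}T^{m(h)},\qquad h\in\mathbb Z^n\cap\Bigl\{\sum_{v\in V_i}h_vv\;\Big|\;h_v\in(0,1]\text{ for all }v\Bigr\}.$$ **Theorem 9.3.** Let $f\in\mathbb C[x_1,\dots,x_n]$ be nonzero with $f(0)=0$, and non-degenerate over $\mathbb C$ with respect to the compact faces of $\Gamma_f$: for no compact face $\tau$ do $f_\tau$ and all its partial derivatives have a common zero in $(\mathbb C^\times)^n$. (a) The sets $\mathcal X_l^0$ ($l\ge1$), $\mathcal X_\tau$ and $\mathcal X_\tau'$ ($\tau$ a compact face; defined below) are constructible with well-defined classes. There are finitely many compact faces. For each compact face $\tau$ one has $|P_\tau|\le n-1$; $f_\tau$ only involves the variables $x_\rho$, $\rho\notin P_\tau$; $\Delta_\tau$ has finitely many rays and is strictly positively spanned by them; the $e_\rho$, $\rho\in P_\tau$, are rays, there is at least one other ray, and $m(v)>0$ for every other ray $v$; and $\Delta_\tau$ has a simplicial decomposition. (b) For every choice, for each compact face $\tau$, of a simplicial decomposition $\{\delta_i\}_{i\in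 I}$ of $\Delta_\tau$, we have in $\mathcal M_{\mathbb C}[[T]]$ $$Z_f^{\mathrm{mot},0}(T)=\sum_{\tau\text{ compact},\,P_\tau=\emptyset}L_\tau S(\Delta_\tau)+\sum_{\tau\text{ compact},\,P_\tau\neq\emptyset}L_\tau'S(\Delta_\tau)',$$ where the terms are as follows. If $P_\tau=\emptyset$, put $\mathcal X_\tau=\{x\in(\mathbb C^\times)^n\mid f_\tau(x)=0\}$; then $$L_\tau=(1-\mathbb L^{-1})^n-\mathbb L^{-n}[\mathcal X_\tau]\frac{1-T}{1-\mathbb L^{-1}T},\qquad S(\Delta_\tau)=\sum_{i\in I}S(\delta_i),\qquad S(\delta_i)=\frac{\tilde\Sigma(\delta_i)}{\prod_{v\in V_i}(1-\mathbb L^{-\sigma(v)}T^{m(v)})}.$$ Moreover $S(\Delta_\tau)=\sum_{k\in\mathbb Z^n\cap\Delta_\tau}\mathbb L^{-\sigma(k)}T^{m(k)}$ and $S(\delta_i)=\sum_{k\in\mathbb Z^n\cap\delta_i}\mathbb L^{-\sigma(k)}T^{m(k)}$, where in each sum only finitely many $k$ contribute to each power of $T$. If $P_\tau\ne\emptyset$,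 put $\mathcal X_\tau'=\{(x_\rho)_{\rho\notin P_\tau}\in(\mathbb C^\times)^{n-|P_\tau|}\mid f_\tau((x_\rho)_{\rho\notin P_\tau})=0\}$; then $$L_\tau'=(1-\mathbb L^{-1})^{n-|P_\tau|}-\mathbb L^{-(n-|P_\tau|)}[\mathcal X_\tau']\frac{1-T}{1-\mathbb L^{-1}T},\qquad S(\Delta_\tau)'=\sum_{i\in I}(1-\mathbb L^{-1})^{|P_\tau|-|P_i|}\frac{\tilde\Sigma(\delta_i)}{\prod_{j\in J_i}(1-\mathbb L^{-\sigma(v_j)}T^{m(v_j)})}.$$ Moreover, for every $i\in I$, $J_i\ne\emptyset$ and $\dfrac{\tilde\Sigma(\delta_i)}{\prod_{j\in J_i}(1-\mathbb L^{-\sigma(v_j)}T^{m(v_j)})}=\sum_{k\in\mathbb Z^n\cap\delta_i'}\mathbb L^{-\sigma(k)}T^{m(k)}$, again with finitely many $k$ contributing to each power of $T$, where $\delta_i'=\{\sum_{\rho\in P_i}h_\rho e_\rho+\sum_{j\in J_i}\lambda_jv_j\mid h_\rho\in(0,1],\ \lambda_j>0\}$. -/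

import Mathlib

open CategoryTheory AlgebraicGeometry

noncomputable section

namespace MotivicZeta

/-! ### The Grothendieck ring of complex varieties and its localization -/

/-- A complex algebraic variety: a reduced separated scheme of finite type over `ℂ`. -/
structure CVar : Type 1 where
  X : Scheme.{0}
  str : X ⟶ Spec (CommRingCat.of ℂ)
  reduced : IsReduced X
  separated : IsSeparated str
  locallyOfFiniteType : LocallyOfFiniteType str
  quasiCompact : QuasiCompact str

/-- The affine variety `Spec A` of a reduced finitely generated `ℂ`-algebra `A`. -/
def CVar.spec (A : Type) [CommRing A] [Algebra ℂ A] [_root_.IsReduced A]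
    [Algebra.FiniteType ℂ A] : CVar where
  X := Spec (CommRingCat.of A)
  str := Spec.map (CommRingCat.ofHom (algebraMap ℂ A))
  reduced := inferInstance
  separated := inferInstance
  locallyOfFiniteType := by
    rw [HasRingHomProperty.Spec_iff (P := @LocallyOfFiniteType)]
    exact (RingHom.finiteType_algebraMap (A := ℂ) (B := A)).2 inferInstance
  quasiCompact := inferInstance

/-- The defining relations of the Grothendieck ring: isomorphic varieties have the same class;
`[X] = [Y] + [X ∖ Y]` for a closed subvariety `Y` of `X` (with open complement `U`);
`[X × Y] = [X] · [Y]` for the product over `ℂ`; the class of a point is `1`. -/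
inductive K0Relation : MvPolynomial CVar ℤ → Prop
  | iso (V W : CVar) (e : V.X ≅ W.X) (he : e.hom ≫ W.str = V.str) :
      K0Relation (MvPolynomial.X V - MvPolynomial.X W)
  | scissor (V Y U : CVar) (i : Y.X ⟶ V.X) (j : U.X ⟶ V.X)
      (hi : IsClosedImmersion i) (hj : IsOpenImmersion j)
      (hi' : i ≫ V.str = Y.str) (hj' : j ≫ V.str = U.str)
      (hc : Set.range j = (Set.range i)ᶜ) :
      K0Relation (MvPolynomial.X V - (MvPolynomial.X Y + MvPolynomial.X U))
  | prod (V W P : CVar) (p : P.X ⟶ V.X) (q : P.X ⟶ W.X)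
      (h : IsPullback p q V.str W.str) (hP : p ≫ V.str = P.str) :
      K0Relation (MvPolynomial.X P - MvPolynomial.X V * MvPolynomial.X W)
  | point : K0Relation (MvPolynomial.X (CVar.spec ℂ) - 1)

/-- The Grothendieck ring `K₀(Var_ℂ)`: the commutative ring generated by the (isomorphism classes
of) complex varieties modulo the relations above. As the additive relations are stable under
products with a variety, this is the usual Grothendieck group with its usual product. -/
abbrev K0 : Type 1 := MvPolynomial CVar ℤ ⧸ Ideal.span {r | K0Relation r}

/-- The class `[V]` of a variety in the Grothendieck ring. -/
def CVar.cls (V : CVar) : K0 := Ideal.Quotient.mk _ (MvPolynomial.X V)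

/-- The class of the affine line. -/
def lefschetz : K0 := (CVar.spec (Polynomial ℂ)).cls

/-- The localization `M_ℂ = K₀(Var_ℂ)[𝕃⁻¹]`. -/
abbrev MC : Type 1 := Localization.Away lefschetz

/-- The element `𝕃⁻¹` of `M_ℂ`. -/
def Linv : MC := IsLocalization.Away.invSelf lefschetz

/-! ### Classes of constructible subsets of affine space -/

section Constructible

variable {s : Type}

/-- The points of `ℂ^s` in the image of a morphism to the affine space scheme
`Spec ℂ[x_i, i ∈ s]`; a point `a ∈ ℂ^s` is identified with the corresponding maximal ideal. -/
def complexPoints {Y : Scheme.{0}} (i : Y ⟶ Spec (CommRingCat.of (MvPolynomial s ℂ))) :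
    Set (s → ℂ) :=
  {a | (MvPolynomial.pointToPoint (k := ℂ) a : PrimeSpectrum (MvPolynomial s ℂ)) ∈ Set.range i}

/-- `HasClass C c`: the subset `C ⊆ ℂ^s` is the finite disjoint union of (the sets of complex
points of) locally closed subvarieties `Y_1, …, Y_r` of affine space, and `c = ∑ [Y_j]`.
In particular `C` is constructible. -/
def HasClass (C : Set (s → ℂ)) (c : K0) : Prop :=
  ∃ (r : ℕ) (Y : Fin r → CVar)
    (i : ∀ j, (Y j).X ⟶ Spec (CommRingCat.of (MvPolynomial s ℂ))),
    (∀ j, IsImmersion (i j)) ∧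
    (∀ j, i j ≫ Spec.map (CommRingCat.ofHom (algebraMap ℂ (MvPolynomial s ℂ))) = (Y j).str) ∧
    Pairwise (fun j k => Disjoint (complexPoints (i j)) (complexPoints (i k))) ∧
    C = ⋃ j, complexPoints (i j) ∧
    c = ∑ j, (Y j).cls

open Classical in
/-- The class `[C]` in `M_ℂ` of a constructible subset `C` of `ℂ^s` (and `0` if `C` is not
constructible). -/
def cls (C : Set (s → ℂ)) : MC :=
  if h : ∃ c, HasClass C c then algebraMap K0 MC h.choose else 0

end Constructible

/-! ### The local motivic zeta function -/

variable {n : ℕ}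

/-- The set of `l`-jets `φ` at the origin with `ord_t f(φ) = l`. The jet with components
`φ_ρ = ∑_{κ ≤ l} a_{ρ,κ} t^κ` is identified with the point `(a_{ρ,κ})` of `ℂ^{n(l+1)}`. -/
def jetLocus (f : MvPolynomial (Fin n) ℂ) (l : ℕ) : Set (Fin n × Fin (l + 1) → ℂ) :=
  {a | (∀ ρ, a (ρ, 0) = 0) ∧
    (MvPolynomial.aeval
      (fun ρ => ∑ κ : Fin (l + 1), PowerSeries.monomial (κ : ℕ) (a (ρ, κ))) f
        : PowerSeries ℂ).order = (l : ℕ∞)}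

/-- The local motivic zeta function `𝕃⁻ⁿ ∑_{l ≥ 1} [𝒳_l⁰] (𝕃⁻ⁿ T)^l ∈ M_ℂ[[T]]`. -/
def motivicZeta (f : MvPolynomial (Fin n) ℂ) : PowerSeries MC :=
  PowerSeries.mk fun l =>
    if l = 0 then 0 else Linv ^ n * cls (jetLocus f l) * (Linv ^ n) ^ l

/-! ### Newton polyhedra -/

/-- An integral vector viewed as a real vector. -/
def toReal (k : Fin n → ℕ) : Fin n → ℝ := fun ρ => (k ρ : ℝ)

/-- The Newton polyhedron: the convex hull of `⋃_{ω ∈ supp f} (ω + ℝ_{≥0}^n)`. -/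
def newton (f : MvPolynomial (Fin n) ℂ) : Set (Fin n → ℝ) :=
  convexHull ℝ (⋃ ω ∈ f.support, {x | ∀ ρ, (ω ρ : ℝ) ≤ x ρ})

/-- `m(k) = inf_{x ∈ Γ_f} k · x`. -/
def m (f : MvPolynomial (Fin n) ℂ) (k : Fin n → ℝ) : ℝ :=
  sInf ((fun x => k ⬝ᵥ x) '' newton f)

/-- The value of `m` at an integral vector `k ∈ ℤ_{≥0}^n`, as a natural number
(see `m_toReal`). -/
def mNat (f : MvPolynomial (Fin n) ℂ) (k : Fin n → ℕ) : ℕ :=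
  sInf ((fun ω : Fin n →₀ ℕ => ∑ ρ, k ρ * ω ρ) '' (f.support : Set (Fin n →₀ ℕ)))

theorem m_toReal {f : MvPolynomial (Fin n) ℂ} (hf : f ≠ 0) (k : Fin n → ℕ) :
    m f (toReal k) = mNat f k := by
  have hne : ((fun ω : Fin n →₀ ℕ => ∑ ρ, k ρ * ω ρ) ''
      (f.support : Set (Fin n →₀ ℕ))).Nonempty :=
    (Finset.coe_nonempty.2 (MvPolynomial.support_nonempty.2 hf)).image _
  obtain ⟨ω, hω, hω'⟩ := Nat.sInf_mem hne
  refine IsLeast.csInf_eq ⟨?_, ?_⟩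
  · refine ⟨fun ρ => (ω ρ : ℝ), subset_convexHull ℝ _ ?_, ?_⟩
    · exact Set.mem_biUnion hω fun ρ => le_rfl
    · simp only [mNat, ← hω', toReal, dotProduct]
      push_cast
      rfl
  · rintro _ ⟨x, hx, rfl⟩
    have hconv : Convex ℝ {x : Fin n → ℝ | (mNat f k : ℝ) ≤ toReal k ⬝ᵥ x} :=
      convex_halfSpace_ge
        ⟨fun a b => dotProduct_add _ a b, fun c a => by simp [dotProduct_smul]⟩ _
    refine convexHull_min ?_ hconv hx
    intro y hy
    simp only [Set.mem_iUnion] at hy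
    obtain ⟨ν, hν, hy⟩ := hy
    have h1 : mNat f k ≤ ∑ ρ, k ρ * ν ρ := Nat.sInf_le ⟨ν, hν, rfl⟩
    calc (mNat f k : ℝ) ≤ ((∑ ρ, k ρ * ν ρ : ℕ) : ℝ) := by exact_mod_cast h1
      _ = ∑ ρ, (k ρ : ℝ) * (ν ρ : ℝ) := by push_cast; rfl
      _ ≤ toReal k ⬝ᵥ y :=
        Finset.sum_le_sum fun ρ _ => mul_le_mul_of_nonneg_left (hy ρ) (Nat.cast_nonneg _)

/-- `σ(k) = k_1 + ⋯ + k_n`. -/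
def sigma (k : Fin n → ℕ) : ℕ := ∑ ρ, k ρ

/-- The first meet locus `F(k) = {x ∈ Γ_f | k · x = m(k)}`. -/
def firstMeet (f : MvPolynomial (Fin n) ℂ) (k : Fin n → ℝ) : Set (Fin n → ℝ) :=
  {x ∈ newton f | k ⬝ᵥ x = m f k}

/-- The compact faces of the Newton polyhedron. A (nonempty) face is the Newton polyhedron
itself or its intersection with a supporting hyperplane. -/
abbrev CompactFace (f : MvPolynomial (Fin n) ℂ) : Type :=
  {τ : Set (Fin n → ℝ) // IsExposed ℝ (newton f) τ ∧ τ.Nonempty ∧ IsCompact τ}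

open Classical in
/-- `f_τ = ∑_{ω ∈ τ} a_ω x^ω`. -/
def facePoly (f : MvPolynomial (Fin n) ℂ) (τ : Set (Fin n → ℝ)) : MvPolynomial (Fin n) ℂ :=
  ∑ ω ∈ f.support.filter (fun ω => (fun ρ => (ω ρ : ℝ)) ∈ τ),
    MvPolynomial.monomial ω (f.coeff ω)

/-- `f` is non-degenerate over `ℂ` with respect to the compact faces of its Newton polyhedron:
for no compact face `τ` do `f_τ` and all its partial derivatives have a common zero
in `(ℂ^×)^n`. -/
def NonDegenerate (f : MvPolynomial (Fin n) ℂ) : Prop :=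
  ∀ τ : CompactFace f, ∀ x : Fin n → ℂ, (∀ ρ, x ρ ≠ 0) →
    ¬ (MvPolynomial.eval x (facePoly f τ) = 0 ∧
      ∀ ρ, MvPolynomial.eval x (MvPolynomial.pderiv ρ (facePoly f τ)) = 0)

open Classical in
/-- `P_τ`: the set of indices `ρ` with `τ ⊆ {x_ρ = 0}`. -/
def P (τ : Set (Fin n → ℝ)) : Finset (Fin n) :=
  Finset.univ.filter fun ρ => ∀ x ∈ τ, x ρ = 0

/-! ### Cones -/

/-- The cone `Δ_τ = {k ∈ ℝ_{≥0}^n | F(k) = τ}` associated to a face `τ`. -/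
def dualCone (f : MvPolynomial (Fin n) ℂ) (τ : Set (Fin n → ℝ)) : Set (Fin n → ℝ) :=
  {k | (∀ ρ, 0 ≤ k ρ) ∧ firstMeet f k = τ}

/-- The cone strictly positively spanned by a finite set of integral vectors. -/
def cone (V : Finset (Fin n → ℕ)) : Set (Fin n → ℝ) :=
  {x | ∃ c : (Fin n → ℕ) → ℝ, (∀ v ∈ V, 0 < c v) ∧ x = ∑ v ∈ V, c v • toReal v}

/-- The rays of `Δ_τ`: the primitive vectors in `ℤ_{≥0}^n ∖ {0}` perpendicular to the facets
(faces of codimension one) of the Newton polyhedron that contain `τ`. The facet to which such a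
vector `v` is perpendicular is its first meet locus `F(v)`. -/
def rays (f : MvPolynomial (Fin n) ℂ) (τ : Set (Fin n → ℝ)) : Set (Fin n → ℕ) :=
  {v | Finset.univ.gcd v = 1 ∧
    Module.finrank ℝ (vectorSpan ℝ (firstMeet f (toReal v))) + 1 = n ∧
    τ ⊆ firstMeet f (toReal v)}

/-- A decomposition of `Δ_τ` into simplicial cones without introducing new rays: a finite
partition of `Δ_τ` into cones, each strictly positively spanned by linearly independent
rays of `Δ_τ`. A cone `δ_i` is recorded by the set of the rays that span it. -/
structure SimplicialDecomp (f : MvPolynomial (Fin n) ℂ) (τ : Set (Fin n → ℝ)) where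
  cells : Finset (Finset (Fin n → ℕ))
  subset_rays : ∀ V ∈ cells, (V : Set (Fin n → ℕ)) ⊆ rays f τ
  linearIndependent : ∀ V ∈ cells, LinearIndepOn ℝ toReal (V : Set (Fin n → ℕ))
  disjoint : (cells : Set (Finset (Fin n → ℕ))).PairwiseDisjoint cone
  iUnion_eq : ⋃ V ∈ cells, cone V = dualCone f τ

/-- The standard basis vector `e_ρ`. -/
def stdVec (ρ : Fin n) : Fin n → ℕ := Pi.single ρ 1

/-- `P_i`: the indices `ρ ∈ P_τ` such that `e_ρ` is among the spanning vectors `V`. -/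
def cellP (τ : Set (Fin n → ℝ)) (V : Finset (Fin n → ℕ)) : Finset (Fin n) :=
  (P τ).filter fun ρ => stdVec ρ ∈ V

/-- `(v_j)_{j ∈ J_i}`: the spanning vectors in `V` other than the `e_ρ`, `ρ ∈ P_τ`. -/
def cellJ (τ : Set (Fin n → ℝ)) (V : Finset (Fin n → ℕ)) : Finset (Fin n → ℕ) :=
  V \ (P τ).image stdVec

/-- The integral points of the fundamental parallelepiped
`{∑ h_v v | h_v ∈ (0,1] for all v}`. -/
def parPoints (V : Finset (Fin n → ℕ)) : Set (Fin n → ℕ) :=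
  {h | ∃ c : (Fin n → ℕ) → ℝ, (∀ v ∈ V, 0 < c v ∧ c v ≤ 1) ∧
    toReal h = ∑ v ∈ V, c v • toReal v}

/-- The set `δ_i'` of all `∑ h_ρ e_ρ + ∑ λ_j v_j`, with `h_ρ ∈ (0,1]` for `ρ ∈ P_i` and
`λ_j > 0` for `j ∈ J_i`. -/
def truncCone (τ : Set (Fin n → ℝ)) (V : Finset (Fin n → ℕ)) : Set (Fin n → ℝ) :=
  {x | ∃ (h : Fin n → ℝ) (c : (Fin n → ℕ) → ℝ),
    (∀ ρ ∈ cellP τ V, 0 < h ρ ∧ h ρ ≤ 1) ∧ (∀ v ∈ cellJ τ V, 0 < c v) ∧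
    x = ∑ ρ ∈ cellP τ V, h ρ • toReal (stdVec ρ) + ∑ v ∈ cellJ τ V, c v • toReal v}

/-! ### The terms of the formula -/

open PowerSeries in
/-- `Σ̃ = ∑_h 𝕃^{-σ(h)} T^{m(h)}`, with `h` running through the integral points of the
fundamental parallelepiped spanned by `V`. -/
def parSum (f : MvPolynomial (Fin n) ℂ) (V : Finset (Fin n → ℕ)) : PowerSeries MC :=
  ∑ᶠ h ∈ parPoints V, C (Linv ^ sigma h) * X ^ mNat f h

open PowerSeries in
/-- `∏_{v ∈ J} (1 - 𝕃^{-σ(v)} T^{m(v)})^{-1}`; each factor is invertible in `M_ℂ[[T]]`, as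
`m(v) > 0` whenever this is used. -/
def invProd (f : MvPolynomial (Fin n) ℂ) (J : Finset (Fin n → ℕ)) : PowerSeries MC :=
  ∏ v ∈ J, invOfUnit (1 - C (Linv ^ sigma v) * X ^ mNat f v) 1

open PowerSeries in
/-- `(1 - T) / (1 - 𝕃⁻¹ T)`. -/
def tFactor : PowerSeries MC := (1 - X) * invOfUnit (1 - C Linv * X) 1

/-- `S(δ_i)`, for `δ_i` the cone strictly positively spanned by `V`. -/
def cellS (f : MvPolynomial (Fin n) ℂ) (V : Finset (Fin n → ℕ)) : PowerSeries MC :=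
  parSum f V * invProd f V

/-- `S(Δ_τ) = ∑_i S(δ_i)`. -/
def coneS {f : MvPolynomial (Fin n) ℂ} {τ : Set (Fin n → ℝ)} (D : SimplicialDecomp f τ) :
    PowerSeries MC :=
  ∑ V ∈ D.cells, cellS f V

/-- `Σ̃(δ_i) / ∏_{j ∈ J_i} (1 - 𝕃^{-σ(v_j)} T^{m(v_j)})`, the product being over the spanning
vectors other than the `e_ρ`, `ρ ∈ P_τ`. -/
def cellS' (f : MvPolynomial (Fin n) ℂ) (τ : Set (Fin n → ℝ)) (V : Finset (Fin n → ℕ)) :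
    PowerSeries MC :=
  parSum f V * invProd f (cellJ τ V)

/-- `S(Δ_τ)' = ∑_i (1 - 𝕃⁻¹)^{|P_τ| - |P_i|} Σ̃(δ_i) / ∏_{j ∈ J_i} (1 - 𝕃^{-σ(v_j)} T^{m(v_j)})`. -/
def coneS' {f : MvPolynomial (Fin n) ℂ} {τ : Set (Fin n → ℝ)} (D : SimplicialDecomp f τ) :
    PowerSeries MC :=
  ∑ V ∈ D.cells,
    PowerSeries.C ((1 - Linv) ^ ((P τ).card - (cellP τ V).card)) * cellS' f τ V

/-- `𝒳_τ = {x ∈ (ℂ^×)^n | f_τ(x) = 0}`. -/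
def torusLocus (f : MvPolynomial (Fin n) ℂ) (τ : Set (Fin n → ℝ)) : Set (Fin n → ℂ) :=
  {x | (∀ ρ, x ρ ≠ 0) ∧ MvPolynomial.eval x (facePoly f τ) = 0}

open Classical in
/-- `𝒳_τ'`: the zero locus of `f_τ`, as a polynomial in the variables `x_ρ`, `ρ ∉ P_τ` (the
other variables do not occur and are set to `0`), in `(ℂ^×)^{n - |P_τ|}`. -/
def torusLocus' (f : MvPolynomial (Fin n) ℂ) (τ : Set (Fin n → ℝ)) :
    Set ({ρ : Fin n // ρ ∉ P τ} → ℂ) :=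
  {x | (∀ ρ, x ρ ≠ 0) ∧
    MvPolynomial.eval (fun ρ => if h : ρ ∉ P τ then x ⟨ρ, h⟩ else 0) (facePoly f τ) = 0}

/-- `L_τ = (1 - 𝕃⁻¹)^n - 𝕃⁻ⁿ [𝒳_τ] (1 - T)/(1 - 𝕃⁻¹ T)`. -/
def faceL (f : MvPolynomial (Fin n) ℂ) (τ : Set (Fin n → ℝ)) : PowerSeries MC :=
  PowerSeries.C ((1 - Linv) ^ n) -
    PowerSeries.C (Linv ^ n * cls (torusLocus f τ)) * tFactor

/-- `L_τ' = (1 - 𝕃⁻¹)^{n-|P_τ|} - 𝕃^{-(n-|P_τ|)} [𝒳_τ'] (1 - T)/(1 - 𝕃⁻¹ T)`. -/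
def faceL' (f : MvPolynomial (Fin n) ℂ) (τ : Set (Fin n → ℝ)) : PowerSeries MC :=
  PowerSeries.C ((1 - Linv) ^ (n - (P τ).card)) -
    PowerSeries.C (Linv ^ (n - (P τ).card) * cls (torusLocus' f τ)) * tFactor

/-- `IsLatticeSum f A S`: the formal sum `∑_{k ∈ ℤ^n ∩ A} 𝕃^{-σ(k)} T^{m(k)}` (for
`A ⊆ ℝ_{≥0}^n`) makes sense in `M_ℂ[[T]]`, i.e. only finitely many `k` contribute to each power
of `T`, and it is equal to `S`. -/
def IsLatticeSum (f : MvPolynomial (Fin n) ℂ) (A : Set (Fin n → ℝ)) (S : PowerSeries MC) :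
    Prop :=
  ∀ l : ℕ, {k : Fin n → ℕ | toReal k ∈ A ∧ mNat f k = l}.Finite ∧
    PowerSeries.coeff l S =
      ∑ᶠ k ∈ {k : Fin n → ℕ | toReal k ∈ A ∧ mNat f k = l}, Linv ^ sigma k

end MotivicZeta

end

/-!
The class of a constructible set `C ⊆ ℂ^s` is well defined because it can be read off from zero
patterns. A finite set `Φ` of polynomials cuts `ℂ^s` into atoms, according to which elements of
`Φ` vanish; each atom is the set of complex points of `Spec` of its algebra of regular functions,
and any decomposition of `C` into locally closed subvarieties has, for `Φ` large enough, the class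
`∑ [C ∩ atom]` (`HasClass.unique`). Regular functions also show that the class is invariant under
biregular bijections (`cls_congr`) and that a cylinder in the direction of a coordinate has `𝕃`
times the class of its base (`cls_cyl`). Together they permit to use any function that is affine
in one coordinate, with invertible linear coefficient, as a new coordinate (`cls_affine`). All
later computations in the Grothendieck ring reduce to these facts.

A jet `φ` at the origin of `(t ℂ[t]/t^{l+1})^n` has a vector `k ∈ {1, …, l+1}^n` of orders, where
`l + 1` stands for a zero component (`cls_jetLocus`). If `m = m(k)` and `τ = F(k)`, then `τ` is a
compact face, `f(φ) = t^m f_τ(c) + ⋯` where `c` are the leading coefficients of `φ`, and `f_τ`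
only involves the coordinates off `P_τ`. There are no such jets with `ord f(φ) = l` if `l < m`. If
`l = m`, the condition is `f_τ(c) ≠ 0`. If `l > m`, it says that `f_τ(c) = 0`, that the
coefficients of `t^{m+1}, …, t^{l-1}` in `f(φ)` vanish, and that the one of `t^l` does not. By
non-degeneracy some partial derivative `∂f_τ/∂x_ρ` does not vanish at `c`; by Taylor expansion the
coefficient of `t^{m+j}` in `f(φ)` is affine in the coefficient of `t^{k_ρ+j}` in `φ_ρ`, with this
derivative as linear coefficient (`eval_jetCoeff_update`), and the conditions become conditions on
coordinates. The normalized class of the stratum is the coefficient of `T^{l-m}` in `L'_τ`, times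
a weight that is `𝕃^{-k_ρ}` for `ρ ∉ P_τ` and, for `ρ ∈ P_τ`, is `(1 - 𝕃⁻¹) 𝕃^{-k_ρ}` if `k_ρ ≤ l`
and `𝕃^{-(l+1)}` if `k_ρ = l + 1` (`cls_jetStratum`). The last weight is the tail of the geometric
series of the preceding ones. Hence the capped sums over the integral points of `Δ_τ` do not
depend on the cap (`sum_capPoints_eq`).

It remains to identify the capped sums with the coefficients of `S(Δ_τ)'` (`coeff_coneS'`). An
integral point of a simplicial cone `δ_i` is, in a unique way, an integral point of `δ_i'` plus a
nonnegative integral combination of the `e_ρ`, `ρ ∈ P_i`. Summing over these combinations replaces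
the factors `1 - 𝕃⁻¹` of `P_i` by `1`, which leaves `(1 - 𝕃⁻¹)^{|P_τ| - |P_i|}`
(`exists_cap_sum_cell`), and the sum over `δ_i'` is `Σ̃(δ_i)` times a product of geometric series
in the directions `v_j` on which `m` is positive (`latSum_boxPoints`). The case `P_τ = ∅` is the
special case in which no coordinate is capped.

For the polyhedral statements, `Δ_τ` is described as the set of the points of a rational cone,
contained in the orthant, at which a given set of inequalities is active (`mem_dualCone_iff`). The
rays of `Δ_τ` are the primitive vectors on the extremal rays of this cone on which these
inequalities are active (`mem_rays_iff`), and `Δ_τ` is triangulated by pulling: a point is moved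
away from a chosen extremal ray of its face until it reaches a smaller face (`exists_cell`,
`Cell.unique`).
-/

noncomputable section

namespace MotivicZeta

/-! ### Reduced subschemes are determined by their complex points -/

/-- A reduced closed subscheme is defined by the vanishing ideal of its underlying set. -/
theorem ker_eq_vanishingIdeal {Y X : Scheme.{0}} (i : Y ⟶ X) [IsClosedImmersion i]
    [IsReduced Y] :
    i.ker =
      Scheme.IdealSheafData.vanishingIdeal ⟨Set.range i, i.isClosedEmbedding.isClosed_range⟩ := by
  have hrad : i.ker.radical = i.ker := by
    refine Scheme.IdealSheafData.ext (funext fun U => ?_)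
    rw [Scheme.IdealSheafData.radical_ideal, Scheme.Hom.ker_apply]
    refine Ideal.IsRadical.radical fun x ⟨k, hk⟩ => ?_
    rw [RingHom.mem_ker, map_pow] at hk
    exact eq_zero_of_pow_eq_zero hk
  rw [← hrad, ← Scheme.IdealSheafData.vanishingIdeal_support]
  congr 1
  ext x
  have := Scheme.Hom.support_ker i
  rw [i.isClosedEmbedding.isClosed_range.closure_eq] at this
  exact Set.ext_iff.1 this x

theorem exists_iso_of_isClosedImmersion {Y₁ Y₂ X : Scheme.{0}} (i₁ : Y₁ ⟶ X) (i₂ : Y₂ ⟶ X)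
    [IsClosedImmersion i₁] [IsClosedImmersion i₂] [IsReduced Y₁] [IsReduced Y₂]
    (h : Set.range i₁ = Set.range i₂) : ∃ e : Y₁ ≅ Y₂, e.hom ≫ i₂ = i₁ := by
  have hk : i₂.ker = i₁.ker := by
    rw [ker_eq_vanishingIdeal, ker_eq_vanishingIdeal]
    congr 1
    ext x
    exact (Set.ext_iff.1 h x).symm
  have := IsClosedImmersion.isIso_lift i₂ i₁ hk
  exact ⟨asIso (IsClosedImmersion.lift i₂ i₁ hk.le), by simp⟩

/-- Reduced locally closed subschemes with the same underlying set are isomorphic: both are closed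
subschemes of the open subscheme on the coborder of this set. -/
theorem exists_iso_of_isImmersion {Y₁ Y₂ X : Scheme.{0}} (i₁ : Y₁ ⟶ X) (i₂ : Y₂ ⟶ X)
    [IsImmersion i₁] [IsImmersion i₂] [IsReduced Y₁] [IsReduced Y₂]
    (h : Set.range i₁ = Set.range i₂) : ∃ e : Y₁ ≅ Y₂, e.hom ≫ i₂ = i₁ := by
  have hsub : Set.range i₂ ⊆ Set.range i₁.coborderRange.ι := by
    rw [← h]
    simpa using! subset_coborder
  -- the coborder of the common underlying set is an open set in which both subschemes are
  -- closed
  let j₂ := IsOpenImmersion.lift i₁.coborderRange.ι i₂ hsub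
  have hj₂ : j₂ ≫ i₁.coborderRange.ι = i₂ := IsOpenImmersion.lift_fac _ _ _
  have hr : Set.range i₁.liftCoborder = Set.range j₂ := by
    apply Set.image_injective.mpr i₁.coborderRange.ι.isOpenEmbedding.injective
    rw [← Set.range_comp, ← Set.range_comp, ← TopCat.coe_comp, ← TopCat.coe_comp,
      ← Scheme.Hom.comp_base, ← Scheme.Hom.comp_base, hj₂, i₁.liftCoborder_ι, h]
  have : IsImmersion (j₂ ≫ i₁.coborderRange.ι) := by rw [hj₂]; infer_instance
  have : IsImmersion j₂ := IsImmersion.of_comp j₂ i₁.coborderRange.ι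
  have : IsClosedImmersion j₂ :=
    .of_isPreimmersion _ (hr ▸ i₁.liftCoborder.isClosedEmbedding.isClosed_range)
  obtain ⟨e, he⟩ := exists_iso_of_isClosedImmersion i₁.liftCoborder j₂ hr
  exact ⟨e, by rw [← hj₂, ← Category.assoc, he, i₁.liftCoborder_ι]⟩

/-- In a Jacobson space, inclusions between locally closed sets can be tested on closed points. -/
theorem subset_of_closedPoints_subset {X : Type*} [TopologicalSpace X] [JacobsonSpace X]
    {A B : Set X} (hA : IsLocallyClosed A) (hB : IsLocallyClosed B)
    (h : ∀ x ∈ closedPoints X, x ∈ A → x ∈ B) : A ⊆ B := by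
  obtain ⟨U, Z, hU, hZ, rfl⟩ := hB
  have key : ∀ W : Set X, IsLocallyClosed W → U ∩ Z ⊆ Wᶜ → A ∩ W = ∅ := by
    intro W hW hWB
    by_contra hne
    obtain ⟨x, hx, hx'⟩ := nonempty_inter_closedPoints (Set.nonempty_iff_ne_empty.2 hne)
      (hA.inter hW)
    exact hWB (h x hx' hx.1) hx.2
  intro x hx
  constructor
  · by_contra hxU
    have := key Uᶜ hU.isClosed_compl.isLocallyClosed (by simp)
    exact (Set.ext_iff.1 this x).1 ⟨hx, hxU⟩
  · by_contra hxZ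
    have := key Zᶜ hZ.isOpen_compl.isLocallyClosed (by simp)
    exact (Set.ext_iff.1 this x).1 ⟨hx, hxZ⟩

section Points

variable {s : Type}

/-- By the Nullstellensatz, inclusions between locally closed subsets of affine space can be
tested on complex points. -/
theorem range_subset_of_complexPoints_subset [Finite s] {Y₁ Y₂ : Scheme.{0}}
    (i₁ : Y₁ ⟶ Spec (CommRingCat.of (MvPolynomial s ℂ)))
    (i₂ : Y₂ ⟶ Spec (CommRingCat.of (MvPolynomial s ℂ))) [IsImmersion i₁] [IsImmersion i₂]
    (h : complexPoints i₁ ⊆ complexPoints i₂) : Set.range i₁ ⊆ Set.range i₂ := by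
  have : JacobsonSpace (Spec (CommRingCat.of (MvPolynomial s ℂ))) := inferInstance
  refine subset_of_closedPoints_subset i₁.isLocallyClosed_range i₂.isLocallyClosed_range ?_
  intro x hx hx1
  have hx' : IsClosed ({x} : Set (PrimeSpectrum (MvPolynomial s ℂ))) := hx
  obtain ⟨a, ha⟩ := MvPolynomial.isMaximal_iff_eq_vanishingIdeal_singleton.1
    ((PrimeSpectrum.isClosed_singleton_iff_isMaximal _).1 hx')
  have hxa : x = (MvPolynomial.pointToPoint (k := ℂ) a : PrimeSpectrum (MvPolynomial s ℂ)) :=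
    PrimeSpectrum.ext ha
  rw [hxa] at hx1 ⊢
  exact h hx1

/-- The structure morphism of affine space. -/
abbrev affineStr (s : Type) : Spec (CommRingCat.of (MvPolynomial s ℂ)) ⟶ Spec (CommRingCat.of ℂ) :=
  Spec.map (CommRingCat.ofHom (algebraMap ℂ (MvPolynomial s ℂ)))

/-- Isomorphic varieties have the same class in `K0`. -/
theorem cls_eq_of_iso {V W : CVar} (e : V.X ≅ W.X) (he : e.hom ≫ W.str = V.str) :
    V.cls = W.cls := by
  rw [CVar.cls, CVar.cls, Ideal.Quotient.eq]
  exact Ideal.subset_span (K0Relation.iso V W e he)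

/-- The scissor relation in `K0`. -/
theorem cls_eq_add {V Y U : CVar} (i : Y.X ⟶ V.X) (j : U.X ⟶ V.X)
    (hi : IsClosedImmersion i) (hj : IsOpenImmersion j)
    (hi' : i ≫ V.str = Y.str) (hj' : j ≫ V.str = U.str)
    (hc : Set.range j = (Set.range i)ᶜ) : V.cls = Y.cls + U.cls := by
  rw [CVar.cls, CVar.cls, CVar.cls, ← map_add, Ideal.Quotient.eq]
  exact Ideal.subset_span (K0Relation.scissor V Y U i j hi hj hi' hj' hc)

/-- The class of a locally closed subvariety of affine space only depends on its complex points. -/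
theorem cls_eq_of_complexPoints_eq [Finite s] {Y₁ Y₂ : CVar}
    (i₁ : Y₁.X ⟶ Spec (CommRingCat.of (MvPolynomial s ℂ)))
    (i₂ : Y₂.X ⟶ Spec (CommRingCat.of (MvPolynomial s ℂ))) (h₁ : IsImmersion i₁)
    (h₂ : IsImmersion i₂) (hs₁ : i₁ ≫ affineStr s = Y₁.str) (hs₂ : i₂ ≫ affineStr s = Y₂.str)
    (h : complexPoints i₁ = complexPoints i₂) : Y₁.cls = Y₂.cls := by
  have := Y₁.reduced
  have := Y₂.reduced
  obtain ⟨e, he⟩ := exists_iso_of_isImmersion i₁ i₂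
    ((range_subset_of_complexPoints_subset i₁ i₂ h.le).antisymm
      (range_subset_of_complexPoints_subset i₂ i₁ h.ge))
  exact cls_eq_of_iso e (by rw [← hs₂, ← hs₁, ← Category.assoc, he])

instance isReduced_vanishingIdeal_subscheme {X : Scheme.{0}} (Z : TopologicalSpace.Closeds X) :
    IsReduced (Scheme.IdealSheafData.vanishingIdeal Z).subscheme := by
  have : ∀ U,
      IsReduced ((Scheme.IdealSheafData.vanishingIdeal Z).subschemeCover.openCover.X U) := by
    intro (U : X.affineOpens)
    change IsReduced (Spec (.of (Γ(X, U.1) ⧸ (Scheme.IdealSheafData.vanishingIdeal Z).ideal U)))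
    have : _root_.IsReduced (Γ(X, U.1) ⧸ (Scheme.IdealSheafData.vanishingIdeal Z).ideal U) := by
      rw [← Ideal.isRadical_iff_quotient_reduced, Scheme.IdealSheafData.vanishingIdeal_ideal]
      exact PrimeSpectrum.isRadical_vanishingIdeal _
    infer_instance
  exact IsReduced.of_openCover _ (Scheme.IdealSheafData.subschemeCover _).openCover

/-- A locally closed subvariety of affine space is cut in two by the zero locus of a
polynomial. -/
theorem exists_cut (Y : CVar) (i : Y.X ⟶ Spec (CommRingCat.of (MvPolynomial s ℂ)))
    (h : IsImmersion i) (hs : i ≫ affineStr s = Y.str) (p : MvPolynomial s ℂ) :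
    ∃ (Y₁ Y₂ : CVar) (i₁ : Y₁.X ⟶ Spec (CommRingCat.of (MvPolynomial s ℂ)))
      (i₂ : Y₂.X ⟶ Spec (CommRingCat.of (MvPolynomial s ℂ))),
      IsImmersion i₁ ∧ IsImmersion i₂ ∧ i₁ ≫ affineStr s = Y₁.str ∧ i₂ ≫ affineStr s = Y₂.str ∧
      complexPoints i₁ = {a ∈ complexPoints i | MvPolynomial.eval a p = 0} ∧
      complexPoints i₂ = {a ∈ complexPoints i | MvPolynomial.eval a p ≠ 0} ∧
      Y.cls = Y₁.cls + Y₂.cls := by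
  have := Y.reduced
  have := Y.separated
  have := Y.locallyOfFiniteType
  have := Y.quasiCompact
  let U : (Spec (CommRingCat.of (MvPolynomial s ℂ))).Opens := PrimeSpectrum.basicOpen p
  let V := i ⁻¹ᵁ U
  -- the closed part carries the reduced structure
  let Z : TopologicalSpace.Closeds Y.X := ⟨(V : Set Y.X)ᶜ, V.isOpen.isClosed_compl⟩
  let I := Scheme.IdealSheafData.vanishingIdeal Z
  have : IsLocallyNoetherian Y.X := LocallyOfFiniteType.isLocallyNoetherian Y.str
  let Y₁ : CVar := ⟨I.subscheme, I.subschemeι ≫ Y.str, inferInstance, inferInstance,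
    inferInstance, inferInstance⟩
  let Y₂ : CVar := ⟨V.toScheme, V.ι ≫ Y.str, inferInstance, inferInstance, inferInstance,
    inferInstance⟩
  have hU : ∀ a : s → ℂ, (MvPolynomial.pointToPoint (k := ℂ) a :
      PrimeSpectrum (MvPolynomial s ℂ)) ∈ PrimeSpectrum.basicOpen p ↔
        MvPolynomial.eval a p ≠ 0 := by
    intro a
    rw [PrimeSpectrum.mem_basicOpen]
    exact not_congr (MvPolynomial.mem_vanishingIdeal_singleton_iff a p)
  have hrI : Set.range I.subschemeι = (V : Set Y.X)ᶜ := by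
    rw [Scheme.IdealSheafData.range_subschemeι, Scheme.IdealSheafData.coe_support_vanishingIdeal]
    rfl
  refine ⟨Y₁, Y₂, I.subschemeι ≫ i, V.ι ≫ i, inferInstanceAs (IsImmersion (I.subschemeι ≫ i)),
    inferInstanceAs (IsImmersion (V.ι ≫ i)), ?_, ?_, ?_, ?_, ?_⟩
  · rw [Category.assoc, hs]
  · rw [Category.assoc, hs]
  · ext a
    simp only [complexPoints, Set.mem_ofPred_eq]
    rw [Scheme.Hom.comp_base, TopCat.coe_comp, Set.range_comp, hrI]
    constructor
    · rintro ⟨y, hy, hya⟩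
      refine ⟨⟨y, hya⟩, ?_⟩
      by_contra hne
      exact hy (show i y ∈ U from hya ▸ (hU a).2 hne)
    · rintro ⟨⟨y, hya⟩, h0⟩
      refine ⟨y, fun hy => ?_, hya⟩
      exact (hU a).1 (hya ▸ (show i y ∈ U from hy)) h0
  · ext a
    simp only [complexPoints, Set.mem_ofPred_eq]
    rw [Scheme.Hom.comp_base, TopCat.coe_comp, Set.range_comp, Scheme.Opens.range_ι]
    constructor
    · rintro ⟨y, hy, hya⟩
      exact ⟨⟨y, hya⟩, (hU a).1 (hya ▸ (show i y ∈ U from hy))⟩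
    · rintro ⟨⟨y, hya⟩, h0⟩
      exact ⟨y, show i y ∈ U from hya ▸ (hU a).2 h0, hya⟩
  · refine cls_eq_add (V := Y) (Y := Y₁) (U := Y₂) I.subschemeι V.ι inferInstance inferInstance
      rfl rfl ?_
    rw [hrI, Scheme.Opens.range_ι, compl_compl]

end Points

/-! ### Zero patterns and constructible sets -/

section Constructible

variable {s : Type}

open MvPolynomial

/-- The membership in `C` of a point only depends on which of the polynomials in the finite set `Φ`
vanish at this point. -/
def Decides (Φ : Finset (MvPolynomial s ℂ)) (C : Set (s → ℂ)) : Prop :=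
  ∀ x y : s → ℂ, (∀ p ∈ Φ, eval x p = 0 ↔ eval y p = 0) → (x ∈ C ↔ y ∈ C)

/-- The constructible subsets of `ℂ^s`: those decided by the vanishing of finitely many
polynomials. -/
def IsCons (C : Set (s → ℂ)) : Prop := ∃ Φ, Decides Φ C

/-- The points at which the polynomials in `S`, and no other ones in `Φ`, vanish. -/
def atom (Φ S : Finset (MvPolynomial s ℂ)) : Set (s → ℂ) :=
  {x | ∀ p ∈ Φ, eval x p = 0 ↔ p ∈ S}

theorem Decides.mono {Φ Ψ : Finset (MvPolynomial s ℂ)} {C : Set (s → ℂ)} (h : Decides Φ C)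
    (hΦ : Φ ⊆ Ψ) : Decides Ψ C := fun x y hxy => h x y fun p hp => hxy p (hΦ hp)

/-- Sets decided by `Φ` are unions of atoms. -/
theorem Decides.inter_atom {Φ S : Finset (MvPolynomial s ℂ)} {C : Set (s → ℂ)}
    (h : Decides Φ C) : C ∩ atom Φ S = atom Φ S ∨ C ∩ atom Φ S = ∅ := by
  by_cases hne : (C ∩ atom Φ S).Nonempty
  · obtain ⟨x, hx, hxS⟩ := hne
    refine .inl (Set.inter_eq_right.2 fun y hy => (h x y fun p hp => ?_).1 hx)
    rw [hxS p hp, hy p hp]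
  · exact .inr (Set.not_nonempty_iff_eq_empty.1 hne)

open Classical in
theorem iUnion_inter_atom (Φ : Finset (MvPolynomial s ℂ)) (C : Set (s → ℂ)) :
    ⋃ S : Φ.powerset, C ∩ atom Φ S = C := by
  ext x
  simp only [Set.mem_iUnion, Set.mem_inter_iff, Subtype.exists, exists_prop]
  refine ⟨fun ⟨_, _, h, _⟩ => h, fun h => ⟨Φ.filter (fun p => eval x p = 0), ?_, h, ?_⟩⟩
  · simp
  · intro p hp
    simp [hp]

theorem pairwise_disjoint_inter_atom (Φ : Finset (MvPolynomial s ℂ)) (C : Set (s → ℂ)) :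
    Pairwise (fun S T : Φ.powerset => Disjoint (C ∩ atom Φ S) (C ∩ atom Φ T)) := by
  rintro ⟨S, hS⟩ ⟨T, hT⟩ hne
  rw [Set.disjoint_left]
  rintro x ⟨_, hxS⟩ ⟨_, hxT⟩
  rw [Finset.mem_powerset] at hS hT
  apply hne
  ext p
  constructor
  · exact fun hp => (hxT p (hS hp)).1 ((hxS p (hS hp)).2 hp)
  · exact fun hp => (hxS p (hT hp)).1 ((hxT p (hT hp)).2 hp)

theorem IsCons.compl {C : Set (s → ℂ)} (h : IsCons C) : IsCons Cᶜ := by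
  obtain ⟨Φ, h⟩ := h
  exact ⟨Φ, fun x y hxy => not_congr (h x y hxy)⟩

theorem IsCons.inter {C D : Set (s → ℂ)} (h : IsCons C) (h' : IsCons D) : IsCons (C ∩ D) := by
  classical
  obtain ⟨Φ, h⟩ := h
  obtain ⟨Ψ, h'⟩ := h'
  exact ⟨Φ ∪ Ψ, fun x y hxy => and_congr (h.mono Finset.subset_union_left x y hxy)
    (h'.mono Finset.subset_union_right x y hxy)⟩

theorem isCons_zero (p : MvPolynomial s ℂ) : IsCons {x | eval x p = 0} :=
  ⟨{p}, fun x y hxy => hxy p (by simp)⟩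

theorem isCons_ne_zero (p : MvPolynomial s ℂ) : IsCons {x | eval x p ≠ 0} :=
  (isCons_zero p).compl

theorem isCons_univ : IsCons (Set.univ : Set (s → ℂ)) := ⟨∅, fun x y _ => by simp⟩

theorem IsCons.biInter {ι : Type*} (I : Finset ι) {C : ι → Set (s → ℂ)}
    (h : ∀ i ∈ I, IsCons (C i)) : IsCons (⋂ i ∈ I, C i) := by
  classical
  induction I using Finset.induction_on with
  | empty => simpa using isCons_univ
  | insert a I ha ih =>
    rw [Finset.set_biInter_insert]
    exact (h a (by simp)).inter (ih fun i hi => h i (by simp [hi]))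

theorem IsCons.biUnion {ι : Type*} (I : Finset ι) {C : ι → Set (s → ℂ)}
    (h : ∀ i ∈ I, IsCons (C i)) : IsCons (⋃ i ∈ I, C i) := by
  have := (IsCons.biInter I fun i hi => (h i hi).compl).compl
  simpa [Set.compl_iInter] using this

theorem isCons_setOf_forall {ι : Type*} [Finite ι] {p : ι → (s → ℂ) → Prop}
    (h : ∀ i, IsCons {x | p i x}) : IsCons {x | ∀ i, p i x} := by
  have := Fintype.ofFinite ι
  have h' := IsCons.biInter Finset.univ (C := fun i => {x | p i x}) fun i _ => h i
  convert h' using 1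
  ext x
  simp

theorem isCons_setOf_and {p q : (s → ℂ) → Prop} (hp : IsCons {x | p x}) (hq : IsCons {x | q x}) :
    IsCons {x | p x ∧ q x} := hp.inter hq

theorem isCons_setOf_not {p : (s → ℂ) → Prop} (hp : IsCons {x | p x}) :
    IsCons {x | ¬ p x} := hp.compl

theorem isCons_setOf_imp {p q : (s → ℂ) → Prop} (hp : IsCons {x | p x}) (hq : IsCons {x | q x}) :
    IsCons {x | p x → q x} := by
  convert (hp.inter hq.compl).compl using 1
  ext x
  simp

theorem isCons_setOf_const (p : Prop) : IsCons {_x : s → ℂ | p} :=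
  ⟨∅, fun _ _ _ => Iff.rfl⟩

/-! ### Classes of locally closed sets -/

/-- The set `Z ⊆ ℂ^s` is the set of complex points of a locally closed subvariety of class `c`. -/
def IsLocClass (Z : Set (s → ℂ)) (c : K0) : Prop :=
  ∃ (Y : CVar) (i : Y.X ⟶ Spec (CommRingCat.of (MvPolynomial s ℂ))),
    IsImmersion i ∧ i ≫ affineStr s = Y.str ∧ complexPoints i = Z ∧ Y.cls = c

theorem IsLocClass.unique [Finite s] {Z : Set (s → ℂ)} {c c' : K0} (h : IsLocClass Z c)
    (h' : IsLocClass Z c') : c = c' := by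
  obtain ⟨Y, i, hi, hs, rfl, rfl⟩ := h
  obtain ⟨Y', i', hi', hs', hc, rfl⟩ := h'
  exact cls_eq_of_complexPoints_eq i i' hi hi' hs hs' hc.symm

theorem IsLocClass.cut {Z : Set (s → ℂ)} {c : K0} (h : IsLocClass Z c) (p : MvPolynomial s ℂ) :
    ∃ c₁ c₂, IsLocClass {a ∈ Z | eval a p = 0} c₁ ∧ IsLocClass {a ∈ Z | eval a p ≠ 0} c₂ ∧
      c = c₁ + c₂ := by
  obtain ⟨Y, i, hi, hs, rfl, rfl⟩ := h
  obtain ⟨Y₁, Y₂, i₁, i₂, hi₁, hi₂, hs₁, hs₂, h₁, h₂, hc⟩ := exists_cut Y i hi hs p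
  exact ⟨_, _, ⟨Y₁, i₁, hi₁, hs₁, h₁, rfl⟩, ⟨Y₂, i₂, hi₂, hs₂, h₂, rfl⟩, hc⟩

/-- A locally closed subvariety is cut into its intersections with the atoms of any finite set of
polynomials, which again are locally closed subvarieties. -/
theorem IsLocClass.exists_sum {Z : Set (s → ℂ)} {c : K0} (h : IsLocClass Z c)
    (Φ : Finset (MvPolynomial s ℂ)) :
    ∃ f : Finset (MvPolynomial s ℂ) → K0,
      (∀ S ∈ Φ.powerset, IsLocClass (Z ∩ atom Φ S) (f S)) ∧ c = ∑ S ∈ Φ.powerset, f S := by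
  classical
  induction Φ using Finset.induction_on with
  | empty =>
    refine ⟨fun _ => c, fun S _ => ?_, by simp⟩
    convert h using 1
    simp [atom]
  | insert p Φ hp ih =>
    obtain ⟨f, hf, hc⟩ := ih
    choose! g₁ g₂ h₁ h₂ hg using fun S (hS : S ∈ Φ.powerset) => (hf S hS).cut p
    refine ⟨fun S => if p ∈ S then g₁ (S.erase p) else g₂ S, fun S hS => ?_, ?_⟩
    · rw [Finset.mem_powerset] at hS
      by_cases hpS : p ∈ S
      · simp only [hpS, if_true]
        have hS' : S.erase p ∈ Φ.powerset := by
          rw [Finset.mem_powerset]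
          intro q hq
          rw [Finset.mem_erase] at hq
          exact (Finset.mem_insert.1 (hS hq.2)).resolve_left hq.1
        convert h₁ _ hS' using 1
        ext a
        simp only [atom, Set.mem_inter_iff, Set.mem_ofPred_eq, Finset.mem_insert,
          forall_eq_or_imp, hpS, iff_true, Finset.mem_erase]
        constructor
        · rintro ⟨ha, hap, h'⟩
          refine ⟨⟨ha, fun q hq => ?_⟩, hap⟩
          rw [h' q hq]
          exact ⟨fun h => ⟨fun e => hp (e ▸ hq), h⟩, fun h => h.2⟩
        · rintro ⟨⟨ha, h'⟩, hap⟩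
          refine ⟨ha, hap, fun q hq => ?_⟩
          rw [h' q hq]
          exact ⟨fun h => h.2, fun h => ⟨fun e => hp (e ▸ hq), h⟩⟩
      · simp only [hpS, if_false]
        have hS' : S ∈ Φ.powerset := by
          rw [Finset.mem_powerset]
          intro q hq
          exact (Finset.mem_insert.1 (hS hq)).resolve_left fun e => hpS (e ▸ hq)
        convert h₂ _ hS' using 1
        ext a
        simp only [atom, Set.mem_inter_iff, Set.mem_ofPred_eq, Finset.mem_insert,
          forall_eq_or_imp, hpS, iff_false]
        tauto
    · rw [hc, Finset.sum_powerset_insert hp, ← Finset.sum_add_distrib]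
      refine Finset.sum_congr rfl fun S hS => ?_
      have hpS : p ∉ S := fun h => hp (Finset.mem_powerset.1 hS h)
      rw [hg S hS]
      simp [hpS, add_comm]

/-- By the Hilbert basis theorem, zero loci are defined by finitely many polynomials. -/
theorem exists_finset_zeroLocus [Finite s] (T : Set (MvPolynomial s ℂ)) :
    ∃ Φ : Finset (MvPolynomial s ℂ), PrimeSpectrum.zeroLocus (Φ : Set (MvPolynomial s ℂ)) =
      PrimeSpectrum.zeroLocus T := by
  obtain ⟨Φ, hΦ⟩ := (isNoetherianRing_iff_ideal_fg _).1
    (inferInstanceAs (IsNoetherianRing (MvPolynomial s ℂ))) (Ideal.span T)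
  exact ⟨Φ, by rw [← PrimeSpectrum.zeroLocus_span, hΦ, PrimeSpectrum.zeroLocus_span]⟩

/-- Locally closed sets are decided by finitely many polynomials. -/
theorem IsLocClass.isCons [Finite s] {Z : Set (s → ℂ)} {c : K0} (h : IsLocClass Z c) :
    IsCons Z := by
  obtain ⟨Y, i, hi, hs, rfl, rfl⟩ := h
  obtain ⟨U, F, hU, hF, hUF⟩ := i.isLocallyClosed_range
  have hU' : IsClosed (X := PrimeSpectrum (MvPolynomial s ℂ)) Uᶜ := hU.isClosed_compl
  have hF' : IsClosed (X := PrimeSpectrum (MvPolynomial s ℂ)) F := hF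
  obtain ⟨T, hT⟩ := (PrimeSpectrum.isClosed_iff_zeroLocus _).1 hU'
  obtain ⟨T', hT'⟩ := (PrimeSpectrum.isClosed_iff_zeroLocus _).1 hF'
  obtain ⟨Φ, hΦ⟩ := exists_finset_zeroLocus T
  obtain ⟨Φ', hΦ'⟩ := exists_finset_zeroLocus T'
  have key : ∀ (Ψ : Finset (MvPolynomial s ℂ)) (a : s → ℂ),
      (pointToPoint (k := ℂ) a : PrimeSpectrum (MvPolynomial s ℂ)) ∈
        PrimeSpectrum.zeroLocus (Ψ : Set (MvPolynomial s ℂ)) ↔ ∀ p : Ψ, eval a p.1 = 0 := by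
    intro Ψ a
    rw [PrimeSpectrum.mem_zeroLocus]
    constructor
    · exact fun h p => (mem_vanishingIdeal_singleton_iff a p.1).1 (h p.2)
    · exact fun h p hp => (mem_vanishingIdeal_singleton_iff a p).2 (h ⟨p, hp⟩)
  have heq : complexPoints i =
      {a | (¬ ∀ p : Φ, eval a p.1 = 0) ∧ ∀ p : Φ', eval a p.1 = 0} := by
    ext a
    rw [complexPoints, Set.mem_ofPred_eq, Set.mem_ofPred_eq, hUF, ← key, ← key, hΦ, hΦ', ← hT,
      ← hT']
    exact ⟨fun h => ⟨fun h' => h' h.1, h.2⟩, fun h => ⟨not_not.1 h.1, h.2⟩⟩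
  rw [heq]
  exact isCons_setOf_and (isCons_setOf_not (isCons_setOf_forall fun p => isCons_zero p.1))
    (isCons_setOf_forall fun p => isCons_zero p.1)

theorem hasClass_iff {C : Set (s → ℂ)} {c : K0} :
    HasClass C c ↔ ∃ (r : ℕ) (Z : Fin r → Set (s → ℂ)) (d : Fin r → K0),
      (∀ j, IsLocClass (Z j) (d j)) ∧ Pairwise (fun j k => Disjoint (Z j) (Z k)) ∧
      C = ⋃ j, Z j ∧ c = ∑ j, d j := by
  constructor
  · rintro ⟨r, Y, i, h1, h2, h3, h4, h5⟩
    exact ⟨r, fun j => complexPoints (i j), fun j => (Y j).cls,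
      fun j => ⟨Y j, i j, h1 j, h2 j, rfl, rfl⟩, h3, h4, h5⟩
  · rintro ⟨r, Z, d, h1, h2, h3, h4⟩
    choose Y i hi hs hZ hd using h1
    refine ⟨r, Y, i, hi, hs, ?_, ?_, ?_⟩
    · simpa only [hZ] using h2
    · simpa only [hZ] using h3
    · simpa only [hd] using h4

theorem hasClass_iUnion {ι : Type*} [Fintype ι] {Z : ι → Set (s → ℂ)} {d : ι → K0}
    (h : ∀ j, IsLocClass (Z j) (d j)) (hd : Pairwise (fun j k => Disjoint (Z j) (Z k))) :
    HasClass (⋃ j, Z j) (∑ j, d j) := by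
  let e := Fintype.equivFin ι
  refine hasClass_iff.2 ⟨_, Z ∘ e.symm, d ∘ e.symm, fun j => h _, ?_, ?_, ?_⟩
  · exact fun j k hjk => hd (e.symm.injective.ne hjk)
  · exact (e.symm.surjective.iUnion_comp Z).symm
  · exact (e.symm.sum_comp d).symm

end Constructible

/-! ### Regular functions -/

section Regular

variable {s : Type}

open MvPolynomial

/-- The function `F` is given on `Z` by a fraction of polynomials whose denominator has no zero
on `Z`. -/
def RegOn (Z : Set (s → ℂ)) (F : (s → ℂ) → ℂ) : Prop :=
  ∃ p g : MvPolynomial s ℂ, ∀ x ∈ Z, eval x g ≠ 0 ∧ F x = eval x p / eval x g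

theorem RegOn.mono {Z W : Set (s → ℂ)} {F : (s → ℂ) → ℂ} (h : RegOn Z F) (hW : W ⊆ Z) :
    RegOn W F := by
  obtain ⟨p, g, h⟩ := h
  exact ⟨p, g, fun x hx => h x (hW hx)⟩

theorem regOn_eval (Z : Set (s → ℂ)) (p : MvPolynomial s ℂ) : RegOn Z fun x => eval x p :=
  ⟨p, 1, fun x _ => by simp⟩

theorem regOn_coord (Z : Set (s → ℂ)) (i : s) : RegOn Z fun x => x i := by
  simpa using regOn_eval Z (X i)

theorem regOn_const (Z : Set (s → ℂ)) (c : ℂ) : RegOn Z fun _ => c := by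
  simpa using regOn_eval Z (C c)

theorem RegOn.add {Z : Set (s → ℂ)} {F G : (s → ℂ) → ℂ} (hF : RegOn Z F) (hG : RegOn Z G) :
    RegOn Z fun x => F x + G x := by
  obtain ⟨p, g, hF⟩ := hF
  obtain ⟨q, h, hG⟩ := hG
  refine ⟨p * h + q * g, g * h, fun x hx => ?_⟩
  obtain ⟨h1, h2⟩ := hF x hx
  obtain ⟨h3, h4⟩ := hG x hx
  refine ⟨by simp [h1, h3], ?_⟩
  change F x + G x = _
  rw [h2, h4]
  simp only [map_add, map_mul]
  field_simp

theorem RegOn.mul {Z : Set (s → ℂ)} {F G : (s → ℂ) → ℂ} (hF : RegOn Z F) (hG : RegOn Z G) :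
    RegOn Z fun x => F x * G x := by
  obtain ⟨p, g, hF⟩ := hF
  obtain ⟨q, h, hG⟩ := hG
  refine ⟨p * q, g * h, fun x hx => ?_⟩
  obtain ⟨h1, h2⟩ := hF x hx
  obtain ⟨h3, h4⟩ := hG x hx
  refine ⟨by simp [h1, h3], ?_⟩
  change F x * G x = _
  rw [h2, h4]
  simp only [map_mul]
  field_simp

theorem RegOn.div {Z : Set (s → ℂ)} {F G : (s → ℂ) → ℂ} (hF : RegOn Z F) (hG : RegOn Z G)
    (h0 : ∀ x ∈ Z, G x ≠ 0) : RegOn Z fun x => F x / G x := by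
  obtain ⟨p, g, hF⟩ := hF
  obtain ⟨q, h, hG⟩ := hG
  refine ⟨p * h, g * q, fun x hx => ?_⟩
  obtain ⟨h1, h2⟩ := hF x hx
  obtain ⟨h3, h4⟩ := hG x hx
  have h5 : eval x q ≠ 0 := fun h5 => h0 x hx (by rw [h4, h5, zero_div])
  refine ⟨by simp [h1, h5], ?_⟩
  change F x / G x = _
  rw [h2, h4]
  simp only [map_mul]
  field_simp

theorem RegOn.neg {Z : Set (s → ℂ)} {F : (s → ℂ) → ℂ} (hF : RegOn Z F) :
    RegOn Z fun x => - F x := by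
  simpa using (regOn_const Z (-1)).mul hF

theorem RegOn.sub {Z : Set (s → ℂ)} {F G : (s → ℂ) → ℂ} (hF : RegOn Z F) (hG : RegOn Z G) :
    RegOn Z fun x => F x - G x := by
  simpa [sub_eq_add_neg] using hF.add hG.neg

/-- The algebra of regular functions on `Z ⊆ ℂ^s`. -/
def Reg (Z : Set (s → ℂ)) : Subalgebra ℂ (Z → ℂ) where
  carrier := {F | ∃ p g : MvPolynomial s ℂ, ∀ x : Z, eval x.1 g ≠ 0 ∧
    F x = eval x.1 p / eval x.1 g}
  mul_mem' := by
    rintro F G ⟨p, g, hF⟩ ⟨q, h, hG⟩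
    refine ⟨p * q, g * h, fun x => ?_⟩
    obtain ⟨h1, h2⟩ := hF x
    obtain ⟨h3, h4⟩ := hG x
    refine ⟨by simp [h1, h3], ?_⟩
    rw [Pi.mul_apply, h2, h4]
    simp only [map_mul]
    field_simp
  add_mem' := by
    rintro F G ⟨p, g, hF⟩ ⟨q, h, hG⟩
    refine ⟨p * h + q * g, g * h, fun x => ?_⟩
    obtain ⟨h1, h2⟩ := hF x
    obtain ⟨h3, h4⟩ := hG x
    refine ⟨by simp [h1, h3], ?_⟩
    rw [Pi.add_apply, h2, h4]
    simp only [map_add, map_mul]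
    field_simp
  algebraMap_mem' c := ⟨C c, 1, fun x => by simp⟩

instance (Z : Set (s → ℂ)) : _root_.IsReduced (Reg Z) :=
  isReduced_of_injective (Reg Z).val Subtype.val_injective

/-- The restriction of polynomials to `Z`. -/
def polyToReg (Z : Set (s → ℂ)) : MvPolynomial s ℂ →ₐ[ℂ] Reg Z :=
  aeval fun i => ⟨fun x => x.1 i, X i, 1, fun x => by simp⟩

@[simp]
theorem polyToReg_apply (Z : Set (s → ℂ)) (p : MvPolynomial s ℂ) (x : Z) :
    (polyToReg Z p).1 x = eval x.1 p := by
  have : ((Pi.evalAlgHom ℂ (fun _ : Z => ℂ) x).comp (Reg Z).val).comp (polyToReg Z) =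
      aeval x.1 := by
    ext i
    simp [polyToReg]
  exact DFunLike.congr_fun this p

/-- The class of `Spec` of the algebra of regular functions on `Z`. The value `0` if this algebra is
not of finite type is a junk value; on basic locally closed sets the algebra is of finite type. -/
def regCls (Z : Set (s → ℂ)) : K0 :=
  open Classical in
  if _h : Algebra.FiniteType ℂ (Reg Z) then
    (CVar.spec (Reg Z)).cls else 0

theorem cls_spec_eq_of_algEquiv {A B : Type} [CommRing A] [Algebra ℂ A] [_root_.IsReduced A]
    [Algebra.FiniteType ℂ A] [CommRing B] [Algebra ℂ B] [_root_.IsReduced B]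
    [Algebra.FiniteType ℂ B] (e : A ≃ₐ[ℂ] B) : (CVar.spec A).cls = (CVar.spec B).cls := by
  let i : CommRingCat.of B ≅ CommRingCat.of A := e.symm.toRingEquiv.toCommRingCatIso
  refine cls_eq_of_iso (V := CVar.spec A) (W := CVar.spec B) (Scheme.Spec.mapIso i.op) ?_
  change Spec.map i.hom ≫ Spec.map _ = Spec.map _
  rw [← Spec.map_comp]
  congr 1
  ext c
  exact e.symm.commutes c

theorem regCls_eq_of_algEquiv {t : Type} {Z : Set (s → ℂ)} {W : Set (t → ℂ)}
    (e : Reg Z ≃ₐ[ℂ] Reg W) : regCls Z = regCls W := by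
  have hiff : Algebra.FiniteType ℂ (Reg Z) ↔ Algebra.FiniteType ℂ (Reg W) :=
    ⟨fun h => h.equiv e, fun h => h.equiv e.symm⟩
  by_cases h : Algebra.FiniteType ℂ (Reg Z)
  · have h' := hiff.1 h
    rw [regCls, regCls, dif_pos h, dif_pos h']
    exact cls_spec_eq_of_algEquiv e
  · rw [regCls, regCls, dif_neg h, dif_neg (mt hiff.2 h)]

/-- If `V` is empty, then `V` is the disjoint union of two copies of itself. -/
theorem cls_eq_zero_of_isEmpty {V : CVar} (h : IsEmpty V.X) : V.cls = 0 := by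
  -- the identity is both a closed and an open immersion with complementary images
  have := cls_eq_add (V := V) (Y := V) (U := V) (𝟙 _) (𝟙 _) inferInstance inferInstance
    (by simp) (by simp) (by ext x; exact h.elim x)
  simpa using this

theorem regCls_empty : regCls (∅ : Set (s → ℂ)) = 0 := by
  by_cases h : Algebra.FiniteType ℂ (Reg (∅ : Set (s → ℂ)))
  · rw [regCls, dif_pos h]
    exact cls_eq_zero_of_isEmpty
      (inferInstanceAs (IsEmpty (PrimeSpectrum (Reg (∅ : Set (s → ℂ))))))
  · rw [regCls, dif_neg h]

/-- The set of points at which the polynomials in `S` vanish and `g` does not vanish. -/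
def basicLoc (S : Set (MvPolynomial s ℂ)) (g : MvPolynomial s ℂ) : Set (s → ℂ) :=
  {x | (∀ p ∈ S, eval x p = 0) ∧ eval x g ≠ 0}

theorem atom_eq_basicLoc {Φ S : Finset (MvPolynomial s ℂ)} (hS : S ⊆ Φ) :
    atom Φ S = basicLoc (S : Set (MvPolynomial s ℂ)) (∏ p ∈ open Classical in Φ \ S, p) := by
  classical
  ext x
  simp only [atom, basicLoc, Set.mem_ofPred_eq, map_prod, Finset.mem_coe, Finset.prod_ne_zero_iff,
    Finset.mem_sdiff]
  constructor
  · exact fun h => ⟨fun p hp => (h p (hS hp)).2 hp, fun p hp h0 => hp.2 ((h p hp.1).1 h0)⟩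
  · rintro ⟨h1, h2⟩ p hp
    exact ⟨fun h0 => by_contra fun hpS => h2 p ⟨hp, hpS⟩ h0, h1 p⟩

/-- By the Nullstellensatz, the regular functions on a basic locally closed set are the fractions
with a power of the defining denominator. -/
theorem exists_eq_div_pow [Finite s] {S : Set (MvPolynomial s ℂ)} {g : MvPolynomial s ℂ}
    (F : Reg (basicLoc S g)) :
    ∃ (p : MvPolynomial s ℂ) (N : ℕ), ∀ x, F.1 x = eval x.1 p / eval x.1 g ^ N := by
  obtain ⟨F, p, h, hF⟩ := F
  -- `g` vanishes on the common zeros of `S` and of the denominator `h`, so a power of `g` is a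
  -- multiple of `h` on `basicLoc S g`
  have hg : g ∈ vanishingIdeal ℂ (zeroLocus ℂ (Ideal.span (insert h S))) := by
    rw [mem_vanishingIdeal_iff, zeroLocus_span]
    intro x hx
    simp only [Set.mem_insert_iff, forall_eq_or_imp, Set.mem_ofPred_eq] at hx ⊢
    by_contra hgx
    exact (hF ⟨x, hx.2, hgx⟩).1 hx.1
  rw [vanishingIdeal_zeroLocus_eq_radical] at hg
  obtain ⟨N, hN⟩ := hg
  rw [Ideal.mem_span_insert] at hN
  obtain ⟨a, z, hz, hN⟩ := hN
  refine ⟨p * a, N, fun x => ?_⟩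
  have hz0 : eval x.1 z = 0 := by
    have : Ideal.span S ≤ RingHom.ker (eval x.1) :=
      Ideal.span_le.2 fun p hp => x.2.1 p hp
    exact this hz
  have hx := congrArg (eval x.1) hN
  rw [map_pow, map_add, map_mul, hz0, add_zero] at hx
  obtain ⟨h1, h2⟩ := hF x
  have hg0 : eval x.1 g ^ N ≠ 0 := pow_ne_zero _ x.2.2
  change F x = _
  rw [h2, map_mul, div_eq_div_iff h1 hg0, hx]
  ring

/-- The inverse of the denominator of a basic locally closed set. -/
def invDenom (S : Set (MvPolynomial s ℂ)) (g : MvPolynomial s ℂ) : Reg (basicLoc S g) :=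
  ⟨fun x => 1 / eval x.1 g, 1, g, fun x => ⟨x.2.2, by simp⟩⟩

theorem polyToReg_mul_invDenom (S : Set (MvPolynomial s ℂ)) (g : MvPolynomial s ℂ) :
    polyToReg (basicLoc S g) g * invDenom S g = 1 := by
  ext x
  have := x.2.2
  change (polyToReg (basicLoc S g) g).1 x * (1 / eval x.1 g) = 1
  rw [polyToReg_apply]
  field_simp

theorem exists_eq_mul_invDenom_pow [Finite s] {S : Set (MvPolynomial s ℂ)} {g : MvPolynomial s ℂ}
    (F : Reg (basicLoc S g)) :
    ∃ (p : MvPolynomial s ℂ) (N : ℕ), F = polyToReg _ p * invDenom S g ^ N := by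
  obtain ⟨p, N, h⟩ := exists_eq_div_pow F
  refine ⟨p, N, ?_⟩
  ext x
  change F.1 x = (polyToReg (basicLoc S g) p).1 x * (1 / eval x.1 g) ^ N
  rw [polyToReg_apply, h, one_div, inv_pow, div_eq_mul_inv]

instance [Finite s] (S : Set (MvPolynomial s ℂ)) (g : MvPolynomial s ℂ) :
    Algebra.FiniteType ℂ (Reg (basicLoc S g)) := by
  let φ : MvPolynomial (Option s) ℂ →ₐ[ℂ] Reg (basicLoc S g) :=
    aeval fun i => i.elim (invDenom S g) fun i => polyToReg _ (X i)
  have hφ : φ.comp (rename some) = polyToReg _ := by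
    ext i : 1
    simp [φ]
  refine Algebra.FiniteType.of_surjective φ fun F => ?_
  obtain ⟨p, N, rfl⟩ := exists_eq_mul_invDenom_pow F
  refine ⟨rename some p * X none ^ N, ?_⟩
  rw [map_mul, map_pow, ← hφ]
  simp [φ]

/-- A ring homomorphism `R → A` that makes `g` invertible, and such that `R` and the inverse of
`g` generate `A`, defines a closed subscheme of the basic open subset of `g`. -/
theorem isImmersion_specMap {R A : Type} [CommRing R] [CommRing A] (f : R →+* A) (g : R) (u : A)
    (hu : f g * u = 1) (hs : ∀ a : A, ∃ (p : R) (N : ℕ), a = f p * u ^ N) :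
    IsImmersion (Spec.map (CommRingCat.ofHom f)) := by
  have hg : IsUnit (f g) := IsUnit.of_mul_eq_one _ hu
  let ψ : Localization.Away g →+* A := IsLocalization.Away.lift g hg
  have hψ : ψ.comp (algebraMap _ _) = f := IsLocalization.Away.lift_comp g hg
  have hψs : Function.Surjective ψ := by
    intro F
    obtain ⟨p, N, rfl⟩ := hs F
    refine ⟨algebraMap _ _ p * IsLocalization.Away.invSelf g ^ N, ?_⟩
    have h1 : ∀ q, ψ (algebraMap _ _ q) = f q := fun q => RingHom.congr_fun hψ q
    have h2 : ψ (IsLocalization.Away.invSelf g) = u := by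
      have h3 := congrArg ψ (IsLocalization.Away.mul_invSelf (S := Localization.Away g) g)
      rw [map_mul, h1, map_one] at h3
      exact (hg.mul_right_inj).1 (h3.trans hu.symm)
    rw [map_mul, map_pow, h1, h2]
  have h1 : IsClosedImmersion (Spec.map (CommRingCat.ofHom ψ)) :=
    IsClosedImmersion.spec_of_surjective _ hψs
  have h3 : IsOpenImmersion (Spec.map (CommRingCat.ofHom
      (algebraMap R (Localization.Away g)))) := inferInstance
  rw [← hψ, CommRingCat.ofHom_comp, Spec.map_comp]
  infer_instance

/-- The regular functions on a basic locally closed set define a locally closed subvariety of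
affine space with the expected complex points. -/
theorem isLocClass_basicLoc [Finite s] (S : Set (MvPolynomial s ℂ)) (g : MvPolynomial s ℂ) :
    IsLocClass (basicLoc S g) (regCls (basicLoc S g)) := by
  have hu : IsUnit (polyToReg (basicLoc S g) g) :=
    IsUnit.of_mul_eq_one _ (polyToReg_mul_invDenom S g)
  let ι : Spec (CommRingCat.of (Reg (basicLoc S g))) ⟶ Spec (CommRingCat.of (MvPolynomial s ℂ)) :=
    Spec.map (CommRingCat.ofHom (polyToReg (basicLoc S g) : MvPolynomial s ℂ →+* _))
  refine ⟨CVar.spec (Reg (basicLoc S g)), ι, ?_, ?_, ?_, ?_⟩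
  · exact isImmersion_specMap _ g (invDenom S g) (polyToReg_mul_invDenom S g)
      exists_eq_mul_invDenom_pow
  · change Spec.map _ ≫ Spec.map _ = Spec.map _
    rw [← Spec.map_comp]
    exact congrArg Spec.map
      (CommRingCat.hom_ext (RingHom.ext fun c => (polyToReg (basicLoc S g)).commutes c))
  · ext a
    constructor
    · rintro ⟨P, hP⟩
      -- a prime over the complex point `a` forces the equations at `a`, and `g` is a unit
      have hP' : ∀ q : MvPolynomial s ℂ, polyToReg (basicLoc S g) q ∈ P.asIdeal ↔ eval a q = 0 := by
        intro q
        have : P.asIdeal.comap (polyToReg (basicLoc S g) : MvPolynomial s ℂ →+* _) =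
          vanishingIdeal ℂ {a} := congrArg PrimeSpectrum.asIdeal hP
        have h := Ideal.ext_iff.1 this q
        rw [mem_vanishingIdeal_singleton_iff] at h
        exact h
      refine ⟨fun p hp => ?_, fun h0 => ?_⟩
      · rw [← hP']
        convert P.asIdeal.zero_mem
        ext x
        rw [polyToReg_apply]
        exact x.2.1 p hp
      · rw [← hP'] at h0
        exact P.isPrime.ne_top (Ideal.eq_top_of_isUnit_mem _ h0 hu)
    · intro ha
      let ev : Reg (basicLoc S g) →ₐ[ℂ] ℂ :=
        (Pi.evalAlgHom ℂ (fun _ : basicLoc S g => ℂ) ⟨a, ha⟩).comp (Reg _).val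
      refine ⟨⟨RingHom.ker (ev : Reg (basicLoc S g) →+* ℂ), RingHom.ker_isPrime _⟩, ?_⟩
      apply PrimeSpectrum.ext
      ext q
      refine Iff.trans ?_ (mem_vanishingIdeal_singleton_iff a q).symm
      change (polyToReg (basicLoc S g) q).1 ⟨a, ha⟩ = 0 ↔ _
      rw [polyToReg_apply]; rfl
  · rw [regCls, dif_pos]

end Regular

/-! ### Classes of constructible sets -/

section Classes

variable {s t : Type} [Finite s] [Finite t]

open MvPolynomial

/-- The set `Z` is cut out by polynomial equations and one polynomial inequation. -/
def IsBasic (Z : Set (s → ℂ)) : Prop := ∃ S g, Z = basicLoc S g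

theorem IsBasic.isLocClass {Z : Set (s → ℂ)} (h : IsBasic Z) : IsLocClass Z (regCls Z) := by
  obtain ⟨S, g, rfl⟩ := h
  exact isLocClass_basicLoc S g

omit [Finite s] in
theorem isBasic_empty : IsBasic (∅ : Set (s → ℂ)) := ⟨∅, 0, by simp [basicLoc]⟩

omit [Finite s] in
theorem IsBasic.inter_zero {Z : Set (s → ℂ)} (h : IsBasic Z) (p : MvPolynomial s ℂ) :
    IsBasic {x ∈ Z | eval x p = 0} := by
  obtain ⟨S, g, rfl⟩ := h
  refine ⟨insert p S, g, ?_⟩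
  ext x
  simp only [basicLoc, Set.mem_ofPred_eq, Set.mem_insert_iff, forall_eq_or_imp]
  tauto

omit [Finite s] in
theorem IsBasic.inter_ne_zero {Z : Set (s → ℂ)} (h : IsBasic Z) (p : MvPolynomial s ℂ) :
    IsBasic {x ∈ Z | eval x p ≠ 0} := by
  obtain ⟨S, g, rfl⟩ := h
  refine ⟨S, g * p, ?_⟩
  ext x
  simp only [basicLoc, Set.mem_ofPred_eq, map_mul, mul_ne_zero_iff]
  tauto

omit [Finite s] in
theorem Decides.isBasic {Φ S : Finset (MvPolynomial s ℂ)} {C : Set (s → ℂ)}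
    (h : Decides Φ C) (hS : S ⊆ Φ) : IsBasic (C ∩ atom Φ S) := by
  rcases h.inter_atom (S := S) with h | h
  · rw [h, atom_eq_basicLoc hS]
    exact ⟨_, _, rfl⟩
  · rw [h]
    exact isBasic_empty

theorem Decides.isLocClass {Φ S : Finset (MvPolynomial s ℂ)} {C : Set (s → ℂ)}
    (h : Decides Φ C) (hS : S ⊆ Φ) : IsLocClass (C ∩ atom Φ S) (regCls (C ∩ atom Φ S)) :=
  (h.isBasic hS).isLocClass

/-- The sum of the classes of the atoms with respect to `Φ` that make up `C`. -/
def atomSum (Φ : Finset (MvPolynomial s ℂ)) (C : Set (s → ℂ)) : K0 :=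
  ∑ S : Φ.powerset, regCls (C ∩ atom Φ S)

omit [Finite s] in
/-- On each atom at most one of the disjoint sets is nonempty, and it then contains the atom. -/
theorem atomSum_iUnion {ι : Type*} [Fintype ι] {Φ : Finset (MvPolynomial s ℂ)}
    {Z : ι → Set (s → ℂ)} (h : ∀ j, Decides Φ (Z j))
    (hd : Pairwise (fun j k => Disjoint (Z j) (Z k))) :
    atomSum Φ (⋃ j, Z j) = ∑ j, atomSum Φ (Z j) := by
  simp only [atomSum]
  rw [Finset.sum_comm]
  refine Finset.sum_congr rfl fun S _ => ?_
  rw [Set.iUnion_inter]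
  by_cases hex : ∃ j, (Z j ∩ atom Φ S).Nonempty
  · obtain ⟨j, hj⟩ := hex
    have hj' : Z j ∩ atom Φ S = atom Φ S :=
      (h j).inter_atom.resolve_right hj.ne_empty
    have hother : ∀ k, k ≠ j → Z k ∩ atom Φ S = ∅ := by
      intro k hk
      rw [← hj', ← Set.inter_assoc, (hd hk).inter_eq, Set.empty_inter]
    rw [Finset.sum_eq_single j (fun k _ hk => by rw [hother k hk, regCls_empty]) (by simp)]
    congr 1
    refine subset_antisymm (Set.iUnion_subset fun k => ?_)
      (Set.subset_iUnion (fun k => Z k ∩ atom Φ S) j)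
    rw [hj']
    exact Set.inter_subset_right
  · have hall : ∀ k, Z k ∩ atom Φ S = ∅ := fun k =>
      Set.not_nonempty_iff_eq_empty.1 fun hk => hex ⟨k, hk⟩
    simp [hall, regCls_empty]

theorem Decides.hasClass {Φ : Finset (MvPolynomial s ℂ)} {C : Set (s → ℂ)}
    (h : Decides Φ C) : HasClass C (atomSum Φ C) := by
  have := hasClass_iUnion (Z := fun S : Φ.powerset => C ∩ atom Φ S)
    (d := fun S => regCls (C ∩ atom Φ S))
    (fun S => h.isLocClass (Finset.mem_powerset.1 S.2)) (pairwise_disjoint_inter_atom Φ C)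
  rwa [iUnion_inter_atom] at this

theorem IsLocClass.eq_atomSum {Z : Set (s → ℂ)} {c : K0} (h : IsLocClass Z c)
    {Φ : Finset (MvPolynomial s ℂ)} (hΦ : Decides Φ Z) : c = atomSum Φ Z := by
  obtain ⟨f, hf, hc⟩ := h.exists_sum Φ
  rw [hc, atomSum, ← Finset.sum_coe_sort]
  exact Finset.sum_congr rfl fun S _ =>
    (hf S S.2).unique (hΦ.isLocClass (Finset.mem_powerset.1 S.2))

/-- For all sufficiently large `Φ`, the class given by a decomposition into locally closed
subvarieties is the sum over the atoms of `Φ`; the latter does not refer to the decomposition. -/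
theorem HasClass.exists_eq_atomSum {C : Set (s → ℂ)} {c : K0} (h : HasClass C c) :
    ∃ Φ₀, ∀ Φ, Φ₀ ⊆ Φ → c = atomSum Φ C := by
  classical
  obtain ⟨r, Z, d, h1, h2, rfl, rfl⟩ := hasClass_iff.1 h
  choose Φ hΦ using fun j => (h1 j).isCons
  refine ⟨Finset.univ.biUnion Φ, fun Ψ hΨ => ?_⟩
  have hdec : ∀ j, Decides Ψ (Z j) := fun j =>
    (hΦ j).mono ((Finset.subset_biUnion_of_mem Φ (Finset.mem_univ j)).trans hΨ)
  rw [atomSum_iUnion hdec h2]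
  exact Finset.sum_congr rfl fun j _ => (h1 j).eq_atomSum (hdec j)

/-- The class of a constructible set is well defined. -/
theorem HasClass.unique {C : Set (s → ℂ)} {c c' : K0} (h : HasClass C c) (h' : HasClass C c') :
    c = c' := by
  classical
  obtain ⟨Φ, hΦ⟩ := h.exists_eq_atomSum
  obtain ⟨Ψ, hΨ⟩ := h'.exists_eq_atomSum
  rw [hΦ _ Finset.subset_union_left, hΨ _ Finset.subset_union_right]

theorem IsCons.existsUnique_hasClass {C : Set (s → ℂ)} (h : IsCons C) : ∃! c, HasClass C c := by
  obtain ⟨Φ, hΦ⟩ := h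
  exact ⟨_, hΦ.hasClass, fun c hc => hc.unique hΦ.hasClass⟩

theorem HasClass.cls_eq {C : Set (s → ℂ)} {c : K0} (h : HasClass C c) :
    cls C = algebraMap K0 MC c := by
  have hex : ∃ c, HasClass C c := ⟨c, h⟩
  rw [cls, dif_pos hex, hex.choose_spec.unique h]

theorem IsLocClass.cls_eq {C : Set (s → ℂ)} {c : K0} (h : IsLocClass C c) :
    cls C = algebraMap K0 MC c := by
  have := hasClass_iUnion (ι := Unit) (Z := fun _ => C) (d := fun _ => c) (fun _ => h)
    (fun i j hij => (hij rfl).elim)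
  simp only [Set.iUnion_const, Finset.univ_unique, Finset.sum_const, Finset.card_singleton,
    one_smul] at this
  exact this.cls_eq

theorem cls_empty : cls (∅ : Set (s → ℂ)) = 0 := by
  have h : HasClass (∅ : Set (s → ℂ)) 0 := by
    have := hasClass_iUnion (s := s) (ι := Empty) (Z := fun _ => ∅) (d := fun _ => 0)
      (fun j => j.elim) (fun j => j.elim)
    simpa using this
  rw [h.cls_eq, map_zero]

theorem cls_iUnion {ι : Type*} [Fintype ι] {Z : ι → Set (s → ℂ)} (h : ∀ j, IsCons (Z j))
    (hd : Pairwise (fun j k => Disjoint (Z j) (Z k))) :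
    cls (⋃ j, Z j) = ∑ j, cls (Z j) := by
  classical
  choose Φ hΦ using h
  have hdec : ∀ j, Decides (Finset.univ.biUnion Φ) (Z j) := fun j =>
    (hΦ j).mono (Finset.subset_biUnion_of_mem Φ (Finset.mem_univ j))
  have hU : Decides (Finset.univ.biUnion Φ) (⋃ j, Z j) := fun x y hxy => by
    simp only [Set.mem_iUnion]
    exact exists_congr fun j => hdec j x y hxy
  rw [hU.hasClass.cls_eq, atomSum_iUnion hdec hd, map_sum]
  exact Finset.sum_congr rfl fun j _ => (hdec j).hasClass.cls_eq.symm

theorem cls_union {C D : Set (s → ℂ)} (hC : IsCons C) (hD : IsCons D) (h : Disjoint C D) :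
    cls (C ∪ D) = cls C + cls D := by
  rw [Set.union_eq_iUnion, cls_iUnion (Z := fun b : Bool => cond b C D)]
  · simp
  · rintro (_ | _) <;> assumption
  · rintro (_ | _) (_ | _) hne
    · exact (hne rfl).elim
    · exact h.symm
    · exact h
    · exact (hne rfl).elim

/-- Cutting a constructible set in two. -/
theorem cls_eq_add_of_split {C A B : Set (s → ℂ)} (hA : IsCons A) (hB : IsCons B)
    (h : ∀ x, x ∈ C ↔ x ∈ A ∨ x ∈ B) (hd : ∀ x, x ∈ A → x ∈ B → False) :
    cls C = cls A + cls B := by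
  rw [← cls_union hA hB (Set.disjoint_left.2 hd)]
  congr 1
  ext x
  exact h x

/-! ### Biregular maps -/

omit [Finite s] [Finite t] in
/-- The composition of a polynomial with a regular map is regular. -/
theorem RegOn.comp_eval {Z : Set (s → ℂ)} {φ : (s → ℂ) → t → ℂ}
    (hφ : ∀ i, RegOn Z fun x => φ x i) (p : MvPolynomial t ℂ) :
    RegOn Z fun x => eval (φ x) p := by
  induction p using MvPolynomial.induction_on with
  | C c => simpa using regOn_const Z c
  | add p q hp hq => simpa using hp.add hq
  | mul_X p i hp => simpa using hp.mul (hφ i)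

omit [Finite s] in
/-- The zero locus of a regular function is that of its numerator. -/
theorem RegOn.exists_zero_iff {Z : Set (s → ℂ)} {F : (s → ℂ) → ℂ} (h : RegOn Z F) :
    ∃ p : MvPolynomial s ℂ, ∀ x ∈ Z, F x = 0 ↔ eval x p = 0 := by
  obtain ⟨p, g, h⟩ := h
  exact ⟨p, fun x hx => by rw [(h x hx).2, div_eq_zero_iff, or_iff_left (h x hx).1]⟩

/-- Pulling back regular functions along a regular map. -/
def Reg.comap {Z : Set (s → ℂ)} {W : Set (t → ℂ)} (φ : (s → ℂ) → t → ℂ)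
    (hφ : ∀ i, RegOn Z fun x => φ x i) (hZ : Set.MapsTo φ Z W) : Reg W →ₐ[ℂ] Reg Z where
  toFun F := ⟨fun x => F.1 ⟨φ x, hZ x.2⟩, by
    obtain ⟨F, p, g, hF⟩ := F
    obtain ⟨q, h, H⟩ := (RegOn.comp_eval hφ p).div (RegOn.comp_eval hφ g)
      fun x hx => (hF ⟨φ x, hZ hx⟩).1
    exact ⟨q, h, fun x => ⟨(H x x.2).1, ((hF ⟨φ x, hZ x.2⟩).2).trans (H x x.2).2⟩⟩⟩
  map_one' := rfl
  map_mul' _ _ := rfl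
  map_zero' := rfl
  map_add' _ _ := rfl
  commutes' _ := rfl

omit [Finite s] [Finite t] in
/-- Pulling back regular functions along a biregular map is an isomorphism. -/
theorem regCls_congr {Z : Set (s → ℂ)} {W : Set (t → ℂ)} (φ : (s → ℂ) → t → ℂ)
    (ψ : (t → ℂ) → s → ℂ) (hφ : ∀ i, RegOn Z fun x => φ x i) (hψ : ∀ i, RegOn W fun y => ψ y i)
    (hZ : Set.MapsTo φ Z W) (hW : Set.MapsTo ψ W Z) (hl : ∀ x ∈ Z, ψ (φ x) = x)
    (hr : ∀ y ∈ W, φ (ψ y) = y) : regCls Z = regCls W := by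
  refine regCls_eq_of_algEquiv
    (AlgEquiv.ofAlgHom (Reg.comap ψ hψ hW) (Reg.comap φ hφ hZ) ?_ ?_)
  · refine AlgHom.ext fun F => Subtype.ext (funext fun y => ?_)
    exact congrArg F.1 (Subtype.ext (hr y y.2))
  · refine AlgHom.ext fun F => Subtype.ext (funext fun x => ?_)
    exact congrArg F.1 (Subtype.ext (hl x x.2))

omit [Finite s] [Finite t] in
/-- The preimage of a constructible set under a regular map is constructible. -/
theorem IsCons.inter_preimage {C : Set (s → ℂ)} (hC : IsCons C) {D : Set (t → ℂ)} (hD : IsCons D)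
    {φ : (s → ℂ) → t → ℂ} (hφ : ∀ i, RegOn C fun x => φ x i) :
    IsCons {x | x ∈ C ∧ φ x ∈ D} := by
  classical
  obtain ⟨Φ, hΦ⟩ := hC
  obtain ⟨Ψ, hΨ⟩ := hD
  choose n hn using fun q : MvPolynomial t ℂ => (RegOn.comp_eval hφ q).exists_zero_iff
  refine ⟨Φ ∪ Ψ.image n, fun x y hxy => ?_⟩
  have hxy1 : ∀ p ∈ Φ, eval x p = 0 ↔ eval y p = 0 := fun p hp =>
    hxy p (Finset.mem_union_left _ hp)
  have hC := hΦ x y hxy1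
  refine ⟨fun h => ⟨hC.1 h.1, (hΨ _ _ fun q hq => ?_).1 h.2⟩,
    fun h => ⟨hC.2 h.1, (hΨ _ _ fun q hq => ?_).2 h.2⟩⟩
  · rw [hn q x h.1, hn q y (hC.1 h.1)]
    exact hxy _ (Finset.mem_union_right _ (Finset.mem_image_of_mem n hq))
  · rw [hn q x (hC.2 h.1), hn q y h.1]
    exact hxy _ (Finset.mem_union_right _ (Finset.mem_image_of_mem n hq))

omit [Finite s] [Finite t] in
/-- The preimage of an atom under a regular map is, inside an atom of the source, again cut out by
polynomial equations and inequations. -/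
theorem isBasic_inter_preimage_atom {C : Set (s → ℂ)} {Φ S : Finset (MvPolynomial s ℂ)}
    {Ψ T : Finset (MvPolynomial t ℂ)} (hΦ : Decides Φ C) (hS : S ⊆ Φ)
    {φ : (s → ℂ) → t → ℂ} (hφ : ∀ i, RegOn C fun x => φ x i) :
    IsBasic {x | (x ∈ C ∧ x ∈ atom Φ S) ∧ φ x ∈ atom Ψ T} := by
  classical
  choose n hn using fun q : MvPolynomial t ℂ => (RegOn.comp_eval hφ q).exists_zero_iff
  induction Ψ using Finset.induction_on with
  | empty =>
    convert hΦ.isBasic hS using 1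
    ext x
    simp [atom]
  | insert q Ψ hq ih =>
    by_cases hqT : q ∈ T
    · convert ih.inter_zero (n q) using 1
      ext x
      simp only [Set.mem_ofPred_eq, atom, Finset.mem_insert, forall_eq_or_imp, hqT, iff_true]
      constructor
      · rintro ⟨hx, h1, h2⟩
        exact ⟨⟨hx, h2⟩, (hn q x hx.1).1 h1⟩
      · rintro ⟨⟨hx, h2⟩, h1⟩
        exact ⟨hx, (hn q x hx.1).2 h1, h2⟩
    · convert ih.inter_ne_zero (n q) using 1
      ext x
      simp only [Set.mem_ofPred_eq, atom, Finset.mem_insert, forall_eq_or_imp, hqT, iff_false]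
      constructor
      · rintro ⟨hx, h1, h2⟩
        exact ⟨⟨hx, h2⟩, mt (hn q x hx.1).2 h1⟩
      · rintro ⟨⟨hx, h2⟩, h1⟩
        exact ⟨hx, mt (hn q x hx.1).1 h1, h2⟩

/-- The class of a constructible set is invariant under biregular bijections. -/
theorem cls_congr {C : Set (s → ℂ)} {D : Set (t → ℂ)} (hC : IsCons C) (hD : IsCons D)
    (φ : (s → ℂ) → t → ℂ) (ψ : (t → ℂ) → s → ℂ) (hφ : ∀ i, RegOn C fun x => φ x i)
    (hψ : ∀ i, RegOn D fun y => ψ y i) (hCD : Set.MapsTo φ C D) (hDC : Set.MapsTo ψ D C)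
    (hl : ∀ x ∈ C, ψ (φ x) = x) (hr : ∀ y ∈ D, φ (ψ y) = y) : cls C = cls D := by
  obtain ⟨Φ, hΦ⟩ := id hC
  obtain ⟨Ψ, hΨ⟩ := id hD
  -- the common refinement of the atoms of `C` and the preimages of the atoms of `D`,
  -- transported by `φ` to the corresponding refinement on `D`
  let ZC : Φ.powerset × Ψ.powerset → Set (s → ℂ) := fun ST =>
    {x | (x ∈ C ∧ x ∈ atom Φ ST.1) ∧ φ x ∈ atom Ψ ST.2}
  let ZD : Φ.powerset × Ψ.powerset → Set (t → ℂ) := fun ST =>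
    {y | (y ∈ D ∧ y ∈ atom Ψ ST.2) ∧ ψ y ∈ atom Φ ST.1}
  have hZC : ∀ ST, IsBasic (ZC ST) := fun ST =>
    isBasic_inter_preimage_atom hΦ (Finset.mem_powerset.1 ST.1.2) hφ
  have hZD : ∀ ST, IsBasic (ZD ST) := fun ST =>
    isBasic_inter_preimage_atom hΨ (Finset.mem_powerset.1 ST.2.2) hψ
  have hUC : C = ⋃ ST, ZC ST := by
    ext x
    simp only [Set.mem_iUnion, ZC, Set.mem_ofPred_eq]
    refine ⟨fun hx => ?_, fun ⟨_, h, _⟩ => h.1⟩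
    have h1 := hx
    have h2 : φ x ∈ D := hCD hx
    rw [← iUnion_inter_atom Φ C, Set.mem_iUnion] at h1
    rw [← iUnion_inter_atom Ψ D, Set.mem_iUnion] at h2
    obtain ⟨S, hS⟩ := h1
    obtain ⟨T, hT⟩ := h2
    exact ⟨(S, T), hS, hT.2⟩
  have hUD : D = ⋃ ST, ZD ST := by
    ext y
    simp only [Set.mem_iUnion, ZD, Set.mem_ofPred_eq]
    refine ⟨fun hy => ?_, fun ⟨_, h, _⟩ => h.1⟩
    have h1 := hy
    have h2 : ψ y ∈ C := hDC hy
    rw [← iUnion_inter_atom Ψ D, Set.mem_iUnion] at h1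
    rw [← iUnion_inter_atom Φ C, Set.mem_iUnion] at h2
    obtain ⟨T, hT⟩ := h1
    obtain ⟨S, hS⟩ := h2
    exact ⟨(S, T), hT, hS.2⟩
  have hdC : Pairwise fun j k => Disjoint (ZC j) (ZC k) := by
    rintro ⟨S, T⟩ ⟨S', T'⟩ hne
    rw [Set.disjoint_left]
    rintro x ⟨⟨hx, hxS⟩, hxT⟩ ⟨⟨-, hxS'⟩, hxT'⟩
    apply hne
    have h1 : S = S' := by_contra fun h =>
      Set.disjoint_left.1 (pairwise_disjoint_inter_atom Φ C h) ⟨hx, hxS⟩ ⟨hx, hxS'⟩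
    have h2 : T = T' := by_contra fun h =>
      Set.disjoint_left.1 (pairwise_disjoint_inter_atom Ψ D h) ⟨hCD hx, hxT⟩ ⟨hCD hx, hxT'⟩
    rw [h1, h2]
  have hdD : Pairwise fun j k => Disjoint (ZD j) (ZD k) := by
    rintro ⟨S, T⟩ ⟨S', T'⟩ hne
    rw [Set.disjoint_left]
    rintro y ⟨⟨hy, hyT⟩, hyS⟩ ⟨⟨-, hyT'⟩, hyS'⟩
    apply hne
    have h1 : S = S' := by_contra fun h =>
      Set.disjoint_left.1 (pairwise_disjoint_inter_atom Φ C h) ⟨hDC hy, hyS⟩ ⟨hDC hy, hyS'⟩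
    have h2 : T = T' := by_contra fun h =>
      Set.disjoint_left.1 (pairwise_disjoint_inter_atom Ψ D h) ⟨hy, hyT⟩ ⟨hy, hyT'⟩
    rw [h1, h2]
  have key : ∀ ST, cls (ZC ST) = cls (ZD ST) := by
    intro ST
    rw [(hZC ST).isLocClass.cls_eq, (hZD ST).isLocClass.cls_eq]
    congr 1
    refine regCls_congr φ ψ (fun i => (hφ i).mono fun x hx => hx.1.1)
      (fun i => (hψ i).mono fun x hx => hx.1.1) ?_ ?_ (fun x hx => hl x hx.1.1)
      (fun y hy => hr y hy.1.1)
    · exact fun x hx => ⟨⟨hCD hx.1.1, hx.2⟩, by rw [hl x hx.1.1]; exact hx.1.2⟩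
    · exact fun y hy => ⟨⟨hDC hy.1.1, hy.2⟩, by rw [hr y hy.1.1]; exact hy.1.2⟩
  calc cls C = ∑ ST, cls (ZC ST) := by
        rw [← cls_iUnion (fun ST => (hZC ST).isLocClass.isCons) hdC, ← hUC]
    _ = ∑ ST, cls (ZD ST) := Finset.sum_congr rfl fun ST _ => key ST
    _ = cls D := by rw [← cls_iUnion (fun ST => (hZD ST).isLocClass.isCons) hdD, ← hUD]

end Classes

/-! ### Products with the affine line -/

section Line

open MvPolynomial

/-- `Spec A[T]` is the product of `Spec A` with the affine line. -/
theorem cls_spec_polynomial (A : Type) [CommRing A] [Algebra ℂ A] [_root_.IsReduced A]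
    [Algebra.FiniteType ℂ A] [_root_.IsReduced (Polynomial A)]
    [Algebra.FiniteType ℂ (Polynomial A)] :
    (CVar.spec (Polynomial A)).cls = lefschetz * (CVar.spec A).cls := by
  let _ : Algebra (Polynomial ℂ) (Polynomial A) :=
    (Polynomial.mapRingHom (algebraMap ℂ A)).toAlgebra
  have h1 := CommRingCat.isPushout_of_isPushout ℂ A (Polynomial ℂ) (Polynomial A)
  have h2 := (isPullback_SpecMap_of_isPushout _ _ _ _ h1).flip
  rw [lefschetz, CVar.cls, CVar.cls, CVar.cls, ← map_mul, Ideal.Quotient.eq]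
  refine Ideal.subset_span (K0Relation.prod _ _ _ _ _ h2 ?_)
  change Spec.map _ ≫ Spec.map _ = Spec.map _
  rw [← Spec.map_comp, ← CommRingCat.ofHom_comp, ← IsScalarTower.algebraMap_eq]

variable {s : Type} [DecidableEq s]

/-- The set `B ⊆ ℂ^s` is a cylinder in the direction of the coordinate `v`. -/
def IsCyl (v : s) (B : Set (s → ℂ)) : Prop := ∀ x y, x ∈ B ↔ Function.update x v y ∈ B

/-- Setting the variable `v` to zero in a polynomial. -/
def killVar (v : s) : MvPolynomial s ℂ →ₐ[ℂ] MvPolynomial s ℂ :=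
  aeval fun i => if i = v then 0 else X i

theorem eval_killVar (v : s) (x : s → ℂ) (p : MvPolynomial s ℂ) :
    eval x (killVar v p) = eval (Function.update x v 0) p := by
  induction p using MvPolynomial.induction_on with
  | C c => simp [killVar, algebraMap_eq]
  | add p q hp hq => simp [hp, hq]
  | mul_X p i hp =>
    rw [map_mul, map_mul, map_mul, hp]
    by_cases h : i = v
    · subst h; simp [killVar]
    · simp [killVar, h]

theorem eval_killVar_update (v : s) (x : s → ℂ) (y : ℂ) (p : MvPolynomial s ℂ) :
    eval (Function.update x v y) (killVar v p) = eval x (killVar v p) := by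
  simp [eval_killVar]

theorem isCyl_basicLoc {v : s} {S : Set (MvPolynomial s ℂ)} {g : MvPolynomial s ℂ}
    (hS : ∀ p ∈ S, ∃ q, p = killVar v q) (hg : ∃ q, g = killVar v q) : IsCyl v (basicLoc S g) := by
  intro x y
  obtain ⟨q, rfl⟩ := hg
  simp only [basicLoc, Set.mem_ofPred_eq, eval_killVar_update]
  refine and_congr_left' (forall₂_congr fun p hp => ?_)
  obtain ⟨q', rfl⟩ := hS p hp
  rw [eval_killVar_update]

theorem regOn_update (Z : Set (s → ℂ)) (v : s) (c : ℂ) (i : s) :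
    RegOn Z fun x => Function.update x v c i := by
  by_cases h : i = v
  · subst h; simpa using regOn_const Z c
  · simpa [h] using regOn_coord Z i

/-- Regular functions on a basic cylinder are polynomials in the free coordinate. -/
theorem regCls_basicLoc_cyl [Finite s] {v : s} {S : Set (MvPolynomial s ℂ)} {g : MvPolynomial s ℂ}
    (hS : ∀ p ∈ S, ∃ q, p = killVar v q) (hg : ∃ q, g = killVar v q) :
    regCls (basicLoc S g) = lefschetz * regCls (basicLoc (insert (X v) S) g) := by
  have hcyl := isCyl_basicLoc hS hg
  have hmem : ∀ x, x ∈ basicLoc (insert (X v) S) g ↔ x ∈ basicLoc S g ∧ x v = 0 := by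
    intro x
    simp only [basicLoc, Set.mem_ofPred_eq, Set.mem_insert_iff, forall_eq_or_imp, eval_X]
    tauto
  have hmaps : Set.MapsTo (fun x => Function.update x v 0) (basicLoc S g)
      (basicLoc (insert (X v) S) g) :=
    fun x hx => (hmem _).2 ⟨(hcyl x 0).1 hx, by simp⟩
  let ι : Reg (basicLoc (insert (X v) S) g) →ₐ[ℂ] Reg (basicLoc S g) :=
    Reg.comap (fun x => Function.update x v 0) (fun i => regOn_update _ v 0 i) hmaps
  let T : Reg (basicLoc S g) := polyToReg _ (X v)
  -- the polynomials in the coordinate function `x_v` over the regular functions on the base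
  let Θ : Polynomial (Reg (basicLoc (insert (X v) S) g)) →ₐ[ℂ] Reg (basicLoc S g) :=
    Polynomial.eval₂AlgHom ι T fun a => Commute.all _ _
  have hΘ : ∀ (P : Polynomial (Reg (basicLoc (insert (X v) S) g))) (x : basicLoc S g),
      (Θ P).1 x = (P.map ((Pi.evalRingHom (fun _ => ℂ)
        (⟨Function.update x.1 v 0, hmaps x.2⟩ : basicLoc (insert (X v) S) g)).comp
          (Reg (basicLoc (insert (X v) S) g)).val.toRingHom)).eval (x.1 v) := by
    intro P x
    rw [Polynomial.eval_map]
    have h1 : Θ P = Polynomial.eval₂ (ι : _ →+* Reg (basicLoc S g)) T P := rfl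
    have h2 := Polynomial.hom_eval₂ P (ι : _ →+* Reg (basicLoc S g))
      ((Pi.evalRingHom (fun _ => ℂ) x).comp (Reg (basicLoc S g)).val.toRingHom) T
    rw [h1]
    refine h2.trans ?_
    have h3 : ((Pi.evalRingHom (fun _ => ℂ) x).comp (Reg (basicLoc S g)).val.toRingHom) T =
        x.1 v := by
      change (polyToReg _ (X v)).1 x = _
      simp
    rw [h3]
    rfl
  -- a polynomial that vanishes at all complex values of the free coordinate is zero
  have hinj : Function.Injective Θ := by
    rw [injective_iff_map_eq_zero]
    intro P hP
    ext n z
    have hz := (hmem z.1).1 z.2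
    have h0 : (P.map ((Pi.evalRingHom (fun _ => ℂ) z).comp
          (Reg (basicLoc (insert (X v) S) g)).val.toRingHom)) = 0 := by
      refine Polynomial.funext fun c => ?_
      have h1 := hΘ P ⟨Function.update z.1 v c, (hcyl _ c).1 hz.1⟩
      have h2 : (⟨Function.update (Function.update z.1 v c) v 0,
          hmaps ((hcyl _ c).1 hz.1)⟩ : basicLoc (insert (X v) S) g) = z := by
        apply Subtype.ext
        simp only [Function.update_idem]
        rw [← hz.2, Function.update_eq_self]
      simp only [h2, Function.update_self] at h1
      rw [← h1, hP]
      simp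
    have h1 := congrArg (fun Q => Polynomial.coeff Q n) h0
    simp only [Polynomial.coeff_map, Polynomial.coeff_zero] at h1
    exact h1
  have hsurj : Function.Surjective Θ := by
    have hpoly : ∀ p : MvPolynomial s ℂ, polyToReg (basicLoc S g) p ∈ Θ.range := by
      intro p
      have : (polyToReg (basicLoc S g)).range ≤ Θ.range := by
        rw [polyToReg, ← Algebra.adjoin_range_eq_range_aeval]
        refine Algebra.adjoin_le ?_
        rintro _ ⟨i, rfl⟩
        by_cases h : i = v
        · subst h
          refine ⟨Polynomial.X, ?_⟩
          ext x
          change (Θ Polynomial.X).1 x = x.1 i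
          rw [hΘ]
          simp
        · refine ⟨Polynomial.C (polyToReg _ (X i)), ?_⟩
          ext x
          change (Θ (Polynomial.C _)).1 x = x.1 i
          rw [hΘ]
          simp only [Polynomial.map_C, Polynomial.eval_C]
          change (polyToReg _ (X i)).1 _ = _
          rw [polyToReg_apply]
          simp [h]
      exact this ⟨p, rfl⟩
    have hinv : invDenom S g ∈ Θ.range := by
      refine ⟨Polynomial.C (invDenom _ g), ?_⟩
      ext x
      change (Θ (Polynomial.C _)).1 x = 1 / eval x.1 g
      rw [hΘ]
      simp only [Polynomial.map_C, Polynomial.eval_C]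
      change 1 / eval (Function.update x.1 v 0) g = _
      obtain ⟨q, rfl⟩ := hg
      rw [eval_killVar_update]
    intro F
    obtain ⟨p, N, rfl⟩ := exists_eq_mul_invDenom_pow F
    exact Θ.range.mul_mem (hpoly p) (Θ.range.pow_mem hinv N)
  have e := AlgEquiv.ofBijective Θ ⟨hinj, hsurj⟩
  have : Algebra.FiniteType ℂ (Polynomial (Reg (basicLoc (insert (X v) S) g))) :=
    Algebra.FiniteType.equiv (inferInstanceAs (Algebra.FiniteType ℂ (Reg (basicLoc S g)))) e.symm
  have : _root_.IsReduced (Polynomial (Reg (basicLoc (insert (X v) S) g))) :=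
    isReduced_of_injective Θ hinj
  have h1 : regCls (basicLoc S g) = (CVar.spec (Reg (basicLoc S g))).cls := by
    rw [regCls, dif_pos]
  have h2 : regCls (basicLoc (insert (X v) S) g) =
      (CVar.spec (Reg (basicLoc (insert (X v) S) g))).cls := by
    rw [regCls, dif_pos]
  rw [h1, h2, ← cls_spec_polynomial]
  exact cls_spec_eq_of_algEquiv e.symm

/-- The class `𝕃` in `M_ℂ`. -/
def Lm : MC := algebraMap K0 MC lefschetz

theorem Lm_mul_Linv : Lm * Linv = 1 := IsLocalization.Away.mul_invSelf lefschetz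

omit [DecidableEq s] in
theorem isCons_coord_zero (v : s) : IsCons {x : s → ℂ | x v = 0} := by
  simpa using isCons_zero (X v : MvPolynomial s ℂ)

/-- The class of a cylinder. -/
theorem cls_cyl [Finite s] {v : s} {B : Set (s → ℂ)} (hB : IsCons B) (hv : IsCyl v B) :
    cls B = Lm * cls {x | x ∈ B ∧ x v = 0} := by
  classical
  obtain ⟨Φ, hΦ⟩ := id hB
  -- a cylinder is decided by polynomials that do not involve the coordinate of its direction,
  -- and the corresponding atoms are cylinders
  let Ψ := Φ.image (killVar v)
  have hΨ : Decides Ψ B := by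
    intro x y hxy
    rw [hv x 0, hv y 0]
    refine hΦ _ _ fun p hp => ?_
    rw [← eval_killVar, ← eval_killVar]
    exact hxy _ (Finset.mem_image_of_mem _ hp)
  let Z : Ψ.powerset → Set (s → ℂ) := fun S => B ∩ atom Ψ S
  let Z' : Ψ.powerset → Set (s → ℂ) := fun S => {x | x ∈ Z S ∧ x v = 0}
  have hZ : ∀ S, IsBasic (Z S) := fun S => hΨ.isBasic (Finset.mem_powerset.1 S.2)
  have hZ' : ∀ S, IsBasic (Z' S) := fun S => by simpa [Z'] using (hZ S).inter_zero (X v)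
  have hd := pairwise_disjoint_inter_atom Ψ B
  have hd' : Pairwise fun S T => Disjoint (Z' S) (Z' T) := fun S T h =>
    (hd h).mono (fun x hx => hx.1) fun x hx => hx.1
  have hU : B = ⋃ S, Z S := (iUnion_inter_atom Ψ B).symm
  have hU' : {x | x ∈ B ∧ x v = 0} = ⋃ S, Z' S := by
    ext x
    simp only [Z', Set.mem_iUnion, Set.mem_ofPred_eq]
    rw [exists_and_right, ← Set.mem_iUnion, ← hU]
  rw [hU', cls_iUnion (fun S => (hZ' S).isLocClass.isCons) hd']
  conv_lhs => rw [hU]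
  rw [cls_iUnion (fun S => (hZ S).isLocClass.isCons) hd, Finset.mul_sum]
  refine Finset.sum_congr rfl fun S _ => ?_
  rw [(hZ S).isLocClass.cls_eq, (hZ' S).isLocClass.cls_eq, Lm, ← map_mul]
  congr 1
  rcases hΨ.inter_atom (S := S.1) with h | h
  · have hS := Finset.mem_powerset.1 S.2
    have hS1 : ∀ p ∈ (S.1 : Set (MvPolynomial s ℂ)), ∃ q, p = killVar v q := fun p hp => by
      obtain ⟨q, -, rfl⟩ := Finset.mem_image.1 (hS hp)
      exact ⟨q, rfl⟩
    have hg1 : ∃ q, ∏ p ∈ Ψ \ S.1, p = killVar v q := by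
      refine ⟨∏ p ∈ Ψ \ S.1, p, ?_⟩
      rw [map_prod]
      refine Finset.prod_congr rfl fun p hp => ?_
      obtain ⟨q, -, rfl⟩ := Finset.mem_image.1 (Finset.mem_sdiff.1 hp).1
      have hkk : (killVar v).comp (killVar v) = killVar v := by
        ext i : 1
        by_cases hi : i = v <;> simp [killVar, hi]
      exact (DFunLike.congr_fun hkk q).symm
    have e1 : Z S = basicLoc (S.1 : Set (MvPolynomial s ℂ)) (∏ p ∈ Ψ \ S.1, p) := by
      change B ∩ atom Ψ S = _
      rw [h, atom_eq_basicLoc hS]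
      congr!
    have e2 : Z' S = basicLoc (insert (X v) (S.1 : Set (MvPolynomial s ℂ))) (∏ p ∈ Ψ \ S.1, p) := by
      ext x
      simp only [Z', e1, basicLoc, Set.mem_ofPred_eq, Set.mem_insert_iff, forall_eq_or_imp, eval_X]
      tauto
    rw [e1, e2]
    exact regCls_basicLoc_cyl hS1 hg1
  · have e1 : Z S = ∅ := h
    have e2 : Z' S = ∅ := by simp [Z', e1]
    rw [e1, e2, regCls_empty, mul_zero]

theorem IsCyl.update_mem {v : s} {B : Set (s → ℂ)} (h : IsCyl v B) {x : s → ℂ} (hx : x ∈ B)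
    (y : ℂ) : Function.update x v y ∈ B := (h x y).1 hx

/-- The class of the points of a cylinder off the base is `(𝕃 - 1)` times that of the base. -/
theorem cls_cyl_ne_zero [Finite s] {v : s} {B : Set (s → ℂ)} (hB : IsCons B) (hv : IsCyl v B) :
    cls {x | x ∈ B ∧ x v ≠ 0} = (Lm - 1) * cls {x | x ∈ B ∧ x v = 0} := by
  have h := cls_eq_add_of_split (C := B) (hB.inter (isCons_coord_zero v))
    (hB.inter (isCons_coord_zero v).compl) (fun x => by
      simp only [Set.mem_inter_iff, Set.mem_compl_iff, Set.mem_ofPred_eq]; tauto)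
    (fun x h1 h2 => h2.2 h1.2)
  rw [cls_cyl hB hv] at h
  change _ = cls {x | x ∈ B ∧ x v = 0} + cls {x | x ∈ B ∧ x v ≠ 0} at h
  linear_combination -h

/-- On a cylinder over the coordinate `v`, an affine function `g x_v + b` of this coordinate with
invertible linear coefficient can be used as a new coordinate. -/
theorem cls_affine [Finite s] {v : s} {B : Set (s → ℂ)} (hB : IsCons B) (hv : IsCyl v B)
    (F g : MvPolynomial s ℂ) (hg : ∀ x ∈ B, eval x g ≠ 0)
    (hF : ∀ x ∈ B, ∀ y, eval (Function.update x v y) F =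
      eval (Function.update x v 0) F + eval x g * y)
    (E : Set ℂ) (hE : E = {0} ∨ E = {0}ᶜ) :
    cls {x | x ∈ B ∧ eval x F ∈ E} = cls {x | x ∈ B ∧ x v ∈ E} := by
  have hgu : ∀ x ∈ B, ∀ y, eval (Function.update x v y) g = eval x g := by
    intro x hx y
    have h1 := hF x hx 1
    have h2 := hF _ (hv.update_mem hx y) 1
    simp only [Function.update_idem] at h2
    rw [h1] at h2
    simpa using h2.symm
  have hFx : ∀ x ∈ B, eval x F = eval (Function.update x v 0) F + eval x g * x v := by
    intro x hx
    simpa using hF x hx (x v)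
  have hcons : ∀ p : MvPolynomial s ℂ, IsCons {x | x ∈ B ∧ eval x p ∈ E} := by
    intro p
    rcases hE with rfl | rfl
    · exact isCons_setOf_and hB (isCons_zero p)
    · exact isCons_setOf_and hB (isCons_ne_zero p)
  have hreg : ∀ (p : (s → ℂ) → Prop) (G : (s → ℂ) → ℂ), RegOn B G →
      ∀ i, RegOn {x | x ∈ B ∧ p x} fun x => Function.update x v (G x) i := by
    intro p G hG i
    by_cases h : i = v
    · subst h; simpa using hG.mono fun x hx => hx.1
    · simpa [h] using regOn_coord _ i
  -- the new coordinate and its inverse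
  refine cls_congr (hcons F) (by simpa using hcons (X v))
    (fun x => Function.update x v (eval x F))
    (fun x => Function.update x v ((x v - eval (Function.update x v 0) F) / eval x g))
    (hreg _ _ (regOn_eval _ _)) (hreg _ _ (((regOn_coord _ _).sub
      (RegOn.comp_eval (φ := fun x => Function.update x v 0) (regOn_update _ v 0) F)).div
        (regOn_eval _ _) hg)) ?_ ?_ ?_ ?_
  · rintro x ⟨hx, hxE⟩
    exact ⟨hv.update_mem hx _, by simpa using hxE⟩
  · rintro x ⟨hx, hxE⟩
    refine ⟨hv.update_mem hx _, ?_⟩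
    have := hg x hx
    rw [hF x hx]
    field_simp
    simpa using hxE
  · rintro x ⟨hx, hxE⟩
    have := hg x hx
    simp only [Function.update_self, Function.update_idem]
    rw [hgu x hx, hFx x hx, add_sub_cancel_left, mul_div_cancel_left₀ _ this,
      Function.update_eq_self]
  · rintro x ⟨hx, hxE⟩
    have := hg x hx
    simp only [Function.update_idem]
    rw [hF x hx]
    field_simp
    simp

theorem cls_affine_zero [Finite s] {v : s} {B : Set (s → ℂ)} (hB : IsCons B) (hv : IsCyl v B)
    (F g : MvPolynomial s ℂ) (hg : ∀ x ∈ B, eval x g ≠ 0)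
    (hF : ∀ x ∈ B, ∀ y, eval (Function.update x v y) F =
      eval (Function.update x v 0) F + eval x g * y) :
    cls {x | x ∈ B ∧ eval x F = 0} = cls {x | x ∈ B ∧ x v = 0} :=
  cls_affine hB hv F g hg hF {0} (.inl rfl)

theorem cls_affine_ne_zero [Finite s] {v : s} {B : Set (s → ℂ)} (hB : IsCons B) (hv : IsCyl v B)
    (F g : MvPolynomial s ℂ) (hg : ∀ x ∈ B, eval x g ≠ 0)
    (hF : ∀ x ∈ B, ∀ y, eval (Function.update x v y) F =
      eval (Function.update x v 0) F + eval x g * y) :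
    cls {x | x ∈ B ∧ eval x F ≠ 0} = (Lm - 1) * cls {x | x ∈ B ∧ x v = 0} := by
  rw [← cls_cyl_ne_zero hB hv]
  exact cls_affine hB hv F g hg hF {0}ᶜ (.inr rfl)

end Line

/-! ### Coefficients of `f` along a jet -/

section Jets

open MvPolynomial

/-- Moving one coordinate changes the value of a polynomial to first order by its partial
derivative. -/
theorem exists_eval_update_add {σ S : Type*} [DecidableEq σ] [CommRing S] (G : MvPolynomial σ S)
    (u : σ → S) (i : σ) (ε : S) :
    ∃ r, eval (Function.update u i (u i + ε)) G =
      eval u G + ε * eval u (pderiv i G) + ε ^ 2 * r := by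
  induction G using MvPolynomial.induction_on with
  | C c => exact ⟨0, by simp⟩
  | add p q hp hq =>
    obtain ⟨a, ha⟩ := hp
    obtain ⟨b, hb⟩ := hq
    exact ⟨a + b, by rw [map_add, ha, hb, map_add, map_add, map_add]; ring⟩
  | mul_X p j hp =>
    obtain ⟨a, ha⟩ := hp
    rw [map_mul, ha, map_mul, Derivation.leibniz, pderiv_X, eval_X, eval_X]
    by_cases h : j = i
    · subst h
      refine ⟨a * (u j + ε) + eval u (pderiv j p), ?_⟩
      simp
      ring
    · refine ⟨a * u j, ?_⟩
      simp [h]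
      ring

/-- The universal coefficient of `t^j` in `f(φ)`, as a polynomial in the coefficients of the
jet `φ`. -/
def jetCoeff {n : ℕ} (f : MvPolynomial (Fin n) ℂ) (l j : ℕ) :
    MvPolynomial (Fin n × Fin (l + 1)) ℂ :=
  PowerSeries.coeff j (aeval (fun ρ => ∑ κ : Fin (l + 1),
    PowerSeries.monomial (κ : ℕ) (X (ρ, κ) : MvPolynomial (Fin n × Fin (l + 1)) ℂ)) f)

/-- The power series with the coefficients of a jet. -/
def jetSeries {n l : ℕ} (a : Fin n × Fin (l + 1) → ℂ) (ρ : Fin n) : PowerSeries ℂ :=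
  ∑ κ : Fin (l + 1), PowerSeries.monomial (κ : ℕ) (a (ρ, κ))

variable {n l : ℕ}

/-- The polynomial `jetCoeff f l j` computes the coefficient of `t^j` in `f(φ)`. -/
theorem eval_jetCoeff (f : MvPolynomial (Fin n) ℂ) (j : ℕ) (a : Fin n × Fin (l + 1) → ℂ) :
    eval a (jetCoeff f l j) = PowerSeries.coeff j (aeval (jetSeries a) f) := by
  have h : ∀ g : MvPolynomial (Fin n) ℂ,
      PowerSeries.map (eval a) (aeval (fun ρ => ∑ κ : Fin (l + 1),
      PowerSeries.monomial (κ : ℕ) (X (ρ, κ) : MvPolynomial (Fin n × Fin (l + 1)) ℂ)) g) =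
      aeval (jetSeries a) g := by
    intro g
    induction g using MvPolynomial.induction_on with
    | C c =>
      rw [aeval_C, aeval_C, PowerSeries.algebraMap_apply, PowerSeries.algebraMap_apply,
        PowerSeries.map_C]
      simp [algebraMap_eq]
    | add p q hp hq => rw [map_add, map_add, hp, hq, map_add]
    | mul_X p i hp =>
      rw [map_mul, map_mul, hp, map_mul, aeval_X, aeval_X, jetSeries, map_sum]
      congr 1
      refine Finset.sum_congr rfl fun κ _ => ?_
      ext d
      rw [PowerSeries.coeff_map, PowerSeries.coeff_monomial, PowerSeries.coeff_monomial]
      split_ifs <;> simp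
  rw [← h, PowerSeries.coeff_map, jetCoeff]

theorem coeff_jetSeries (a : Fin n × Fin (l + 1) → ℂ) (ρ : Fin n) (d : ℕ) :
    PowerSeries.coeff d (jetSeries a ρ) = if h : d < l + 1 then a (ρ, ⟨d, h⟩) else 0 := by
  rw [jetSeries, map_sum]
  simp only [PowerSeries.coeff_monomial]
  split_ifs with h
  · rw [Finset.sum_eq_single ⟨d, h⟩]
    · simp
    · intro κ _ hκ
      rw [if_neg]
      rintro rfl
      exact hκ rfl
    · simp
  · refine Finset.sum_eq_zero fun κ _ => if_neg fun e => h (by have := κ.2; omega)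

/-- The part of `f` of weight `m` with respect to the weights `k`. -/
def initPart (f : MvPolynomial (Fin n) ℂ) (k : Fin n → ℕ) (m : ℕ) : MvPolynomial (Fin n) ℂ :=
  ∑ ω ∈ f.support with ∑ ρ, k ρ * ω ρ = m, monomial ω (f.coeff ω)

/-- The jet vanishes to order at least `k`. -/
def OrdGe (k : Fin n → ℕ) (a : Fin n × Fin (l + 1) → ℂ) : Prop :=
  ∀ ρ, ∀ κ : Fin (l + 1), (κ : ℕ) < k ρ → a (ρ, κ) = 0

/-- The coefficients of `t^k` of a jet. -/
def lead (k : Fin n → ℕ) (a : Fin n × Fin (l + 1) → ℂ) (ρ : Fin n) : ℂ :=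
  if h : k ρ < l + 1 then a (ρ, ⟨k ρ, h⟩) else 0

/-- The quotient by `t^k` of a jet that vanishes to order at least `k`. -/
def jetQuot (k : Fin n → ℕ) (a : Fin n × Fin (l + 1) → ℂ) (ρ : Fin n) : PowerSeries ℂ :=
  PowerSeries.mk fun d => PowerSeries.coeff (d + k ρ) (jetSeries a ρ)

theorem jetSeries_eq_mul {k : Fin n → ℕ} {a : Fin n × Fin (l + 1) → ℂ} (h : OrdGe k a)
    (ρ : Fin n) : jetSeries a ρ = PowerSeries.X ^ k ρ * jetQuot k a ρ := by
  ext d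
  rw [PowerSeries.coeff_X_pow_mul']
  split_ifs with hd
  · rw [jetQuot, PowerSeries.coeff_mk, Nat.sub_add_cancel hd]
  · rw [coeff_jetSeries]
    split_ifs with hd'
    · exact h ρ ⟨d, hd'⟩ (not_le.1 hd)
    · rfl

theorem constantCoeff_jetQuot (k : Fin n → ℕ) (a : Fin n × Fin (l + 1) → ℂ) (ρ : Fin n) :
    PowerSeries.constantCoeff (jetQuot k a ρ) = lead k a ρ := by
  rw [← PowerSeries.coeff_zero_eq_constantCoeff_apply, jetQuot, PowerSeries.coeff_mk, zero_add,
    coeff_jetSeries, lead]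

/-- The polynomial `f(t^k u) / t^m` in `u`. -/
def weighted (f : MvPolynomial (Fin n) ℂ) (k : Fin n → ℕ) (m : ℕ) :
    MvPolynomial (Fin n) (PowerSeries ℂ) :=
  ∑ ω ∈ f.support, monomial ω (PowerSeries.C (f.coeff ω) *
    PowerSeries.X ^ (∑ ρ, k ρ * ω ρ - m))

/-- Modulo `t`, the polynomial `f(t^k u) / t^m` is the initial part of `f`. -/
theorem map_weighted {f : MvPolynomial (Fin n) ℂ} {k : Fin n → ℕ} {m : ℕ}
    (hm : ∀ ω ∈ f.support, m ≤ ∑ ρ, k ρ * ω ρ) :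
    MvPolynomial.map PowerSeries.constantCoeff (weighted f k m) = initPart f k m := by
  rw [weighted, initPart, map_sum, Finset.sum_filter]
  refine Finset.sum_congr rfl fun ω hω => ?_
  rw [map_monomial]
  split_ifs with h
  · simp [h]
  · have : ∑ ρ, k ρ * ω ρ - m ≠ 0 := by have := hm ω hω; omega
    simp [this]

theorem aeval_jetSeries {f : MvPolynomial (Fin n) ℂ} {k : Fin n → ℕ} {m : ℕ}
    (hm : ∀ ω ∈ f.support, m ≤ ∑ ρ, k ρ * ω ρ) {a : Fin n × Fin (l + 1) → ℂ} (h : OrdGe k a) :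
    aeval (jetSeries a) f = PowerSeries.X ^ m * eval (jetQuot k a) (weighted f k m) := by
  rw [weighted, map_sum, Finset.mul_sum]
  conv_lhs => rw [f.as_sum, map_sum]
  refine Finset.sum_congr rfl fun ω hω => ?_
  rw [aeval_monomial, eval_monomial, Finsupp.prod_fintype _ _ (by simp),
    Finsupp.prod_fintype _ _ (by simp)]
  simp only [jetSeries_eq_mul h, mul_pow, Finset.prod_mul_distrib, ← pow_mul,
    Finset.prod_pow_eq_pow_sum]
  have : PowerSeries.X ^ (∑ ρ, k ρ * ω ρ) =
      (PowerSeries.X : PowerSeries ℂ) ^ m * PowerSeries.X ^ (∑ ρ, k ρ * ω ρ - m) := by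
    rw [← pow_add, Nat.add_sub_cancel' (hm ω hω)]
  rw [this]
  change PowerSeries.C _ * _ = _
  ring

/-- Along a jet of order at least `k`, the order of `f` is at least `m`. -/
theorem eval_jetCoeff_of_lt {f : MvPolynomial (Fin n) ℂ} {k : Fin n → ℕ} {m : ℕ}
    (hm : ∀ ω ∈ f.support, m ≤ ∑ ρ, k ρ * ω ρ) {a : Fin n × Fin (l + 1) → ℂ} (h : OrdGe k a)
    {j : ℕ} (hj : j < m) : eval a (jetCoeff f l j) = 0 := by
  rw [eval_jetCoeff, aeval_jetSeries hm h, PowerSeries.coeff_X_pow_mul', if_neg (not_le.2 hj)]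

/-- The coefficient of `t^m` of `f(φ)` is the value of the initial part of `f` at the leading
coefficients of `φ`. -/
theorem eval_jetCoeff_self {f : MvPolynomial (Fin n) ℂ} {k : Fin n → ℕ} {m : ℕ}
    (hm : ∀ ω ∈ f.support, m ≤ ∑ ρ, k ρ * ω ρ) {a : Fin n × Fin (l + 1) → ℂ} (h : OrdGe k a) :
    eval a (jetCoeff f l m) = eval (lead k a) (initPart f k m) := by
  rw [eval_jetCoeff, aeval_jetSeries hm h, PowerSeries.coeff_X_pow_mul', if_pos le_rfl,
    Nat.sub_self, PowerSeries.coeff_zero_eq_constantCoeff_apply, ← map_weighted hm,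
    MvPolynomial.eval_map, ← coe_eval₂Hom, ← RingHom.comp_apply]
  congr 1
  ext x
  · simp
  · simp [constantCoeff_jetQuot]

theorem OrdGe.update {k : Fin n → ℕ} {a : Fin n × Fin (l + 1) → ℂ} (h : OrdGe k a) {ρ₀ : Fin n}
    {κ₀ : Fin (l + 1)} (hκ : k ρ₀ ≤ κ₀) (y : ℂ) : OrdGe k (Function.update a (ρ₀, κ₀) y) := by
  intro ρ κ hκρ
  rw [Function.update_of_ne, h ρ κ hκρ]
  rintro ⟨⟩
  omega

/-- Changing the coefficient of `t^{k+j}` of a component of a jet changes `φ / t^k` by a multiple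
of `t^j` in this component. -/
theorem jetQuot_update {k : Fin n → ℕ} (a : Fin n × Fin (l + 1) → ℂ) {ρ₀ : Fin n}
    {κ₀ : Fin (l + 1)} {j : ℕ} (hκ : (κ₀ : ℕ) = k ρ₀ + j) (y : ℂ) :
    jetQuot k (Function.update a (ρ₀, κ₀) y) =
      Function.update (jetQuot k (Function.update a (ρ₀, κ₀) 0)) ρ₀
        (jetQuot k (Function.update a (ρ₀, κ₀) 0) ρ₀ + PowerSeries.C y * PowerSeries.X ^ j) := by
  ext ρ d
  by_cases hρ : ρ = ρ₀
  · subst hρ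
    simp only [Function.update_self, map_add, jetQuot, PowerSeries.coeff_mk, coeff_jetSeries,
      PowerSeries.coeff_C_mul, PowerSeries.coeff_X_pow]
    by_cases hd : d = j
    · subst hd
      have hlt : d + k ρ < l + 1 := by have := κ₀.2; omega
      have he : (⟨d + k ρ, hlt⟩ : Fin (l + 1)) = κ₀ := Fin.ext (by simp; omega)
      simp [hlt, he]
    · simp only [hd, if_false, mul_zero, add_zero]
      split_ifs with hlt
      · have he : (⟨d + k ρ, hlt⟩ : Fin (l + 1)) ≠ κ₀ := by
          rintro rfl
          simp at hκ
          omega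
        rw [Function.update_of_ne (by simpa using he), Function.update_of_ne (by simpa using he)]
      · rfl
  · rw [Function.update_of_ne hρ]
    simp only [jetQuot, PowerSeries.coeff_mk, coeff_jetSeries]
    split_ifs with hlt
    · rw [Function.update_of_ne (by simp [hρ]), Function.update_of_ne (by simp [hρ])]
    · rfl

theorem lead_update {k : Fin n → ℕ} (a : Fin n × Fin (l + 1) → ℂ) {ρ₀ : Fin n}
    {κ₀ : Fin (l + 1)} (hκ : k ρ₀ < κ₀) (y : ℂ) :
    lead k (Function.update a (ρ₀, κ₀) y) = lead k a := by
  ext ρ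
  rw [lead, lead]
  split_ifs with h
  · rw [Function.update_of_ne]
    rintro ⟨⟩
    simp at hκ
  · rfl

/-- The coefficient of `t^{m+j}` of `f(φ)` depends affinely on the coefficient of `t^{k+j}` of a
component of `φ`, with the partial derivative of the initial part of `f` as linear
coefficient. -/
theorem eval_jetCoeff_update {f : MvPolynomial (Fin n) ℂ} {k : Fin n → ℕ} {m : ℕ}
    (hm : ∀ ω ∈ f.support, m ≤ ∑ ρ, k ρ * ω ρ) {a : Fin n × Fin (l + 1) → ℂ} (h : OrdGe k a)
    {ρ₀ : Fin n} {κ₀ : Fin (l + 1)} {j : ℕ} (hj : 1 ≤ j) (hκ : (κ₀ : ℕ) = k ρ₀ + j) (y : ℂ)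
    {i : ℕ} (hi : i ≤ j) :
    eval (Function.update a (ρ₀, κ₀) y) (jetCoeff f l (m + i)) =
      eval (Function.update a (ρ₀, κ₀) 0) (jetCoeff f l (m + i)) +
        if i = j then eval (lead k a) (pderiv ρ₀ (initPart f k m)) * y else 0 := by
  have hk : k ρ₀ ≤ κ₀ := by omega
  rw [eval_jetCoeff, eval_jetCoeff, aeval_jetSeries hm (h.update hk y),
    aeval_jetSeries hm (h.update hk 0), PowerSeries.coeff_X_pow_mul', PowerSeries.coeff_X_pow_mul',
    if_pos (Nat.le_add_right _ _), if_pos (Nat.le_add_right _ _), Nat.add_sub_cancel_left,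
    jetQuot_update a hκ]
  set u := jetQuot k (Function.update a (ρ₀, κ₀) 0) with hu
  obtain ⟨r, hr⟩ := exists_eval_update_add (weighted f k m) u ρ₀
    (PowerSeries.C y * PowerSeries.X ^ j)
  rw [hr, map_add, map_add]
  have h1 : PowerSeries.coeff i ((PowerSeries.C y * PowerSeries.X ^ j) ^ 2 * r) = 0 := by
    have : (PowerSeries.C y * PowerSeries.X ^ j) ^ 2 * r =
        PowerSeries.X ^ (j * 2) * (PowerSeries.C y ^ 2 * r) := by ring
    rw [this, PowerSeries.coeff_X_pow_mul', if_neg (by omega)]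
  have h2 : PowerSeries.constantCoeff (eval u (pderiv ρ₀ (weighted f k m))) =
      eval (lead k a) (pderiv ρ₀ (initPart f k m)) := by
    rw [← map_weighted hm, pderiv_map, MvPolynomial.eval_map, ← coe_eval₂Hom, ← RingHom.comp_apply]
    congr 1
    ext x
    · simp
    · simp only [RingHom.coe_comp, Function.comp_apply, eval_X, coe_eval₂Hom, eval₂_X, hu]
      rw [constantCoeff_jetQuot, lead_update a (by omega)]
  rw [h1, add_zero, mul_assoc, PowerSeries.coeff_C_mul, PowerSeries.coeff_X_pow_mul']
  congr 1
  split_ifs with h3 h4 h4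
  · rw [h4, Nat.sub_self, PowerSeries.coeff_zero_eq_constantCoeff_apply, h2, mul_comm]
  · omega
  · omega
  · simp

end Jets

/-! ### Classes of jets of given orders -/

section Cylinders

open MvPolynomial

variable {s : Type} [DecidableEq s]

omit [DecidableEq s] in
theorem IsCons.sep {B : Set (s → ℂ)} (hB : IsCons B) {p : (s → ℂ) → Prop}
    (hp : IsCons {x | p x}) : IsCons {x | x ∈ B ∧ p x} := hB.inter hp

theorem isCyl_of_forall {v : s} {B : Set (s → ℂ)}
    (h : ∀ x ∈ B, ∀ y, Function.update x v y ∈ B) : IsCyl v B := by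
  refine fun x y => ⟨fun hx => h x hx y, fun hx => ?_⟩
  simpa using h _ hx (x v)

theorem IsCyl.inter {v : s} {B D : Set (s → ℂ)} (hB : IsCyl v B) (hD : IsCyl v D) :
    IsCyl v {x | x ∈ B ∧ x ∈ D} := fun x y => and_congr (hB x y) (hD x y)

theorem IsCyl.inter_coord_zero {v w : s} {B : Set (s → ℂ)} (hB : IsCyl v B) (h : w ≠ v) :
    IsCyl v {x | x ∈ B ∧ x w = 0} := fun x y => by
  simp only [Set.mem_ofPred_eq, Function.update_of_ne h, ← hB x y]

theorem cls_cyl_finset [Finite s] {B : Set (s → ℂ)} (hB : IsCons B) {E : Finset s}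
    (hE : ∀ v ∈ E, IsCyl v B) : cls B = Lm ^ E.card * cls {x | x ∈ B ∧ ∀ v ∈ E, x v = 0} := by
  induction E using Finset.induction_on generalizing B with
  | empty => simp
  | insert v E hv ih =>
    rw [cls_cyl hB (hE v (by simp)), ih (hB.sep (isCons_coord_zero v))
      fun w hw => (hE w (by simp [hw])).inter_coord_zero fun e => hv (e ▸ hw),
      Finset.card_insert_of_notMem hv, pow_succ', mul_assoc]
    congr 3
    ext x
    simp only [Set.mem_ofPred_eq, Finset.mem_insert, forall_eq_or_imp, and_assoc]

theorem cls_cyl_ne_zero_finset [Finite s] {B : Set (s → ℂ)} (hB : IsCons B) {E : Finset s}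
    (hE : ∀ v ∈ E, IsCyl v B) : cls {x | x ∈ B ∧ ∀ v ∈ E, x v ≠ 0} =
      (Lm - 1) ^ E.card * cls {x | x ∈ B ∧ ∀ v ∈ E, x v = 0} := by
  induction E using Finset.induction_on generalizing B with
  | empty => simp
  | insert v E hv ih =>
    have hB' : IsCons {x | x ∈ B ∧ ∀ w ∈ E, x w ≠ 0} := by
      refine hB.sep ?_
      have := isCons_setOf_forall (ι := E) (p := fun w (x : s → ℂ) => x w.1 ≠ 0)
        fun w => isCons_setOf_not (isCons_coord_zero w.1)
      simpa using this
    have hcyl : IsCyl v {x | x ∈ B ∧ ∀ w ∈ E, x w ≠ 0} := by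
      refine isCyl_of_forall fun x hx y => ⟨(hE v (by simp) x y).1 hx.1, fun w hw => ?_⟩
      have hwv : w ≠ v := fun e => hv (e ▸ hw)
      rw [Function.update_of_ne hwv]
      exact hx.2 w hw
    have h1 := cls_cyl_ne_zero hB' hcyl
    have h2 := ih (hB.sep (isCons_coord_zero v))
      fun w hw => (hE w (by simp [hw])).inter_coord_zero fun e => hv (e ▸ hw)
    have e1 : {x | x ∈ B ∧ ∀ w ∈ insert v E, x w ≠ 0} =
        {x | x ∈ {x | x ∈ B ∧ ∀ w ∈ E, x w ≠ 0} ∧ x v ≠ 0} := by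
      ext x
      simp only [Set.mem_ofPred_eq, Finset.mem_insert, forall_eq_or_imp]
      tauto
    have e2 : {x | x ∈ {x | x ∈ B ∧ ∀ w ∈ E, x w ≠ 0} ∧ x v = 0} =
        {x | x ∈ {x | x ∈ B ∧ x v = 0} ∧ ∀ w ∈ E, x w ≠ 0} := by
      ext x
      simp only [Set.mem_ofPred_eq]
      tauto
    rw [e1, h1, e2, h2, Finset.card_insert_of_notMem hv, pow_succ', mul_assoc]
    congr 4
    ext x
    simp only [Set.mem_ofPred_eq, Finset.mem_insert, forall_eq_or_imp, and_assoc]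

omit [DecidableEq s] in
/-- The class of a point is the unit: its regular functions are the constants. -/
theorem cls_point [Finite s] : cls {x : s → ℂ | ∀ i, x i = 0} = 1 := by
  have e : {x : s → ℂ | ∀ i, x i = 0} = basicLoc (Set.range X) 1 := by
    ext x
    simp [basicLoc]
  have h : IsBasic {x : s → ℂ | ∀ i, x i = 0} := ⟨_, _, e⟩
  rw [h.isLocClass.cls_eq]
  have h0 : (0 : s → ℂ) ∈ {x : s → ℂ | ∀ i, x i = 0} := fun _ => rfl
  have hft : Algebra.FiniteType ℂ (Reg {x : s → ℂ | ∀ i, x i = 0}) := by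
    rw [e]; infer_instance
  let ev : Reg {x : s → ℂ | ∀ i, x i = 0} →ₐ[ℂ] ℂ :=
    (Pi.evalAlgHom ℂ (fun _ => ℂ) ⟨0, h0⟩).comp (Reg _).val
  have hev : Function.Bijective ev := by
    refine ⟨fun F G hFG => ?_, fun c => ⟨algebraMap ℂ _ c, ev.commutes c⟩⟩
    ext ⟨x, hx⟩
    obtain rfl : x = 0 := funext hx
    exact hFG
  have h1 : regCls {x : s → ℂ | ∀ i, x i = 0} = (CVar.spec ℂ).cls := by
    rw [regCls, dif_pos hft]
    exact cls_spec_eq_of_algEquiv (AlgEquiv.ofBijective ev hev)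
  have h2 : (CVar.spec ℂ).cls = 1 := by
    rw [CVar.cls, ← map_one (Ideal.Quotient.mk _), Ideal.Quotient.eq]
    exact Ideal.subset_span K0Relation.point
  rw [h1, h2, map_one]

theorem cls_torus [Fintype s] : cls {x : s → ℂ | ∀ i, x i ≠ 0} = (Lm - 1) ^ Fintype.card s := by
  have := cls_cyl_ne_zero_finset (B := (Set.univ : Set (s → ℂ))) isCons_univ (E := Finset.univ)
    fun v _ x y => by simp
  simp only [Set.mem_univ, true_and, Finset.mem_univ, forall_const] at this
  rw [this, cls_point, mul_one, Finset.card_univ]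

end Cylinders

section JetClasses

open MvPolynomial

variable {n l : ℕ}

/-- A polynomial in the coefficients of `t^k` of a jet. -/
def leadPoly (l : ℕ) (k : Fin n → ℕ) (p : MvPolynomial (Fin n) ℂ) :
    MvPolynomial (Fin n × Fin (l + 1)) ℂ :=
  aeval (fun ρ => if h : k ρ < l + 1 then X (ρ, ⟨k ρ, h⟩) else 0) p

theorem eval_leadPoly (k : Fin n → ℕ) (p : MvPolynomial (Fin n) ℂ)
    (a : Fin n × Fin (l + 1) → ℂ) : eval a (leadPoly l k p) = eval (lead k a) p := by
  rw [leadPoly]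
  induction p using MvPolynomial.induction_on with
  | C c => simp [algebraMap_eq]
  | add p q hp hq => rw [map_add, map_add, map_add, hp, hq]
  | mul_X p i hp =>
    rw [map_mul, map_mul, map_mul, hp, aeval_X, eval_X, lead]
    split_ifs <;> simp

theorem regOn_lead (Z : Set (Fin n × Fin (l + 1) → ℂ)) (k : Fin n → ℕ) (ρ : Fin n) :
    RegOn Z fun a => lead k a ρ := by
  simpa [eval_leadPoly] using regOn_eval Z (leadPoly l k (X ρ))

theorem isCons_lead {k : Fin n → ℕ} {Q : Set (Fin n → ℂ)} (hQ : IsCons Q) :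
    IsCons {a : Fin n × Fin (l + 1) → ℂ | lead k a ∈ Q} := by
  simpa using isCons_univ.inter_preimage hQ (φ := fun a : Fin n × Fin (l + 1) → ℂ => lead k a)
    (regOn_lead _ k)

theorem isCons_ordGe (k : Fin n → ℕ) : IsCons {a : Fin n × Fin (l + 1) → ℂ | OrdGe k a} :=
  isCons_setOf_forall fun _ => isCons_setOf_forall fun _ =>
    isCons_setOf_imp (isCons_setOf_const _) (isCons_coord_zero _)

/-- The jets of order `k` (with order greater than `l` meaning zero) whose leading coefficients
lie in `Q`. -/
def leadLocus (l : ℕ) (k : Fin n → ℕ) (Q : Set (Fin n → ℂ)) : Set (Fin n × Fin (l + 1) → ℂ) :=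
  {a | OrdGe k a ∧ (∀ ρ, k ρ ≤ l → lead k a ρ ≠ 0) ∧ lead k a ∈ Q}

theorem isCons_leadLocus (k : Fin n → ℕ) {Q : Set (Fin n → ℂ)} (hQ : IsCons Q) :
    IsCons (leadLocus l k Q) := by
  refine isCons_setOf_and (isCons_ordGe k) (isCons_setOf_and ?_ (isCons_lead hQ))
  refine isCons_setOf_forall fun ρ => isCons_setOf_imp (isCons_setOf_const _) ?_
  exact isCons_lead (Q := {x | x ρ ≠ 0}) (isCons_coord_zero ρ).compl

theorem OrdGe.update_mem {k : Fin n → ℕ} {a : Fin n × Fin (l + 1) → ℂ} (h : OrdGe k a)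
    {v : Fin n × Fin (l + 1)} (hv : k v.1 ≤ v.2) (y : ℂ) : OrdGe k (Function.update a v y) :=
  OrdGe.update h hv y

theorem isCyl_leadLocus (k : Fin n → ℕ) (Q : Set (Fin n → ℂ)) {v : Fin n × Fin (l + 1)}
    (hv : k v.1 < v.2) : IsCyl v (leadLocus l k Q) := by
  refine isCyl_of_forall fun a ha y => ⟨ha.1.update_mem hv.le y, ?_⟩
  rw [lead_update a hv y]
  exact ha.2

/-- The coordinates of a jet beyond the leading coefficients. -/
def freeCoords (l : ℕ) (k : Fin n → ℕ) : Finset (Fin n × Fin (l + 1)) :=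
  Finset.univ.filter fun v => k v.1 < v.2

/-- The jets `c t^k` with `c ∈ Q`. -/
def pureLocus (l : ℕ) (k : Fin n → ℕ) (Q : Set (Fin n → ℂ)) : Set (Fin n × Fin (l + 1) → ℂ) :=
  {a | a ∈ leadLocus l k Q ∧ ∀ v ∈ freeCoords l k, a v = 0}

theorem cls_leadLocus (k : Fin n → ℕ) {Q : Set (Fin n → ℂ)} (hQ : IsCons Q) :
    cls (leadLocus l k Q) = Lm ^ (freeCoords l k).card * cls (pureLocus l k Q) :=
  cls_cyl_finset (isCons_leadLocus k hQ) fun _ hv =>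
    isCyl_leadLocus k Q (Finset.mem_filter.1 hv).2

/-- The coordinate of a jet given by the coefficient of `t^{k+j}`. -/
def coordAt (l : ℕ) (k : Fin n → ℕ) (ρ : Fin n) (j : ℕ) : Fin n × Fin (l + 1) :=
  (ρ, Fin.ofNat (l + 1) (k ρ + j))

theorem coordAt_snd {k : Fin n → ℕ} {ρ : Fin n} {j : ℕ} (h : k ρ + j ≤ l) :
    ((coordAt l k ρ j).2 : ℕ) = k ρ + j := by
  simp [coordAt, Fin.ofNat, Nat.mod_eq_of_lt (Nat.lt_succ_of_le h)]

variable {f : MvPolynomial (Fin n) ℂ} {k : Fin n → ℕ} {m : ℕ}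

/-- The coefficients of `f(φ)` before `t^{m+j}` do not involve the coefficient of `t^{k+j}` of
`φ`. -/
theorem isCyl_jetCoeff (hm : ∀ ω ∈ f.support, m ≤ ∑ ρ, k ρ * ω ρ) {ρ₀ : Fin n}
    {B : Set (Fin n × Fin (l + 1) → ℂ)} (hord : ∀ a ∈ B, OrdGe k a) {i j : ℕ} (hij : i < j)
    (hj : k ρ₀ + j ≤ l) (hB : IsCyl (coordAt l k ρ₀ j) B) :
    IsCyl (coordAt l k ρ₀ j) {a | a ∈ B ∧ eval a (jetCoeff f l (m + i)) = 0} := by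
  have h0 : ∀ a ∈ B, ∀ y, eval (Function.update a (coordAt l k ρ₀ j) y) (jetCoeff f l (m + i)) =
      eval (Function.update a (coordAt l k ρ₀ j) 0) (jetCoeff f l (m + i)) := by
    intro a ha y
    have := eval_jetCoeff_update hm (hord a ha) (ρ₀ := ρ₀) (κ₀ := (coordAt l k ρ₀ j).2)
      (by omega) (coordAt_snd hj) y hij.le
    rw [if_neg hij.ne, add_zero] at this
    exact this
  refine isCyl_of_forall fun a ha y => ⟨hB.update_mem ha.1 y, ?_⟩
  rw [h0 a ha.1 y, ← h0 a ha.1 (a (coordAt l k ρ₀ j)), Function.update_eq_self]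
  exact ha.2

theorem isCyl_jetCoeffs (hm : ∀ ω ∈ f.support, m ≤ ∑ ρ, k ρ * ω ρ) {ρ₀ : Fin n}
    {B : Set (Fin n × Fin (l + 1) → ℂ)} (hord : ∀ a ∈ B, OrdGe k a) {i j : ℕ} (hij : i < j)
    (hj : k ρ₀ + j ≤ l) (hB : IsCyl (coordAt l k ρ₀ j) B) :
    IsCyl (coordAt l k ρ₀ j)
      {a | a ∈ B ∧ ∀ i' ∈ Finset.Icc 1 i, eval a (jetCoeff f l (m + i')) = 0} := by
  refine isCyl_of_forall fun a ha y => ⟨hB.update_mem ha.1 y, fun i' hi' => ?_⟩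
  rw [Finset.mem_Icc] at hi'
  exact ((isCyl_jetCoeff hm hord (i := i') (by omega) hj hB).update_mem
    ⟨ha.1, ha.2 i' (Finset.mem_Icc.2 hi')⟩ y).2

theorem isCons_jetCoeffs {B : Set (Fin n × Fin (l + 1) → ℂ)} (hB : IsCons B) (i : ℕ) :
    IsCons {a | a ∈ B ∧ ∀ i' ∈ Finset.Icc 1 i, eval a (jetCoeff f l (m + i')) = 0} := by
  refine hB.sep ?_
  have := isCons_setOf_forall (ι := Finset.Icc 1 i)
    (p := fun i' (a : Fin n × Fin (l + 1) → ℂ) => eval a (jetCoeff f l (m + i'.1)) = 0)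
    fun i' => isCons_zero _
  convert this using 1
  ext a
  simp

/-- Where a partial derivative of the initial part of `f` does not vanish, the vanishing of the
coefficients of `t^{m+1}, …, t^{m+i}` in `f(φ)` determines as many coefficients of `φ`. -/
theorem cls_jetCoeffs_zero (hm : ∀ ω ∈ f.support, m ≤ ∑ ρ, k ρ * ω ρ) {ρ₀ : Fin n} (i : ℕ)
    (hi : k ρ₀ + i ≤ l) {B : Set (Fin n × Fin (l + 1) → ℂ)} (hB : IsCons B)
    (hord : ∀ a ∈ B, OrdGe k a)
    (hd : ∀ a ∈ B, eval (lead k a) (pderiv ρ₀ (initPart f k m)) ≠ 0)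
    (hcyl : ∀ j ∈ Finset.Icc 1 i, IsCyl (coordAt l k ρ₀ j) B) :
    cls {a | a ∈ B ∧ ∀ j ∈ Finset.Icc 1 i, eval a (jetCoeff f l (m + j)) = 0} =
      cls {a | a ∈ B ∧ ∀ j ∈ Finset.Icc 1 i, a (coordAt l k ρ₀ j) = 0} := by
  induction i generalizing B with
  | zero => simp
  | succ i ih =>
    have hc : IsCyl (coordAt l k ρ₀ (i + 1)) B := hcyl _ (by simp)
    -- the last coefficient is traded first, as the earlier ones do not involve its coordinate
    have h1 := cls_affine_zero (isCons_jetCoeffs (f := f) (m := m) hB i)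
      (isCyl_jetCoeffs hm hord (Nat.lt_succ_self i) hi hc) (jetCoeff f l (m + (i + 1)))
      (leadPoly l k (pderiv ρ₀ (initPart f k m)))
      (fun a ha => by rw [eval_leadPoly]; exact hd a ha.1)
      (fun a ha y => by
        have := eval_jetCoeff_update hm (hord a ha.1) (ρ₀ := ρ₀)
          (κ₀ := (coordAt l k ρ₀ (i + 1)).2) (by omega) (coordAt_snd hi) y le_rfl
        rw [if_pos rfl] at this
        rw [eval_leadPoly]
        exact this)
    have h2 := ih (by omega) (hB.sep (isCons_coord_zero (coordAt l k ρ₀ (i + 1))))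
      (fun a ha => hord a ha.1) (fun a ha => hd a ha.1) (fun j hj => by
        rw [Finset.mem_Icc] at hj
        refine (hcyl j (Finset.mem_Icc.2 ⟨hj.1, by omega⟩)).inter_coord_zero fun e => ?_
        have e1 := coordAt_snd (k := k) (ρ := ρ₀) hi
        rw [e, coordAt_snd (by omega)] at e1
        omega)
    have hI : Finset.Icc 1 (i + 1) = insert (i + 1) (Finset.Icc 1 i) := by
      ext j
      simp only [Finset.mem_Icc, Finset.mem_insert]
      omega
    simp only [hI, Finset.forall_mem_insert]
    refine Eq.trans (congrArg cls ?_) (h1.trans (Eq.trans (congrArg cls ?_)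
      (h2.trans (congrArg cls ?_)))) <;>
    · ext a
      simp only [Set.mem_ofPred_eq]
      tauto

/-- The class of the jets with leading coefficients in `Q` for which the coefficients of
`t^{m+1}, …, t^{m+d-1}` in `f(φ)` vanish and the one of `t^{m+d}` does not: these conditions may be
replaced by the same conditions on `d` of the free coordinates. -/
theorem cls_jetCoeffs_ne_zero (hm : ∀ ω ∈ f.support, m ≤ ∑ ρ, k ρ * ω ρ) {ρ₀ : Fin n} {d : ℕ}
    (hd : 1 ≤ d) (hdl : k ρ₀ + d ≤ l) {Q : Set (Fin n → ℂ)} (hQ : IsCons Q)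
    (hder : ∀ x ∈ Q, eval x (pderiv ρ₀ (initPart f k m)) ≠ 0) :
    Lm ^ d * cls {a | (a ∈ leadLocus l k Q ∧
        ∀ j ∈ Finset.Icc 1 (d - 1), eval a (jetCoeff f l (m + j)) = 0) ∧
          eval a (jetCoeff f l (m + d)) ≠ 0} =
      (Lm - 1) * Lm ^ (freeCoords l k).card * cls (pureLocus l k Q) := by
  have hB := isCons_leadLocus (l := l) k hQ
  have hcyl : ∀ j ∈ Finset.Icc 1 d, IsCyl (coordAt l k ρ₀ j) (leadLocus l k Q) := by
    intro j hj
    rw [Finset.mem_Icc] at hj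
    refine isCyl_leadLocus k Q ?_
    rw [coordAt_snd (by omega)]
    simp [coordAt]
    omega
  have hord : ∀ a ∈ leadLocus l k Q, OrdGe k a := fun a ha => ha.1
  have hder' : ∀ a ∈ leadLocus l k Q, eval (lead k a) (pderiv ρ₀ (initPart f k m)) ≠ 0 :=
    fun a ha => hder _ ha.2.2
  have hinj : ∀ i ≤ d, ∀ j ≤ d, coordAt l k ρ₀ i = coordAt l k ρ₀ j → i = j := by
    intro i hi j hj e
    have e1 := coordAt_snd (l := l) (k := k) (ρ := ρ₀) (j := i) (by omega)
    rw [e, coordAt_snd (by omega)] at e1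
    omega
  have h1 := cls_affine_ne_zero (isCons_jetCoeffs (f := f) (m := m) hB (d - 1))
      (isCyl_jetCoeffs hm hord (by omega) hdl (hcyl d (Finset.mem_Icc.2 ⟨hd, le_rfl⟩)))
      (jetCoeff f l (m + d)) (leadPoly l k (pderiv ρ₀ (initPart f k m)))
      (fun a ha => by rw [eval_leadPoly]; exact hder' a ha.1)
      (fun a ha y => by
        have := eval_jetCoeff_update hm (hord a ha.1) (ρ₀ := ρ₀)
          (κ₀ := (coordAt l k ρ₀ d).2) hd (coordAt_snd hdl) y le_rfl
        rw [if_pos rfl] at this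
        rw [eval_leadPoly]
        exact this)
  have h2 := cls_jetCoeffs_zero hm (d - 1) (by omega)
    (hB.sep (isCons_coord_zero (coordAt l k ρ₀ d))) (fun a ha => hord a ha.1)
    (fun a ha => hder' a ha.1) (fun j hj => by
      rw [Finset.mem_Icc] at hj
      refine (hcyl j (Finset.mem_Icc.2 ⟨hj.1, by omega⟩)).inter_coord_zero fun e => ?_
      have := hinj _ le_rfl _ (by omega) e
      omega)
  -- the `d` coordinates that are traded for the conditions; the other free coordinates are free
  let E := (Finset.Icc 1 d).image (coordAt l k ρ₀)
  have hEcard : E.card = d := by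
    rw [Finset.card_image_of_injOn, Nat.card_Icc, Nat.add_sub_cancel]
    intro i hi j hj e
    rw [Finset.coe_Icc, Set.mem_Icc] at hi hj
    exact hinj i hi.2 j hj.2 e
  have hEsub : E ⊆ freeCoords l k := by
    intro v hv
    obtain ⟨j, hj, rfl⟩ := Finset.mem_image.1 hv
    rw [Finset.mem_Icc] at hj
    rw [freeCoords, Finset.mem_filter]
    refine ⟨Finset.mem_univ _, ?_⟩
    rw [coordAt_snd (by omega)]
    simp [coordAt]
    omega
  have hI : Finset.Icc 1 d = insert d (Finset.Icc 1 (d - 1)) := by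
    ext j
    simp only [Finset.mem_Icc, Finset.mem_insert]
    omega
  have h3 : cls {a | (a ∈ leadLocus l k Q ∧
        ∀ j ∈ Finset.Icc 1 (d - 1), eval a (jetCoeff f l (m + j)) = 0) ∧
          eval a (jetCoeff f l (m + d)) ≠ 0} =
      (Lm - 1) * cls {a | a ∈ leadLocus l k Q ∧ ∀ v ∈ E, a v = 0} := by
    refine h1.trans (congrArg _ (Eq.trans (congrArg cls ?_) (h2.trans (congrArg cls ?_))))
    · ext a
      simp only [Set.mem_ofPred_eq]
      tauto
    · ext a
      simp only [Set.mem_ofPred_eq, E, Finset.forall_mem_image, hI, Finset.forall_mem_insert]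
      tauto
  have h4 := cls_cyl_finset (B := {a | a ∈ leadLocus l k Q ∧ ∀ v ∈ E, a v = 0})
    (E := freeCoords l k \ E) (hB.sep (by
      have := isCons_setOf_forall (ι := E) (p := fun v (a : Fin n × Fin (l + 1) → ℂ) => a v.1 = 0)
        fun v => isCons_coord_zero v.1
      simpa using this)) (fun v hv => by
        rw [Finset.mem_sdiff, freeCoords, Finset.mem_filter] at hv
        refine isCyl_of_forall fun a ha y =>
          ⟨(isCyl_leadLocus k Q hv.1.2).update_mem ha.1 y, fun w hw => ?_⟩
        have hwv : w ≠ v := fun e => hv.2 (e ▸ hw)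
        rw [Function.update_of_ne hwv]
        exact ha.2 w hw)
  have h5 : {a | a ∈ {a | a ∈ leadLocus l k Q ∧ ∀ v ∈ E, a v = 0} ∧
      ∀ v ∈ freeCoords l k \ E, a v = 0} = pureLocus l k Q := by
    ext a
    simp only [Set.mem_ofPred_eq, pureLocus, Finset.mem_sdiff, and_assoc]
    refine and_congr_right fun _ => ⟨fun h v hv => ?_, fun h => ⟨fun v hv => h v (hEsub hv),
      fun v hv => h v hv.1⟩⟩
    by_cases hvE : v ∈ E
    · exact h.1 v hvE
    · exact h.2 v ⟨hv, hvE⟩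
  have h6 : (freeCoords l k).card = (freeCoords l k \ E).card + d := by
    rw [← hEcard, Finset.card_sdiff_add_card_eq_card hEsub]
  rw [h3, h4, h5, h6, pow_add]
  ring

open Classical in
/-- Extension of a point by zero in the coordinates in `P`. -/
def extZero (P : Finset (Fin n)) (x : {ρ // ρ ∉ P} → ℂ) (ρ : Fin n) : ℂ :=
  if h : ρ ∉ P then x ⟨ρ, h⟩ else 0

theorem regOn_extZero (P : Finset (Fin n)) (Z : Set ({ρ // ρ ∉ P} → ℂ)) (ρ : Fin n) :
    RegOn Z fun x => extZero P x ρ := by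
  by_cases h : ρ ∉ P
  · simpa [extZero, h] using regOn_coord Z ⟨ρ, h⟩
  · simpa [extZero, h] using regOn_const Z 0

/-- The points of the torus in the coordinates off `P` that lie in `Q`. -/
def torusPart (P : Finset (Fin n)) (Q : Set (Fin n → ℂ)) : Set ({ρ // ρ ∉ P} → ℂ) :=
  {x | (∀ ρ, x ρ ≠ 0) ∧ extZero P x ∈ Q}

theorem isCons_torus {s : Type} [Finite s] : IsCons {x : s → ℂ | ∀ i, x i ≠ 0} :=
  isCons_setOf_forall fun i => (isCons_coord_zero i).compl

theorem isCons_torusPart (P : Finset (Fin n)) {Q : Set (Fin n → ℂ)} (hQ : IsCons Q) :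
    IsCons (torusPart P Q) := by
  refine isCons_torus.sep (p := fun x => extZero P x ∈ Q) ?_
  simpa using isCons_univ.inter_preimage hQ (φ := extZero P) (regOn_extZero P _)

/-- If `Q` only depends on the coordinates off `P`, the coordinates in `P` of the leading
coefficients range freely over `ℂˣ`, except those with `k ρ = l + 1`, which are zero. -/
theorem cls_pureLocus {P : Finset (Fin n)} (hk : ∀ ρ ∉ P, k ρ ≤ l) {Q : Set (Fin n → ℂ)}
    (hQ : IsCons Q) (hQP : ∀ x y : Fin n → ℂ, (∀ ρ ∉ P, x ρ = y ρ) → x ∈ Q → y ∈ Q) :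
    cls (pureLocus l k Q) =
      (Lm - 1) ^ (P.filter fun ρ => k ρ ≤ l).card * cls (torusPart P Q) := by
  -- the leading coefficients in `P` that are coordinates of the jet
  let E := (P.filter fun ρ => k ρ ≤ l).image fun ρ => coordAt l k ρ 0
  have hEcard : E.card = (P.filter fun ρ => k ρ ≤ l).card :=
    Finset.card_image_of_injective _ fun ρ ρ' e => congrArg Prod.fst e
  have hlead : ∀ (a : Fin n × Fin (l + 1) → ℂ) ρ, k ρ ≤ l → lead k a ρ = a (coordAt l k ρ 0) := by
    intro a ρ h
    rw [lead, dif_pos (Nat.lt_succ_of_le h)]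
    congr 1
    refine Prod.ext rfl (Fin.ext ?_)
    rw [coordAt_snd (by omega)]
    simp
  let B : Set (Fin n × Fin (l + 1) → ℂ) := {a | OrdGe k a ∧ (∀ v : freeCoords l k, a v = 0) ∧
    (∀ ρ : {ρ // ρ ∉ P}, lead k a ρ ≠ 0) ∧ lead k a ∈ Q}
  have hB : IsCons B := by
    refine isCons_setOf_and (isCons_ordGe k) (isCons_setOf_and
      (isCons_setOf_forall fun _ => isCons_coord_zero _) (isCons_setOf_and
        (isCons_setOf_forall fun ρ => ?_) (isCons_lead hQ)))
    exact isCons_lead (Q := {x | x ρ.1 ≠ 0}) (isCons_coord_zero ρ.1).compl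
  have hcyl : ∀ v ∈ E, IsCyl v B := by
    intro v hv
    obtain ⟨ρ₁, hρ₁, rfl⟩ := Finset.mem_image.1 hv
    rw [Finset.mem_filter] at hρ₁
    have h2 := coordAt_snd (l := l) (k := k) (ρ := ρ₁) (j := 0) (by omega)
    have hl : ∀ (a : Fin n × Fin (l + 1) → ℂ) (y : ℂ), ∀ ρ ∉ P,
        lead k (Function.update a (coordAt l k ρ₁ 0) y) ρ = lead k a ρ := by
      intro a y ρ hρ
      have hne : coordAt l k ρ 0 ≠ coordAt l k ρ₁ 0 := fun e => by
        have : ρ = ρ₁ := congrArg Prod.fst e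
        exact hρ (this ▸ hρ₁.1)
      rw [hlead _ _ (hk ρ hρ), hlead _ _ (hk ρ hρ), Function.update_of_ne hne]
    refine isCyl_of_forall fun a ha y => ⟨ha.1.update_mem ?_ y, fun w => ?_, fun ρ => ?_, ?_⟩
    · rw [h2]; simp [coordAt]
    · have hw := (Finset.mem_filter.1 w.2).2
      have hne : w.1 ≠ coordAt l k ρ₁ 0 := fun e => by
        rw [e, h2] at hw
        simp [coordAt] at hw
      rw [Function.update_of_ne hne]
      exact ha.2.1 w
    · rw [hl a y ρ ρ.2]
      exact ha.2.2.1 ρ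
    · exact hQP _ _ (fun ρ hρ => (hl a y ρ hρ).symm) ha.2.2.2
  have h1 := cls_cyl_ne_zero_finset hB hcyl
  have e1 : pureLocus l k Q = {x | x ∈ B ∧ ∀ v ∈ E, x v ≠ 0} := by
    ext a
    simp only [pureLocus, leadLocus, Set.mem_ofPred_eq, B, E, Finset.forall_mem_image,
      Finset.mem_filter, Subtype.forall]
    constructor
    · rintro ⟨⟨h1, h2, h3⟩, h4⟩
      refine ⟨⟨h1, h4, fun ρ hρ => h2 ρ (hk ρ hρ), h3⟩, fun ρ hρ => ?_⟩
      rw [← hlead a ρ hρ.2]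
      exact h2 ρ hρ.2
    · rintro ⟨⟨h1, h4, h2, h3⟩, h5⟩
      refine ⟨⟨h1, fun ρ hρ => ?_, h3⟩, h4⟩
      by_cases hP : ρ ∈ P
      · rw [hlead a ρ hρ]
        exact h5 ⟨hP, hρ⟩
      · exact h2 ρ hP
  rw [e1, h1, hEcard]
  congr 1
  -- the jet whose only coefficients are the leading ones off `P`
  let ψ : ({ρ // ρ ∉ P} → ℂ) → Fin n × Fin (l + 1) → ℂ := fun x v =>
    if (v.2 : ℕ) = k v.1 then extZero P x v.1 else 0
  have hψ : ∀ x ρ, lead k (ψ x) ρ = extZero P x ρ := by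
    intro x ρ
    by_cases hρ : k ρ ≤ l
    · rw [hlead _ _ hρ]
      simp only [ψ]
      rw [if_pos]
      · rfl
      · rw [coordAt_snd (by omega)]
        rfl
    · rw [lead, dif_neg (by omega), extZero, dif_neg]
      exact fun h => hρ (hk ρ h)
  have hE0 : IsCons {x : Fin n × Fin (l + 1) → ℂ | ∀ v ∈ E, x v = 0} := by
    have := isCons_setOf_forall (ι := E) (p := fun v (a : Fin n × Fin (l + 1) → ℂ) => a v.1 = 0)
        fun v => isCons_coord_zero v.1
    simpa using this
  have hpt : ∀ a ∈ {x | x ∈ B ∧ ∀ v ∈ E, x v = 0}, ∀ ρ,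
      extZero P (fun ρ => lead k a ρ) ρ = lead k a ρ := by
    intro a ha ρ
    by_cases hP : ρ ∈ P
    · rw [extZero, dif_neg (not_not.2 hP)]
      by_cases hρ : k ρ ≤ l
      · rw [hlead a ρ hρ, ha.2 _ (Finset.mem_image_of_mem _ (Finset.mem_filter.2 ⟨hP, hρ⟩))]
      · rw [lead, dif_neg (by omega)]
    · rw [extZero, dif_pos hP]
  refine cls_congr (hB.sep hE0) (isCons_torusPart P hQ) (fun a ρ => lead k a ρ) ψ
    (fun ρ => regOn_lead _ k ρ) (fun v => ?_) ?_ ?_ ?_ ?_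
  · simp only [ψ]
    split_ifs
    · exact regOn_extZero _ _ _
    · exact regOn_const _ _
  · intro a ha
    refine ⟨ha.1.2.2.1, ?_⟩
    have : extZero P (fun ρ => lead k a ρ) = lead k a := funext (hpt a ha)
    rw [this]
    exact ha.1.2.2.2
  · intro x hx
    refine ⟨⟨fun ρ κ hκ => ?_, fun v => ?_, fun ρ => ?_, ?_⟩, fun v hv => ?_⟩
    · simp only [ψ]
      rw [if_neg hκ.ne]
    · have hv := (Finset.mem_filter.1 v.2).2
      simp only [ψ]
      rw [if_neg hv.ne']
    · rw [hψ, extZero, dif_pos ρ.2]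
      exact hx.1 ρ
    · have : lead k (ψ x) = extZero P x := funext (hψ x)
      rw [this]
      exact hx.2
    · obtain ⟨ρ, hρ, rfl⟩ := Finset.mem_image.1 hv
      rw [Finset.mem_filter] at hρ
      simp only [ψ]
      split_ifs
      · rw [extZero, dif_neg]
        exact not_not.2 hρ.1
      · rfl
  · intro a ha
    ext v
    simp only [ψ]
    split_ifs with h
    · rw [hpt a ha, hlead a v.1 (by have := v.2.2; omega)]
      congr 1
      refine Prod.ext rfl (Fin.ext ?_)
      rw [coordAt_snd (by have := v.2.2; omega), h]
      rfl
    · rcases lt_or_gt_of_ne h with h | h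
      · exact (ha.1.1 v.1 v.2 h).symm
      · exact (ha.1.2.1 ⟨v, Finset.mem_filter.2 ⟨Finset.mem_univ _, h⟩⟩).symm
  · intro x hx
    ext ρ
    rw [hψ, extZero, dif_pos ρ.2]

end JetClasses

/-! ### The class of the jets of given order along which `f` has order `l` -/

section JetLocus

open MvPolynomial

variable {n l : ℕ} {f : MvPolynomial (Fin n) ℂ} {k : Fin n → ℕ} {m : ℕ}

/-- The condition on the order of `f(φ)` in terms of the coefficients of `f(φ)`. -/
theorem mem_jetLocus {a : Fin n × Fin (l + 1) → ℂ} :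
    a ∈ jetLocus f l ↔ (∀ ρ, a (ρ, 0) = 0) ∧ (∀ j : Fin l, eval a (jetCoeff f l j) = 0) ∧
      eval a (jetCoeff f l l) ≠ 0 := by
  rw [jetLocus, Set.mem_ofPred_eq]
  refine and_congr_right fun _ => ?_
  change (aeval (jetSeries a) f).order = _ ↔ _
  rw [PowerSeries.order_eq_nat, eval_jetCoeff, and_comm]
  refine and_congr_left fun _ => ⟨fun h j => ?_, fun h j hj => ?_⟩
  · rw [eval_jetCoeff]; exact h j j.2
  · rw [← eval_jetCoeff]; exact h ⟨j, hj⟩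

theorem isCons_jetLocus (f : MvPolynomial (Fin n) ℂ) (l : ℕ) : IsCons (jetLocus f l) := by
  have : jetLocus f l = {a | (∀ ρ, a (ρ, 0) = 0) ∧ (∀ j : Fin l, eval a (jetCoeff f l j) = 0) ∧
      eval a (jetCoeff f l l) ≠ 0} := Set.ext fun a => mem_jetLocus
  rw [this]
  exact isCons_setOf_and (isCons_setOf_forall fun _ => isCons_coord_zero _)
    (isCons_setOf_and (isCons_setOf_forall fun _ => isCons_zero _) (isCons_ne_zero _))

/-- The jets in `jetLocus f l` whose components have the orders `k` (where a component of order
`l + 1` is zero). -/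
def jetStratum (f : MvPolynomial (Fin n) ℂ) (l : ℕ) (k : Fin n → ℕ) :
    Set (Fin n × Fin (l + 1) → ℂ) :=
  {a | a ∈ jetLocus f l ∧ OrdGe k a ∧ ∀ ρ, k ρ ≤ l → lead k a ρ ≠ 0}

theorem isCons_jetStratum (f : MvPolynomial (Fin n) ℂ) (l : ℕ) (k : Fin n → ℕ) :
    IsCons (jetStratum f l k) := by
  refine (isCons_jetLocus f l).sep (isCons_setOf_and (isCons_ordGe k) ?_)
  refine isCons_setOf_forall fun ρ => isCons_setOf_imp (isCons_setOf_const _) ?_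
  exact isCons_lead (Q := {x | x ρ ≠ 0}) (isCons_coord_zero ρ).compl

/-- The orders of the components of a jet at the origin, zero components being given the order
`l + 1`. -/
theorem exists_orders {a : Fin n × Fin (l + 1) → ℂ} (ha : ∀ ρ, a (ρ, 0) = 0) :
    ∃ k : Fin n → ℕ, (∀ ρ, k ρ ∈ Finset.Icc 1 (l + 1)) ∧ OrdGe k a ∧
      ∀ ρ, k ρ ≤ l → lead k a ρ ≠ 0 := by
  classical
  have key : ∀ ρ, ∃ d ∈ Finset.Icc 1 (l + 1), (∀ κ : Fin (l + 1), (κ : ℕ) < d → a (ρ, κ) = 0) ∧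
      ∀ h : d < l + 1, a (ρ, ⟨d, h⟩) ≠ 0 := by
    intro ρ
    by_cases hex : ∃ d, ∃ h : d < l + 1, a (ρ, ⟨d, h⟩) ≠ 0
    · obtain ⟨h1, h2⟩ := Nat.find_spec hex
      refine ⟨Nat.find hex, Finset.mem_Icc.2 ⟨?_, h1.le⟩, fun κ hκ => ?_, fun _ => h2⟩
      · rw [Nat.one_le_iff_ne_zero]
        intro h0
        have h3 : (⟨Nat.find hex, h1⟩ : Fin (l + 1)) = 0 := Fin.ext h0
        rw [h3] at h2
        exact h2 (ha ρ)
      · by_contra hne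
        exact Nat.find_min hex hκ ⟨κ.2, hne⟩
    · push Not at hex
      exact ⟨l + 1, by simp, fun κ _ => hex κ κ.2, fun h => (lt_irrefl _ h).elim⟩
  choose k hk h1 h2 using key
  refine ⟨k, hk, h1, fun ρ hρ => ?_⟩
  rw [lead, dif_pos (Nat.lt_succ_of_le hρ)]
  exact h2 ρ _

/-- The jets are stratified by the orders of their components. -/
theorem cls_jetLocus (f : MvPolynomial (Fin n) ℂ) (l : ℕ) :
    cls (jetLocus f l) =
      ∑ k ∈ Fintype.piFinset fun _ => Finset.Icc 1 (l + 1), cls (jetStratum f l k) := by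
  rw [← Finset.sum_coe_sort, ← cls_iUnion (fun _ => isCons_jetStratum f l _)]
  · congr 1
    ext a
    simp only [Set.mem_iUnion]
    refine ⟨fun ha => ?_, fun ⟨_, h⟩ => h.1⟩
    obtain ⟨k, hk, h⟩ := exists_orders (mem_jetLocus.1 ha).1
    exact ⟨⟨k, Fintype.mem_piFinset.2 hk⟩, ha, h⟩
  · rintro ⟨k, hk⟩ ⟨k', hk'⟩ hne
    rw [Set.disjoint_left]
    rintro a ⟨-, h1, h2⟩ ⟨-, h1', h2'⟩
    apply hne
    rw [Fintype.mem_piFinset] at hk hk'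
    have key : ∀ k k' : Fin n → ℕ, (∀ ρ, k' ρ ∈ Finset.Icc 1 (l + 1)) →
        (∀ ρ, k ρ ≤ l → lead k a ρ ≠ 0) → OrdGe k' a → ∀ ρ, k' ρ ≤ k ρ := by
      intro k k' hk' h2 h1' ρ
      by_contra hlt
      push Not at hlt
      have hl := (Finset.mem_Icc.1 (hk' ρ)).2
      have h3 := h2 ρ (by omega)
      rw [lead, dif_pos (by omega)] at h3
      exact h3 (h1' ρ _ hlt)
    exact Subtype.ext (funext fun ρ => le_antisymm (key k' k hk h2' h1 ρ) (key k k' hk' h2 h1' ρ))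

/-- If `l < m`, no jet of orders `k` has order `l` along `f`. -/
theorem cls_jetStratum_of_lt (hm : ∀ ω ∈ f.support, m ≤ ∑ ρ, k ρ * ω ρ) (h : l < m) :
    cls (jetStratum f l k) = 0 := by
  have : jetStratum f l k = ∅ := by
    rw [Set.eq_empty_iff_forall_notMem]
    rintro a ⟨ha, ho, -⟩
    exact (mem_jetLocus.1 ha).2.2 (eval_jetCoeff_of_lt hm ho h)
  rw [this, cls_empty]

theorem coord_zero_of_ordGe (hk : ∀ ρ, 1 ≤ k ρ) {a : Fin n × Fin (l + 1) → ℂ} (h : OrdGe k a)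
    (ρ : Fin n) : a (ρ, 0) = 0 := h ρ 0 (hk ρ)

theorem jetStratum_self (hk : ∀ ρ, 1 ≤ k ρ) (hm : ∀ ω ∈ f.support, l ≤ ∑ ρ, k ρ * ω ρ) :
    jetStratum f l k = leadLocus l k {x | eval x (initPart f k l) ≠ 0} := by
  ext a
  rw [jetStratum, leadLocus, Set.mem_ofPred_eq, Set.mem_ofPred_eq, mem_jetLocus, Set.mem_ofPred_eq]
  constructor
  · rintro ⟨⟨-, -, h1⟩, h2, h3⟩
    rw [eval_jetCoeff_self hm h2] at h1
    exact ⟨h2, h3, h1⟩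
  · rintro ⟨h2, h3, h1⟩
    refine ⟨⟨coord_zero_of_ordGe hk h2, fun j => eval_jetCoeff_of_lt hm h2 j.2, ?_⟩, h2, h3⟩
    rwa [eval_jetCoeff_self hm h2]

/-- If `m < l`, the order of `f(φ)` is `l` when the initial part of `f` vanishes at the leading
coefficients, the next `l - m - 1` coefficients of `f(φ)` vanish, and the following one does not.
-/
theorem jetStratum_of_lt (hk : ∀ ρ, 1 ≤ k ρ) (hm : ∀ ω ∈ f.support, m ≤ ∑ ρ, k ρ * ω ρ)
    (hml : m < l) :
    jetStratum f l k = {a | (a ∈ leadLocus l k {x | eval x (initPart f k m) = 0} ∧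
        ∀ j ∈ Finset.Icc 1 (l - m - 1), eval a (jetCoeff f l (m + j)) = 0) ∧
          eval a (jetCoeff f l (m + (l - m))) ≠ 0} := by
  ext a
  rw [Nat.add_sub_cancel' hml.le]
  simp only [jetStratum, leadLocus, Set.mem_ofPred_eq, mem_jetLocus]
  constructor
  · rintro ⟨⟨-, h0, h1⟩, h2, h3⟩
    refine ⟨⟨⟨h2, h3, ?_⟩, fun j hj => ?_⟩, h1⟩
    · rw [← eval_jetCoeff_self hm h2]
      exact h0 ⟨m, hml⟩
    · rw [Finset.mem_Icc] at hj
      exact h0 ⟨m + j, by omega⟩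
  · rintro ⟨⟨⟨h2, h3, h4⟩, h5⟩, h1⟩
    refine ⟨⟨coord_zero_of_ordGe hk h2, fun j => ?_, h1⟩, h2, h3⟩
    rcases lt_trichotomy (j : ℕ) m with h | h | h
    · exact eval_jetCoeff_of_lt hm h2 h
    · rw [h, eval_jetCoeff_self hm h2]
      exact h4
    · have := h5 (j - m) (Finset.mem_Icc.2 (by have := j.2; omega))
      rwa [Nat.add_sub_cancel' h.le] at this

theorem isCons_initZero (f : MvPolynomial (Fin n) ℂ) (k : Fin n → ℕ) (m : ℕ) :
    IsCons {x | eval x (initPart f k m) = 0} := isCons_zero _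

/-- The case `m = l`: the class of the jets with leading coefficients outside the zero locus of the
initial part of `f`. -/
theorem cls_jetStratum_self (hk : ∀ ρ, 1 ≤ k ρ) (hm : ∀ ω ∈ f.support, l ≤ ∑ ρ, k ρ * ω ρ)
    {P : Finset (Fin n)} (hkP : ∀ ρ ∉ P, k ρ ≤ l)
    (hdep : ∀ x y : Fin n → ℂ, (∀ ρ ∉ P, x ρ = y ρ) →
      eval x (initPart f k l) = eval y (initPart f k l)) :
    cls (jetStratum f l k) = Lm ^ (freeCoords l k).card *
      ((Lm - 1) ^ (P.filter fun ρ => k ρ ≤ l).card *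
        ((Lm - 1) ^ (n - P.card) - cls (torusPart P {x | eval x (initPart f k l) = 0}))) := by
  have hQ : IsCons {x | eval x (initPart f k l) ≠ 0} := isCons_ne_zero _
  rw [jetStratum_self hk hm, cls_leadLocus k hQ, cls_pureLocus hkP hQ
    fun x y hxy hx => by rwa [Set.mem_ofPred_eq, ← hdep x y hxy]]
  congr 2
  have h1 := cls_eq_add_of_split (C := {x : {ρ // ρ ∉ P} → ℂ | ∀ ρ, x ρ ≠ 0})
    (isCons_torusPart P hQ) (isCons_torusPart P (isCons_initZero f k l))
    (fun x => by simp only [torusPart, Set.mem_ofPred_eq]; tauto)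
    (fun x h1 h2 => h1.2 h2.2)
  rw [cls_torus] at h1
  have h2 : Fintype.card {ρ // ρ ∉ P} = n - P.card := by
    rw [Fintype.card_subtype_compl, Fintype.card_fin, Fintype.card_coe]
  rw [h2] at h1
  rw [h1]
  ring

/-- The case `m < l`: the class of the jets with leading coefficients in the (smooth) zero locus of
the initial part of `f`. -/
theorem cls_jetStratum_of_gt (hk : ∀ ρ, 1 ≤ k ρ) (hm : ∀ ω ∈ f.support, m ≤ ∑ ρ, k ρ * ω ρ)
    (hml : m < l) {P : Finset (Fin n)} (hkP : ∀ ρ ∉ P, k ρ ≤ m)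
    (hdep : ∀ x y : Fin n → ℂ, (∀ ρ ∉ P, x ρ = y ρ) →
      eval x (initPart f k m) = eval y (initPart f k m))
    (hsm : ∀ x : Fin n → ℂ, (∀ ρ ∉ P, x ρ ≠ 0) → eval x (initPart f k m) = 0 →
      ∃ ρ₀ ∉ P, eval x (pderiv ρ₀ (initPart f k m)) ≠ 0) :
    Lm ^ (l - m) * cls (jetStratum f l k) = (Lm - 1) * Lm ^ (freeCoords l k).card *
      ((Lm - 1) ^ (P.filter fun ρ => k ρ ≤ l).card *
        cls (torusPart P {x | eval x (initPart f k m) = 0})) := by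
  classical
  -- the zero locus of the initial part is stratified by the first partial derivative (with respect
  -- to a variable off `P`) that does not vanish
  let Q : Fin n → Set (Fin n → ℂ) := fun ρ₀ => {x | eval x (initPart f k m) = 0 ∧ ρ₀ ∉ P ∧
    eval x (pderiv ρ₀ (initPart f k m)) ≠ 0 ∧
      ∀ ρ, ρ ∉ P ∧ ρ < ρ₀ → eval x (pderiv ρ (initPart f k m)) = 0}
  have hQ : ∀ ρ₀, IsCons (Q ρ₀) := fun ρ₀ =>
    isCons_setOf_and (isCons_zero _) (isCons_setOf_and (isCons_setOf_const _)
      (isCons_setOf_and (isCons_ne_zero _) (isCons_setOf_forall fun ρ =>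
        isCons_setOf_imp (isCons_setOf_const _) (isCons_zero _))))
  have hQd : ∀ x ρ₁ ρ₂, x ∈ Q ρ₁ → x ∈ Q ρ₂ → ρ₁ = ρ₂ := by
    intro x ρ₁ ρ₂ h1 h2
    rcases lt_trichotomy ρ₁ ρ₂ with h | h | h
    · exact (h1.2.2.1 (h2.2.2.2 ρ₁ ⟨h1.2.1, h⟩)).elim
    · exact h
    · exact (h2.2.2.1 (h1.2.2.2 ρ₂ ⟨h2.2.1, h⟩)).elim
  have hlead : ∀ a, a ∈ leadLocus l k {x | eval x (initPart f k m) = 0} ↔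
      ∃ ρ₀, a ∈ leadLocus l k (Q ρ₀) := by
    intro a
    constructor
    · rintro ⟨h1, h2, h3⟩
      obtain ⟨ρ₁, h4, h5⟩ := hsm _ (fun ρ hρ => h2 ρ ((hkP ρ hρ).trans hml.le)) h3
      have hne : (Finset.univ.filter fun ρ => ρ ∉ P ∧
          eval (lead k a) (pderiv ρ (initPart f k m)) ≠ 0).Nonempty :=
        ⟨ρ₁, Finset.mem_filter.2 ⟨Finset.mem_univ _, h4, h5⟩⟩
      have hmin := (Finset.mem_filter.1 (Finset.min'_mem _ hne)).2
      refine ⟨_, h1, h2, h3, hmin.1, hmin.2, fun ρ hρ => ?_⟩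
      by_contra h6
      exact absurd (Finset.min'_le _ ρ (Finset.mem_filter.2 ⟨Finset.mem_univ _, hρ.1, h6⟩))
        (not_le.2 hρ.2)
    · rintro ⟨ρ₀, h1, h2, h3⟩
      exact ⟨h1, h2, h3.1⟩
  let S : Fin n → Set (Fin n × Fin (l + 1) → ℂ) := fun ρ₀ => {a | (a ∈ leadLocus l k (Q ρ₀) ∧
        ∀ j ∈ Finset.Icc 1 (l - m - 1), eval a (jetCoeff f l (m + j)) = 0) ∧
          eval a (jetCoeff f l (m + (l - m))) ≠ 0}
  have hS : ∀ ρ₀, IsCons (S ρ₀) := fun ρ₀ =>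
    (isCons_jetCoeffs (isCons_leadLocus k (hQ ρ₀)) _).sep (isCons_ne_zero _)
  have hSU : jetStratum f l k = ⋃ ρ₀, S ρ₀ := by
    rw [jetStratum_of_lt hk hm hml]
    ext a
    simp only [Set.mem_iUnion, S, Set.mem_ofPred_eq, hlead]
    simp only [exists_and_right]
  have hSd : Pairwise fun i j => Disjoint (S i) (S j) := fun i j hij =>
    Set.disjoint_left.2 fun a h1 h2 => hij (hQd _ _ _ h1.1.1.2.2 h2.1.1.2.2)
  have hN : pureLocus l k {x | eval x (initPart f k m) = 0} = ⋃ ρ₀, pureLocus l k (Q ρ₀) := by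
    ext a
    simp only [Set.mem_iUnion, pureLocus, Set.mem_ofPred_eq, hlead, exists_and_right]
  have hNd : Pairwise fun i j => Disjoint (pureLocus l k (Q i)) (pureLocus l k (Q j)) :=
    fun i j hij => Set.disjoint_left.2 fun a h1 h2 => hij (hQd _ _ _ h1.1.2.2 h2.1.2.2)
  have hNc : ∀ ρ₀, IsCons (pureLocus l k (Q ρ₀)) := fun ρ₀ =>
    (isCons_leadLocus k (hQ ρ₀)).sep (by
      have := isCons_setOf_forall (ι := freeCoords l k)
        (p := fun v (a : Fin n × Fin (l + 1) → ℂ) => a v.1 = 0) fun v => isCons_coord_zero v.1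
      simpa using this)
  rw [← cls_pureLocus (fun ρ hρ => (hkP ρ hρ).trans hml.le) (isCons_initZero f k m)
    fun x y hxy hx => by rwa [Set.mem_ofPred_eq, ← hdep x y hxy], hN, cls_iUnion hNc hNd, hSU,
    cls_iUnion hS hSd, Finset.mul_sum, Finset.mul_sum]
  refine Finset.sum_congr rfl fun ρ₀ _ => ?_
  by_cases hρ₀ : ρ₀ ∈ P
  · have e1 : S ρ₀ = ∅ := Set.eq_empty_iff_forall_notMem.2 fun a ha => ha.1.1.2.2.2.1 hρ₀
    have e2 : pureLocus l k (Q ρ₀) = ∅ :=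
      Set.eq_empty_iff_forall_notMem.2 fun a ha => ha.1.2.2.2.1 hρ₀
    rw [e1, e2, cls_empty, mul_zero, mul_zero]
  · exact cls_jetCoeffs_ne_zero hm (by omega) (by have := hkP ρ₀ hρ₀; omega) (hQ ρ₀)
      fun x hx => hx.2.2.1

theorem card_freeCoords (l : ℕ) (k : Fin n → ℕ) :
    (freeCoords l k).card = ∑ ρ, (l - k ρ) := by
  classical
  have h : (freeCoords l k).card =
      ∑ ρ : Fin n, (Finset.univ.filter fun κ : Fin (l + 1) => k ρ < κ).card := by
    rw [freeCoords, Finset.card_filter, ← Finset.univ_product_univ, Finset.sum_product]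
    refine Finset.sum_congr rfl fun ρ _ => ?_
    rw [Finset.card_filter]
  rw [h]
  refine Finset.sum_congr rfl fun ρ _ => ?_
  have h1 : (Finset.univ.filter fun κ : Fin (l + 1) => k ρ < κ).card =
      ((Finset.range (l + 1)).filter fun d => k ρ < d).card := by
    rw [Finset.card_filter, Finset.card_filter, Finset.sum_range]
  have h2 : ((Finset.range (l + 1)).filter fun d => k ρ < d) = Finset.Ioc (k ρ) l := by
    ext d
    simp only [Finset.mem_filter, Finset.mem_range, Finset.mem_Ioc]
    omega
  rw [h1, h2, Nat.card_Ioc]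

end JetLocus

/-! ### Simplicial decompositions of rational cones -/

section HCone

variable {n : ℕ} {ι : Type}

/-- The cone defined by the inequalities `a i · x ≥ 0`. -/
def HCone (a : ι → Fin n → ℤ) : Set (Fin n → ℝ) :=
  {x | ∀ i, 0 ≤ (fun ρ => (a i ρ : ℝ)) ⬝ᵥ x}

variable {a : ι → Fin n → ℤ}

theorem HCone.smul_mem {x : Fin n → ℝ} (hx : x ∈ HCone a) {c : ℝ} (hc : 0 ≤ c) :
    c • x ∈ HCone a := fun i => by
  rw [dotProduct_smul]
  exact mul_nonneg hc (hx i)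

theorem HCone.add_mem {x y : Fin n → ℝ} (hx : x ∈ HCone a) (hy : y ∈ HCone a) :
    x + y ∈ HCone a := fun i => by
  rw [dotProduct_add]
  exact add_nonneg (hx i) (hy i)

theorem zero_mem_HCone : (0 : Fin n → ℝ) ∈ HCone a := fun i => by simp

theorem sum_mem_HCone {V : Finset (Fin n → ℕ)} {c : (Fin n → ℕ) → ℝ}
    (hV : ∀ v ∈ V, toReal v ∈ HCone a) (hc : ∀ v ∈ V, 0 ≤ c v) :
    ∑ v ∈ V, c v • toReal v ∈ HCone a := by
  classical
  induction V using Finset.induction_on with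
  | empty => simpa using zero_mem_HCone
  | insert v V hv ih =>
    rw [Finset.sum_insert hv]
    exact HCone.add_mem (HCone.smul_mem (hV v (by simp)) (hc v (by simp)))
      (ih (fun w hw => hV w (by simp [hw])) fun w hw => hc w (by simp [hw]))

theorem toReal_ne_zero {v : Fin n → ℕ} (h : Finset.univ.gcd v = 1) : toReal v ≠ 0 := by
  intro h0
  have : v = 0 := by
    ext ρ
    have := congrFun h0 ρ
    simpa [toReal] using this
  rw [this] at h
  have h2 : Finset.univ.gcd (0 : Fin n → ℕ) = 0 := Finset.gcd_eq_zero_iff.2 fun _ _ => rfl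
  omega

/-- The cone is contained in the positive orthant, and the inequalities include those of the
positive orthant. -/
def HasOrthant (a : ι → Fin n → ℤ) : Prop := ∀ ρ, ∃ i, a i = Pi.single ρ 1

theorem HasOrthant.dot (h : HasOrthant a) (ρ : Fin n) :
    ∃ i, ∀ x : Fin n → ℝ, (fun ρ => (a i ρ : ℝ)) ⬝ᵥ x = x ρ := by
  obtain ⟨i, hi⟩ := h ρ
  refine ⟨i, fun x => ?_⟩
  have : (fun ρ => (a i ρ : ℝ)) = Pi.single ρ 1 := by
    rw [hi]
    ext ρ'
    by_cases h : ρ' = ρ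
    · subst h; simp
    · simp [h]
  rw [this, single_one_dotProduct]

theorem HasOrthant.nonneg (h : HasOrthant a) {x : Fin n → ℝ} (hx : x ∈ HCone a) (ρ : Fin n) :
    0 ≤ x ρ := by
  obtain ⟨i, hi⟩ := h.dot ρ
  rw [← hi x]
  exact hx i

theorem HasOrthant.eq_zero (h : HasOrthant a) {x : Fin n → ℝ}
    (hx : ∀ i, (fun ρ => (a i ρ : ℝ)) ⬝ᵥ x = 0) : x = 0 := by
  ext ρ
  obtain ⟨i, hi⟩ := h.dot ρ
  rw [← hi x, hx i]
  rfl

variable [Fintype ι]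

open Classical in
/-- The inequalities that are equalities at `x`. -/
def act (a : ι → Fin n → ℤ) (x : Fin n → ℝ) : Finset ι :=
  Finset.univ.filter fun i => (fun ρ => (a i ρ : ℝ)) ⬝ᵥ x = 0

/-- The span of the inequalities in `A`. -/
def normalSpan (a : ι → Fin n → ℤ) (A : Finset ι) : Submodule ℝ (Fin n → ℝ) :=
  Submodule.span ℝ ((fun i ρ => (a i ρ : ℝ)) '' (A : Set ι))

/-- The primitive integral vector `v` spans an extremal ray of the cone. -/
def IsRay (a : ι → Fin n → ℤ) (v : Fin n → ℕ) : Prop :=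
  Finset.univ.gcd v = 1 ∧ toReal v ∈ HCone a ∧
    Module.finrank ℝ (normalSpan a (act a (toReal v))) + 1 = n

theorem mem_act {x : Fin n → ℝ} {i : ι} :
    i ∈ act a x ↔ (fun ρ => (a i ρ : ℝ)) ⬝ᵥ x = 0 := by
  simp [act]

theorem act_smul {x : Fin n → ℝ} {c : ℝ} (hc : c ≠ 0) : act a (c • x) = act a x := by
  ext i
  simp [mem_act, dotProduct_smul, hc]

theorem act_add {x y : Fin n → ℝ} (hx : x ∈ HCone a) (hy : y ∈ HCone a) (i : ι) :
    i ∈ act a (x + y) ↔ i ∈ act a x ∧ i ∈ act a y := by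
  rw [mem_act, mem_act, mem_act, dotProduct_add]
  exact add_eq_zero_iff_of_nonneg (hx i) (hy i)

theorem act_zero : act a 0 = Finset.univ := by
  ext i
  simp [mem_act]

/-- The inequalities active at a positive combination are those active at all of its terms. -/
theorem mem_act_sum {V : Finset (Fin n → ℕ)} {c : (Fin n → ℕ) → ℝ}
    (hV : ∀ v ∈ V, toReal v ∈ HCone a) (hc : ∀ v ∈ V, 0 < c v) (i : ι) :
    i ∈ act a (∑ v ∈ V, c v • toReal v) ↔ ∀ v ∈ V, i ∈ act a (toReal v) := by
  classical
  induction V using Finset.induction_on with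
  | empty => simp [act_zero]
  | insert v V hv ih =>
    rw [Finset.sum_insert hv, act_add (HCone.smul_mem (hV v (by simp)) (hc v (by simp)).le)
      (sum_mem_HCone (fun w hw => hV w (by simp [hw])) fun w hw => (hc w (by simp [hw])).le),
      act_smul (hc v (by simp)).ne', ih (fun w hw => hV w (by simp [hw]))
      fun w hw => hc w (by simp [hw])]
    simp

theorem isRay_ne_zero {v : Fin n → ℕ} (h : IsRay a v) : toReal v ≠ 0 := toReal_ne_zero h.1

/-- The vectors orthogonal to the inequalities in `A`. -/
def perp (a : ι → Fin n → ℤ) (A : Finset ι) : Submodule ℝ (Fin n → ℝ) where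
  carrier := {x | ∀ i ∈ A, (fun ρ => (a i ρ : ℝ)) ⬝ᵥ x = 0}
  add_mem' hx hy i hi := by rw [dotProduct_add, hx i hi, hy i hi, add_zero]
  zero_mem' i _ := dotProduct_zero _
  smul_mem' c x hx i hi := by rw [dotProduct_smul, hx i hi, smul_zero]

omit [Fintype ι] in
/-- The rank theorem for the system of the inequalities in `A`. -/
theorem finrank_perp (A : Finset ι) :
    Module.finrank ℝ (normalSpan a A) + Module.finrank ℝ (perp a A) = n := by
  classical
  let M : Matrix A (Fin n) ℝ := Matrix.of fun i ρ => (a i ρ : ℝ)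
  have h1 : LinearMap.ker M.mulVecLin = perp a A := by
    ext y
    rw [LinearMap.mem_ker, Matrix.mulVecLin_apply, funext_iff]
    simp [perp, M, Matrix.mulVec, dotProduct]
  have h2 : normalSpan a A = Submodule.span ℝ (Set.range M.row) := by
    rw [normalSpan]
    congr 1
    ext y
    exact ⟨fun ⟨i, hi, h⟩ => ⟨⟨i, hi⟩, h⟩, fun ⟨i, h⟩ => ⟨i, i.2, h⟩⟩
  have h3 := M.mulVecLin.finrank_range_add_finrank_ker
  rw [h1, Module.finrank_fin_fun] at h3
  rw [h2, ← Matrix.rank_eq_finrank_span_row]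
  exact h3

omit [Fintype ι] in
/-- A nonzero real solution of a system of linear equations with integral coefficients gives a
nonzero integral solution: the Gram matrix of the system is singular. -/
theorem exists_int_mem_perp {A : Finset ι} {x : Fin n → ℝ} (hx : x ∈ perp a A) (h0 : x ≠ 0) :
    ∃ z : Fin n → ℤ, z ≠ 0 ∧ (fun ρ => (z ρ : ℝ)) ∈ perp a A := by
  classical
  let M : Matrix A (Fin n) ℤ := Matrix.of fun i => a i
  have hM : ∀ y : Fin n → ℝ, y ∈ perp a A ↔ (M.map (Int.cast : ℤ → ℝ)).mulVec y = 0 := by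
    intro y
    rw [funext_iff]
    simp [perp, M, Matrix.mulVec, Matrix.map, dotProduct]
  have hG : (M.transpose * M).det = 0 := by
    have h1 : ((M.transpose * M).map (Int.cast : ℤ → ℝ)).det = 0 := by
      rw [← Matrix.exists_mulVec_eq_zero_iff]
      refine ⟨x, h0, ?_⟩
      have h2 : (M.transpose * M).map (Int.cast : ℤ → ℝ) =
          (M.map (Int.cast : ℤ → ℝ)).transpose * M.map (Int.cast : ℤ → ℝ) := by
        ext i j
        simp [Matrix.mul_apply]
      rw [h2, ← Matrix.mulVec_mulVec, (hM x).1 hx, Matrix.mulVec_zero]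
    have h3 := Int.cast_det (R := ℝ) (M.transpose * M)
    rw [h1] at h3
    exact_mod_cast h3
  obtain ⟨z, hz0, hz⟩ := Matrix.exists_mulVec_eq_zero_iff.2 hG
  refine ⟨z, hz0, (hM _).2 ?_⟩
  have h4 : M.mulVec z = 0 := by
    rw [← dotProduct_self_eq_zero, Matrix.dotProduct_mulVec, ← Matrix.mulVec_transpose,
      Matrix.mulVec_mulVec, hz, zero_dotProduct]
  ext i
  have := congrFun h4 i
  simp only [Matrix.mulVec, dotProduct, Pi.zero_apply, Matrix.map_apply] at this ⊢
  exact_mod_cast this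

theorem mem_perp_act (x : Fin n → ℝ) : x ∈ perp a (act a x) := fun _ hi => mem_act.1 hi

theorem mem_perp_iff {A : Finset ι} {x : Fin n → ℝ} : x ∈ perp a A ↔ A ⊆ act a x :=
  ⟨fun h _ hi => mem_act.2 (h _ hi), fun h _ hi => mem_act.1 (h hi)⟩

/-- Primitive integral vectors that are proportional are equal. -/
theorem eq_of_toReal_eq_smul {v w : Fin n → ℕ} (hv : Finset.univ.gcd v = 1)
    (hw : Finset.univ.gcd w = 1) {c : ℝ} (h : toReal w = c • toReal v) : v = w := by
  have hv0 : ∃ ρ, v ρ ≠ 0 := by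
    by_contra! h0
    exact toReal_ne_zero hv (funext fun ρ => by simp [toReal, h0 ρ])
  obtain ⟨ρ₀, hρ₀⟩ := hv0
  have h1 : ∀ ρ, v ρ₀ * w ρ = w ρ₀ * v ρ := by
    intro ρ
    have e1 : (w ρ : ℝ) = c * v ρ := congrFun h ρ
    have e2 : (w ρ₀ : ℝ) = c * v ρ₀ := congrFun h ρ₀
    have : (v ρ₀ : ℝ) * w ρ = w ρ₀ * v ρ := by rw [e1, e2]; ring
    exact_mod_cast this
  have h2 : v ρ₀ = w ρ₀ := by
    have e1 := Finset.gcd_mul_left (s := Finset.univ) (f := w) (a := v ρ₀)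
    have e2 := Finset.gcd_mul_left (s := Finset.univ) (f := v) (a := w ρ₀)
    rw [hw] at e1
    rw [hv] at e2
    simp only [h1] at e1
    rw [e2] at e1
    simpa using e1.symm
  ext ρ
  have := h1 ρ
  rw [← h2] at this
  exact (Nat.eq_of_mul_eq_mul_left (Nat.pos_of_ne_zero hρ₀) this).symm

/-- A nonzero integral vector with nonnegative coordinates is a multiple of a primitive one. -/
theorem exists_primitive {z : Fin n → ℕ} (hz : z ≠ 0) :
    ∃ (v : Fin n → ℕ) (d : ℕ), 0 < d ∧ Finset.univ.gcd v = 1 ∧ toReal z = (d : ℝ) • toReal v := by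
  obtain ⟨ρ, hρ⟩ := Function.ne_iff.1 hz
  obtain ⟨v, hv, hv1⟩ := Finset.extract_gcd z ⟨ρ, Finset.mem_univ _⟩
  refine ⟨v, Finset.univ.gcd z, Nat.pos_of_ne_zero fun h0 => ?_, hv1, ?_⟩
  · exact hρ (Finset.gcd_eq_zero_iff.1 h0 ρ (Finset.mem_univ _))
  · ext ρ
    simp only [toReal, Pi.smul_apply, smul_eq_mul]
    rw [hv ρ (Finset.mem_univ _)]
    push_cast
    rfl

/-- Two vectors orthogonal to the inequalities active at a ray are proportional. -/
theorem IsRay.exists_smul {v : Fin n → ℕ} (hv : IsRay a v) {x : Fin n → ℝ}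
    (hx : act a (toReal v) ⊆ act a x) : ∃ c : ℝ, x = c • toReal v := by
  have h1 := finrank_perp (a := a) (act a (toReal v))
  have h2 : Module.finrank ℝ (perp a (act a (toReal v))) = 1 := by have := hv.2.2; omega
  have h3 := (finrank_eq_one_iff_of_nonzero'
    (⟨toReal v, mem_perp_act _⟩ : perp a (act a (toReal v)))
    (fun h => isRay_ne_zero hv (congrArg Subtype.val h))).1 h2 ⟨x, mem_perp_iff.2 hx⟩
  obtain ⟨c, hc⟩ := h3
  exact ⟨c, (congrArg Subtype.val hc).symm⟩

/-- A primitive vector is a ray if the vectors with at least the same active inequalities are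
proportional to it. -/
theorem isRay_of_forall {v : Fin n → ℕ} (hv : Finset.univ.gcd v = 1) (hK : toReal v ∈ HCone a)
    (h : ∀ y, act a (toReal v) ⊆ act a y → ∃ c : ℝ, y = c • toReal v) : IsRay a v := by
  refine ⟨hv, hK, ?_⟩
  have h1 := finrank_perp (a := a) (act a (toReal v))
  have h2 : Module.finrank ℝ (perp a (act a (toReal v))) = 1 :=
    (finrank_eq_one_iff_of_nonzero'
      (⟨toReal v, mem_perp_act _⟩ : perp a (act a (toReal v)))
      (fun h => toReal_ne_zero hv (congrArg Subtype.val h))).2 fun w => by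
        obtain ⟨c, hc⟩ := h w (mem_perp_iff.1 w.2)
        exact ⟨c, Subtype.ext hc.symm⟩
  omega

/-- Two rays with the same active inequalities are equal. -/
theorem IsRay.eq_of_act_subset {v w : Fin n → ℕ} (hv : IsRay a v) (hw : IsRay a w)
    (h : act a (toReal v) ⊆ act a (toReal w)) : v = w := by
  obtain ⟨c, hc⟩ := hv.exists_smul h
  exact eq_of_toReal_eq_smul hv.1 hw.1 hc

/-- There are finitely many rays, since a ray is determined by its active inequalities. -/
theorem finite_isRay (a : ι → Fin n → ℤ) : {v | IsRay a v}.Finite :=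
  Set.Finite.of_injOn (f := fun v => act a (toReal v)) (t := Set.univ) (fun _ _ => Set.mem_univ _)
    (fun _ hv _ hw h => IsRay.eq_of_act_subset hv hw h.subset) Set.finite_univ

/-- Moving from a point of the cone against a vector `y` until an inequality becomes active. -/
theorem exists_wall {x y : Fin n → ℝ} (hx : x ∈ HCone a) (hy : act a x ⊆ act a y)
    (hi : ∃ i, 0 < (fun ρ => (a i ρ : ℝ)) ⬝ᵥ y) :
    ∃ t : ℝ, 0 < t ∧ x - t • y ∈ HCone a ∧ act a x ⊆ act a (x - t • y) ∧
      ∃ i, i ∈ act a (x - t • y) ∧ i ∉ act a y := by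
  classical
  obtain ⟨i₁, hi₁⟩ := hi
  obtain ⟨i₀, hi₀, hmin⟩ := Finset.exists_min_image
    (Finset.univ.filter fun i => 0 < (fun ρ => (a i ρ : ℝ)) ⬝ᵥ y)
    (fun i => ((fun ρ => (a i ρ : ℝ)) ⬝ᵥ x) / ((fun ρ => (a i ρ : ℝ)) ⬝ᵥ y))
    ⟨i₁, by simpa using hi₁⟩
  simp only [Finset.mem_filter, Finset.mem_univ, true_and] at hi₀ hmin
  have hne : ∀ i, 0 < (fun ρ => (a i ρ : ℝ)) ⬝ᵥ y → 0 < (fun ρ => (a i ρ : ℝ)) ⬝ᵥ x := by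
    intro i h
    refine lt_of_le_of_ne (hx i) fun h0 => ?_
    have := mem_act.1 (hy (mem_act.2 h0.symm))
    exact h.ne' this
  set t := ((fun ρ => (a i₀ ρ : ℝ)) ⬝ᵥ x) / ((fun ρ => (a i₀ ρ : ℝ)) ⬝ᵥ y) with ht
  have ht0 : 0 < t := div_pos (hne _ hi₀) hi₀
  refine ⟨t, ht0, fun i => ?_, fun i hi => ?_, i₀, ?_, fun h => hi₀.ne' (mem_act.1 h)⟩
  · rw [dotProduct_sub, dotProduct_smul, smul_eq_mul, sub_nonneg]
    rcases le_or_gt ((fun ρ => (a i ρ : ℝ)) ⬝ᵥ y) 0 with h | h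
    · exact (mul_nonpos_of_nonneg_of_nonpos ht0.le h).trans (hx i)
    · exact (le_div_iff₀ h).1 (hmin i h)
  · rw [mem_act, dotProduct_sub, dotProduct_smul, mem_act.1 hi, mem_act.1 (hy hi), smul_zero,
      sub_zero]
  · rw [mem_act, dotProduct_sub, dotProduct_smul, ht, smul_eq_mul, div_mul_cancel₀ _ hi₀.ne',
      sub_self]

/-- A nonzero point of the cone lies on a face that contains an extremal ray. -/
theorem exists_isRay (ho : HasOrthant a) {x : Fin n → ℝ} (hx : x ∈ HCone a) (h0 : x ≠ 0) :
    ∃ v, IsRay a v ∧ act a x ⊆ act a (toReal v) := by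
  classical
  induction hd : Fintype.card ι - (act a x).card using Nat.strong_induction_on generalizing x with
  | _ d ih =>
  by_cases h1 : ∀ y, act a x ⊆ act a y → ∃ c : ℝ, y = c • x
  · -- the face is a half line
    obtain ⟨z, hz0, hz⟩ := exists_int_mem_perp (mem_perp_act (a := a) x) h0
    obtain ⟨c, hc⟩ := h1 _ (mem_perp_iff.1 hz)
    have hc0 : c ≠ 0 := by
      rintro rfl
      refine hz0 (funext fun ρ => ?_)
      have := congrFun hc ρ
      simpa using this
    have habs : toReal (fun ρ => (z ρ).natAbs) = |c| • x := by
      ext ρ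
      have e := congrFun hc ρ
      simp only [Pi.smul_apply, smul_eq_mul] at e
      simp only [toReal, Nat.cast_natAbs, Int.cast_abs, Pi.smul_apply, smul_eq_mul]
      rw [e, abs_mul, abs_of_nonneg (ho.nonneg hx ρ)]
    obtain ⟨v, d', hd', hv, hvz⟩ := exists_primitive (z := fun ρ => (z ρ).natAbs) (by
      intro h
      refine hz0 (funext fun ρ => ?_)
      have := congrFun h ρ
      simpa using this)
    have hvx : toReal v = (|c| / d') • x := by
      have hd0 : (d' : ℝ) ≠ 0 := by positivity
      rw [div_eq_inv_mul, mul_smul, ← habs, hvz, smul_smul, inv_mul_cancel₀ hd0, one_smul]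
    have hpos : 0 < |c| / d' := by positivity
    have hact : act a (toReal v) = act a x := by rw [hvx, act_smul hpos.ne']
    refine ⟨v, isRay_of_forall hv (hvx ▸ HCone.smul_mem hx hpos.le) fun y hy => ?_, hact.ge⟩
    rw [hact] at hy
    obtain ⟨c', hc'⟩ := h1 y hy
    exact ⟨c' / (|c| / d'), by rw [hvx, smul_smul, div_mul_cancel₀ _ hpos.ne', hc']⟩
  · push Not at h1
    obtain ⟨y, hy, hyx⟩ := h1
    -- otherwise the face has a direction that is not proportional to `x`; up to sign, some
    -- inequality increases in this direction, and moving against it leads to a smaller face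
    have key : ∃ y, act a x ⊆ act a y ∧ (∀ c : ℝ, y ≠ c • x) ∧
        ∃ i, 0 < (fun ρ => (a i ρ : ℝ)) ⬝ᵥ y := by
      by_cases hp : ∃ i, 0 < (fun ρ => (a i ρ : ℝ)) ⬝ᵥ y
      · exact ⟨y, hy, hyx, hp⟩
      · push Not at hp
        refine ⟨-y, fun i hi => ?_, fun c hc => hyx (-c) ?_, ?_⟩
        · rw [mem_act, dotProduct_neg, mem_act.1 (hy hi), neg_zero]
        · rw [neg_smul, ← hc, neg_neg]
        · by_contra! hq
          refine hyx 0 ?_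
          rw [zero_smul]
          refine ho.eq_zero fun i => le_antisymm (hp i) ?_
          have := hq i
          rw [dotProduct_neg] at this
          linarith
    obtain ⟨y, hy, hyx, hi⟩ := key
    obtain ⟨t, ht, hK, hsub, i, hi1, hi2⟩ := exists_wall hx hy hi
    have hne : x - t • y ≠ 0 := by
      intro h
      refine hyx t⁻¹ ?_
      rw [sub_eq_zero.1 h, smul_smul, inv_mul_cancel₀ ht.ne', one_smul]
    have hlt : (act a x).card < (act a (x - t • y)).card :=
      Finset.card_lt_card ⟨hsub, fun h => hi2 (hy (h hi1))⟩
    have hle : (act a (x - t • y)).card ≤ Fintype.card ι := Finset.card_le_univ _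
    obtain ⟨v, hv, hv'⟩ := ih _ (by omega) hK hne rfl
    exact ⟨v, hv, hsub.trans hv'⟩

open Classical in
/-- A chosen extremal ray of the face on which the inequalities in `A` are active. -/
def pick (a : ι → Fin n → ℤ) (A : Finset ι) : Fin n → ℕ :=
  if h : ∃ v, IsRay a v ∧ A ⊆ act a (toReal v) then h.choose else 0

theorem pick_spec {A : Finset ι} (h : ∃ v, IsRay a v ∧ A ⊆ act a (toReal v)) :
    IsRay a (pick a A) ∧ A ⊆ act a (toReal (pick a A)) := by
  rw [pick, dif_pos h]
  exact h.choose_spec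

open Classical in
/-- The cells of the pulling triangulation: `Cell a A V` says that the rays in `V` span a cell
whose points have exactly the inequalities in `A` active. The cell is the join of the chosen ray
of the face `A` with a cell in a face that does not contain that ray. -/
inductive Cell (a : ι → Fin n → ℤ) : Finset ι → Finset (Fin n → ℕ) → Prop
  | nil : Cell a Finset.univ ∅
  | cons (A A' : Finset ι) (V' : Finset (Fin n → ℕ)) (hr : IsRay a (pick a A))
      (hV' : Cell a A' V') (hA : A = A' ∩ act a (toReal (pick a A)))
      (hn : ¬ A' ⊆ act a (toReal (pick a A))) : Cell a A (insert (pick a A) V')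

theorem Cell.isRay {A : Finset ι} {V : Finset (Fin n → ℕ)} (h : Cell a A V) :
    ∀ v ∈ V, IsRay a v ∧ A ⊆ act a (toReal v) := by
  classical
  induction h with
  | nil => simp
  | cons A A' V' hr hV' hA hn ih =>
    intro v hv
    rcases Finset.mem_insert.1 hv with rfl | hv
    · exact ⟨hr, fun i hi => by rw [hA] at hi; exact (Finset.mem_inter.1 hi).2⟩
    · exact ⟨(ih v hv).1, fun i hi => (ih v hv).2 (by
        rw [hA] at hi; exact (Finset.mem_inter.1 hi).1)⟩

theorem mem_cone_insert {V : Finset (Fin n → ℕ)} {v : Fin n → ℕ} (hv : v ∉ V)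
    {x : Fin n → ℝ} :
    x ∈ cone (insert v V) ↔ ∃ t : ℝ, 0 < t ∧ ∃ y ∈ cone V, x = t • toReal v + y := by
  classical
  constructor
  · rintro ⟨c, hc, rfl⟩
    exact ⟨c v, hc v (by simp), _, ⟨c, fun w hw => hc w (by simp [hw]), rfl⟩,
      Finset.sum_insert hv⟩
  · rintro ⟨t, ht, _, ⟨c, hc, rfl⟩, rfl⟩
    refine ⟨Function.update c v t, fun w hw => ?_, ?_⟩
    · by_cases hwv : w = v
      · simpa [hwv] using ht
      · rw [Function.update_of_ne hwv]
        exact hc w (by simpa [hwv] using hw)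
    · rw [Finset.sum_insert hv, Function.update_self]
      congr 1
      refine Finset.sum_congr rfl fun w hw => ?_
      rw [Function.update_of_ne (ne_of_mem_of_not_mem hw hv)]

theorem Cell.notMem {A A' : Finset ι} {V' : Finset (Fin n → ℕ)} (hV' : Cell a A' V')
    (hn : ¬ A' ⊆ act a (toReal (pick a A))) : pick a A ∉ V' :=
  fun h => hn (hV'.isRay _ h).2

/-- A cell lies in the relative interior of its face. -/
theorem Cell.cone_subset {A : Finset ι} {V : Finset (Fin n → ℕ)} (h : Cell a A V) :
    ∀ x ∈ cone V, x ∈ HCone a ∧ act a x = A := by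
  classical
  induction h with
  | nil =>
    rintro _ ⟨c, -, rfl⟩
    rw [Finset.sum_empty]
    exact ⟨zero_mem_HCone, act_zero⟩
  | cons A A' V' hr hV' hA hn ih =>
    intro x hx
    obtain ⟨t, ht, y, hy, rfl⟩ := (mem_cone_insert (hV'.notMem hn)).1 hx
    obtain ⟨hy1, hy2⟩ := ih y hy
    have h1 := HCone.smul_mem hr.2.1 ht.le
    refine ⟨HCone.add_mem h1 hy1, ?_⟩
    ext i
    rw [act_add h1 hy1, act_smul ht.ne', hy2]
    conv_rhs => rw [hA, Finset.mem_inter]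
    exact and_comm

/-- The apex of a cell is off the span of the base, because an inequality that is active on the
base is not active at the apex. -/
theorem Cell.linearIndepOn {A : Finset ι} {V : Finset (Fin n → ℕ)} (h : Cell a A V) :
    LinearIndepOn ℝ toReal (V : Set (Fin n → ℕ)) := by
  classical
  induction h with
  | nil => simp
  | cons A A' V' hr hV' hA hn ih =>
    rw [Finset.coe_insert]
    refine ih.insert fun hmem => hn ?_
    rw [← mem_perp_iff]
    refine Submodule.span_le.2 ?_ hmem
    rintro _ ⟨w, hw, rfl⟩
    exact mem_perp_iff.2 (hV'.isRay w hw).2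

/-- Every point of the cone lies on a cell: it is moved away from the chosen ray of its face until
another inequality becomes active. -/
theorem exists_cell (ho : HasOrthant a) {x : Fin n → ℝ} (hx : x ∈ HCone a) :
    ∃ V, Cell a (act a x) V ∧ x ∈ cone V := by
  classical
  induction hd : Fintype.card ι - (act a x).card using Nat.strong_induction_on generalizing x with
  | _ d ih =>
  by_cases h0 : x = 0
  · subst h0
    exact ⟨∅, by rw [act_zero]; exact Cell.nil, 0, by simp, by simp⟩
  · obtain ⟨hr, hsub⟩ := pick_spec (exists_isRay ho hx h0)
    have hi : ∃ i, 0 < (fun ρ => (a i ρ : ℝ)) ⬝ᵥ toReal (pick a (act a x)) := by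
      by_contra! hq
      exact isRay_ne_zero hr (ho.eq_zero fun i => le_antisymm (hq i) (hr.2.1 i))
    obtain ⟨t, ht, hK, hsub', i, hi1, hi2⟩ := exists_wall hx hsub hi
    have hlt : (act a x).card < (act a (x - t • toReal (pick a (act a x)))).card :=
      Finset.card_lt_card ⟨hsub', fun h => hi2 (hsub (h hi1))⟩
    have hle : (act a (x - t • toReal (pick a (act a x)))).card ≤ Fintype.card ι :=
      Finset.card_le_univ _
    obtain ⟨V, hV, hxV⟩ := ih _ (by omega) hK rfl
    have hn : ¬ act a (x - t • toReal (pick a (act a x))) ⊆ act a (toReal (pick a (act a x))) :=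
      fun h => hi2 (h hi1)
    have hx' : x = t • toReal (pick a (act a x)) + (x - t • toReal (pick a (act a x))) := by
      abel
    refine ⟨insert (pick a (act a x)) V, Cell.cons _ _ _ hr hV ?_ hn,
      (mem_cone_insert (hV.notMem hn)).2 ⟨t, ht, _, hxV, hx'⟩⟩
    ext i
    rw [Finset.mem_inter]
    refine ⟨fun h => ⟨hsub' h, hsub h⟩, fun ⟨h1, h2⟩ => ?_⟩
    rw [hx', act_add (HCone.smul_mem hr.2.1 ht.le) hK, act_smul ht.ne']
    exact ⟨h2, h1⟩

/-- Different cells of the pulling triangulation are disjoint. -/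
theorem Cell.unique {A : Finset ι} {V W : Finset (Fin n → ℕ)} (hV : Cell a A V)
    (hW : Cell a A W) {x : Fin n → ℝ} (hxV : x ∈ cone V) (hxW : x ∈ cone W) : V = W := by
  classical
  induction hV generalizing W x with
  | nil =>
    generalize hB : (Finset.univ : Finset ι) = B at hW
    cases hW with
    | nil => rfl
    | cons _ A' V' hr hV' hA hn =>
      subst hB
      exact absurd (fun i _ => (Finset.mem_inter.1 (hA ▸ Finset.mem_univ i)).2) hn
  | cons A A' V' hr hV' hA hn ih =>
    generalize hB : A = B at hW
    cases hW with
    | nil =>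
      subst hB
      exact absurd (fun i _ => (Finset.mem_inter.1 (hA ▸ Finset.mem_univ i)).2) hn
    | cons _ B' W' hr' hW' hA' hn' =>
      subst hB
      obtain ⟨c, hc, y, hy, hxy⟩ := (mem_cone_insert (hV'.notMem hn)).1 hxV
      obtain ⟨d, hd, z, hz, hxz⟩ := (mem_cone_insert (hW'.notMem hn')).1 hxW
      obtain ⟨hyK, hyA⟩ := hV'.cone_subset y hy
      obtain ⟨hzK, hzA⟩ := hW'.cone_subset z hz
      have aux : ∀ (e : ℝ) (y z : Fin n → ℝ), 0 < e → z ∈ HCone a →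
          y = e • toReal (pick a A) + z → act a y ⊆ act a (toReal (pick a A)) := by
        intro e y z he hz hyz i hi
        rw [hyz, act_add (HCone.smul_mem hr.2.1 he.le) hz, act_smul he.ne'] at hi
        exact hi.1
      rcases lt_trichotomy c d with h | h | h
      · refine absurd ?_ hn
        rw [← hyA]
        refine aux (d - c) y z (by linarith) hzK ?_
        rw [sub_smul, sub_add_eq_add_sub, ← hxz, hxy]; abel
      · subst h
        have : y = z := add_left_cancel (hxy.symm.trans hxz)
        subst this
        have hAB : A' = B' := hyA.symm.trans hzA
        subst hAB
        rw [ih hW' hy hz]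
      · refine absurd ?_ hn'
        rw [← hzA]
        refine aux (c - d) z y (by linarith) hyK ?_
        rw [sub_smul, sub_add_eq_add_sub, ← hxy, hxz]; abel

/-- The relative interior of a face is strictly positively spanned by the extremal rays of the
face. -/
theorem mem_cone_rays_iff (ho : HasOrthant a) {A : Finset ι} {k₀ : Fin n → ℝ}
    (hk₀ : k₀ ∈ HCone a) (hA : act a k₀ = A) {V : Finset (Fin n → ℕ)}
    (hV : ∀ v, v ∈ V ↔ IsRay a v ∧ A ⊆ act a (toReal v)) {x : Fin n → ℝ} :
    x ∈ cone V ↔ x ∈ HCone a ∧ act a x = A := by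
  classical
  have hVK : ∀ v ∈ V, toReal v ∈ HCone a := fun v hv => ((hV v).1 hv).1.2.1
  have hact : ∀ c : (Fin n → ℕ) → ℝ, (∀ v ∈ V, 0 < c v) →
      act a (∑ v ∈ V, c v • toReal v) = A := by
    intro c hc
    ext i
    rw [mem_act_sum hVK hc]
    refine ⟨fun h => ?_, fun h v hv => ((hV v).1 hv).2 h⟩
    obtain ⟨W, hW, d, hd, hk⟩ := exists_cell ho hk₀
    rw [← hA, hk, mem_act_sum (fun v hv => (hW.isRay v hv).1.2.1) hd]
    exact fun v hv => h v ((hV v).2 (hA ▸ hW.isRay v hv))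
  constructor
  · rintro ⟨c, hc, rfl⟩
    exact ⟨sum_mem_HCone hVK fun v hv => (hc v hv).le, hact c hc⟩
  · rintro ⟨hx, hxA⟩
    -- a small multiple of the sum of all rays is split off, so that every ray occurs with a
    -- positive coefficient in the sum of this multiple and a point of a cell
    set s := ∑ v ∈ V, (1 : ℝ) • toReal v with hs
    have hsA : act a s = A := hact (fun _ => 1) fun _ _ => one_pos
    have hev : ∀ᶠ ε in nhdsWithin (0 : ℝ) (Set.Ioi 0), ∀ i, i ∉ A →
        0 < (fun ρ => (a i ρ : ℝ)) ⬝ᵥ (x - ε • s) := by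
      rw [Filter.eventually_all]
      intro i
      by_cases hi : i ∈ A
      · exact Filter.Eventually.of_forall fun _ h => absurd hi h
      · have hpos : 0 < (fun ρ => (a i ρ : ℝ)) ⬝ᵥ (x - (0 : ℝ) • s) := by
          rw [zero_smul, sub_zero]
          exact lt_of_le_of_ne (hx i) fun h => hi (hxA ▸ mem_act.2 h.symm)
        have hcont : Continuous fun ε : ℝ => (fun ρ => (a i ρ : ℝ)) ⬝ᵥ (x - ε • s) := by
          simp only [dotProduct_sub, dotProduct_smul]
          fun_prop
        exact ((hcont.tendsto 0).eventually (lt_mem_nhds hpos)).filter_mono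
          nhdsWithin_le_nhds |>.mono fun ε h _ => h
    obtain ⟨ε, hε, hε0⟩ := (hev.and self_mem_nhdsWithin).exists
    have hε0 : 0 < ε := hε0
    have hz : ∀ i ∈ A, (fun ρ => (a i ρ : ℝ)) ⬝ᵥ (x - ε • s) = 0 := by
      intro i hi
      rw [dotProduct_sub, dotProduct_smul, mem_act.1 (hsA.ge hi), mem_act.1 (hxA.ge hi),
        smul_zero, sub_zero]
    have hK : x - ε • s ∈ HCone a := fun i => by
      by_cases hi : i ∈ A
      · exact (hz i hi).ge
      · exact (hε i hi).le
    have hKA : act a (x - ε • s) = A := by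
      ext i
      rw [mem_act]
      exact ⟨fun h => by_contra fun hi => (hε i hi).ne' h, hz i⟩
    obtain ⟨W, hW, d, hd, hk⟩ := exists_cell ho hK
    have hWV : W ⊆ V := fun w hw => (hV w).2 (hKA ▸ hW.isRay w hw)
    refine ⟨fun v => ε + if v ∈ W then d v else 0, fun v _ => ?_, ?_⟩
    · beta_reduce
      split_ifs with h
      · linarith [hd v h]
      · linarith
    · have hx' : x = ε • s + (x - ε • s) := by abel
      rw [hx', hk, hs, Finset.smul_sum]
      simp only [add_smul, ite_smul, zero_smul, Finset.sum_add_distrib, one_smul]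
      rw [Finset.sum_ite_mem, Finset.inter_eq_right.2 hWV]

end HCone

/-! ### Compact faces of the Newton polyhedron -/

section Newton

variable {n : ℕ} {f : MvPolynomial (Fin n) ℂ}

/-- An exponent as a real vector. -/
abbrev expVec (ω : Fin n →₀ ℕ) : Fin n → ℝ := fun ρ => (ω ρ : ℝ)

/-- A point of the Newton polyhedron dominates a convex combination of exponents. -/
theorem mem_newton {x : Fin n → ℝ} : x ∈ newton f ↔ ∃ w : (Fin n →₀ ℕ) → ℝ, (∀ ω, 0 ≤ w ω) ∧
    ∑ ω ∈ f.support, w ω = 1 ∧ ∀ ρ, ∑ ω ∈ f.support, w ω * ω ρ ≤ x ρ := by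
  classical
  constructor
  · intro hx
    refine convexHull_min (t := {x : Fin n → ℝ | ∃ w : (Fin n →₀ ℕ) → ℝ, (∀ ω, 0 ≤ w ω) ∧
      ∑ ω ∈ f.support, w ω = 1 ∧ ∀ ρ, ∑ ω ∈ f.support, w ω * ω ρ ≤ x ρ}) ?_ ?_ hx
    · intro y hy
      simp only [Set.mem_iUnion] at hy
      obtain ⟨ν, hν, hy⟩ := hy
      refine ⟨Pi.single ν 1, fun ω => ?_, ?_, fun ρ => ?_⟩
      · by_cases h : ω = ν
        · subst h; simp
        · simp [h]
      · simp [Pi.single_apply, hν]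
      · simpa [Pi.single_apply, hν] using hy ρ
    · rintro x ⟨w, hw, hw1, hwx⟩ y ⟨u, hu, hu1, huy⟩ s t hs ht hst
      refine ⟨fun ω => s * w ω + t * u ω, fun ω => by
        have := hw ω; have := hu ω; positivity, ?_, fun ρ => ?_⟩
      · rw [Finset.sum_add_distrib, ← Finset.mul_sum, ← Finset.mul_sum, hw1, hu1]
        linarith
      · calc ∑ ω ∈ f.support, (s * w ω + t * u ω) * ω ρ
            = s * ∑ ω ∈ f.support, w ω * ω ρ + t * ∑ ω ∈ f.support, u ω * ω ρ := by
              rw [Finset.mul_sum, Finset.mul_sum, ← Finset.sum_add_distrib]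
              exact Finset.sum_congr rfl fun ω _ => by ring
          _ ≤ s * x ρ + t * y ρ :=
              add_le_add (mul_le_mul_of_nonneg_left (hwx ρ) hs)
                (mul_le_mul_of_nonneg_left (huy ρ) ht)
  · rintro ⟨w, hw, hw1, hwx⟩
    have hx : x = ∑ ω ∈ f.support, w ω •
        (fun ρ => (ω ρ : ℝ) + (x ρ - ∑ ω ∈ f.support, w ω * ω ρ)) := by
      ext ρ
      simp only [Finset.sum_apply, Pi.smul_apply, smul_eq_mul, mul_add, Finset.sum_add_distrib]
      rw [← Finset.sum_mul, hw1]
      ring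
    rw [hx]
    refine (convex_convexHull ℝ _).sum_mem (fun ω _ => hw ω) hw1 fun ω hω => ?_
    refine subset_convexHull ℝ _ (Set.mem_biUnion hω fun ρ => ?_)
    have := hwx ρ
    linarith

theorem expVec_mem_newton {ω : Fin n →₀ ℕ} (hω : ω ∈ f.support) : expVec ω ∈ newton f :=
  subset_convexHull ℝ _ (Set.mem_biUnion hω fun _ => le_rfl)

theorem newton_add {x d : Fin n → ℝ} (hx : x ∈ newton f) (hd : ∀ ρ, 0 ≤ d ρ) :
    x + d ∈ newton f := by
  obtain ⟨w, hw, hw1, hwx⟩ := mem_newton.1 hx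
  exact mem_newton.2 ⟨w, hw, hw1, fun ρ => (hwx ρ).trans (by simpa using hd ρ)⟩

theorem dotProduct_weights (k : Fin n → ℝ) (w : (Fin n →₀ ℕ) → ℝ) :
    (∑ ρ, k ρ * ∑ ω ∈ f.support, w ω * ω ρ) = ∑ ω ∈ f.support, w ω * (k ⬝ᵥ expVec ω) := by
  simp only [dotProduct, Finset.mul_sum]
  rw [Finset.sum_comm]
  exact Finset.sum_congr rfl fun ω _ => Finset.sum_congr rfl fun ρ _ => by ring

/-- For `k ≥ 0`, the minimum of `k` on the Newton polyhedron is attained at an exponent. -/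
theorem exists_isLeast (hf : f ≠ 0) {k : Fin n → ℝ} (hk : ∀ ρ, 0 ≤ k ρ) :
    ∃ α ∈ f.support, k ⬝ᵥ expVec α = m f k ∧ ∀ x ∈ newton f, m f k ≤ k ⬝ᵥ x := by
  obtain ⟨α, hα, hmin⟩ := Finset.exists_min_image f.support (fun ω => k ⬝ᵥ expVec ω)
    (MvPolynomial.support_nonempty.2 hf)
  have hle : ∀ x ∈ newton f, k ⬝ᵥ expVec α ≤ k ⬝ᵥ x := by
    intro x hx
    obtain ⟨w, hw, hw1, hwx⟩ := mem_newton.1 hx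
    calc k ⬝ᵥ expVec α = ∑ ω ∈ f.support, w ω * (k ⬝ᵥ expVec α) := by
          rw [← Finset.sum_mul, hw1, one_mul]
      _ ≤ ∑ ω ∈ f.support, w ω * (k ⬝ᵥ expVec ω) :=
          Finset.sum_le_sum fun ω hω => mul_le_mul_of_nonneg_left (hmin ω hω) (hw ω)
      _ = ∑ ρ, k ρ * ∑ ω ∈ f.support, w ω * ω ρ := (dotProduct_weights k w).symm
      _ ≤ k ⬝ᵥ x := Finset.sum_le_sum fun ρ _ => mul_le_mul_of_nonneg_left (hwx ρ) (hk ρ)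
  have hm : m f k = k ⬝ᵥ expVec α := by
    refine IsLeast.csInf_eq ⟨⟨_, expVec_mem_newton hα, rfl⟩, ?_⟩
    rintro _ ⟨x, hx, rfl⟩
    exact hle x hx
  exact ⟨α, hα, hm.symm, fun x hx => hm ▸ hle x hx⟩

theorem m_le (hf : f ≠ 0) {k : Fin n → ℝ} (hk : ∀ ρ, 0 ≤ k ρ) {x : Fin n → ℝ}
    (hx : x ∈ newton f) : m f k ≤ k ⬝ᵥ x := by
  obtain ⟨_, _, _, h⟩ := exists_isLeast hf hk
  exact h x hx

/-- A point of the first meet locus of `k` is a convex combination of exponents in that locus plus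
a nonnegative vector supported where `k` vanishes. -/
theorem exists_weights_of_mem_firstMeet (hf : f ≠ 0) {k : Fin n → ℝ} (hk : ∀ ρ, 0 ≤ k ρ)
    {x : Fin n → ℝ} (hx : x ∈ firstMeet f k) : ∃ w : (Fin n →₀ ℕ) → ℝ, (∀ ω, 0 ≤ w ω) ∧
      ∑ ω ∈ f.support, w ω = 1 ∧ (∀ ρ, ∑ ω ∈ f.support, w ω * ω ρ ≤ x ρ) ∧
      (∀ ω ∈ f.support, w ω ≠ 0 → k ⬝ᵥ expVec ω = m f k) ∧
      ∀ ρ, k ρ ≠ 0 → ∑ ω ∈ f.support, w ω * ω ρ = x ρ := by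
  obtain ⟨hx, hxm⟩ := hx
  obtain ⟨w, hw, hw1, hwx⟩ := mem_newton.1 hx
  have h1 : ∀ ω ∈ f.support, w ω * m f k ≤ w ω * (k ⬝ᵥ expVec ω) := fun ω hω =>
    mul_le_mul_of_nonneg_left (m_le hf hk (expVec_mem_newton hω)) (hw ω)
  have h2 : ∀ ρ ∈ Finset.univ, k ρ * ∑ ω ∈ f.support, w ω * ω ρ ≤ k ρ * x ρ := fun ρ _ =>
    mul_le_mul_of_nonneg_left (hwx ρ) (hk ρ)
  have e0 : ∑ ω ∈ f.support, w ω * m f k = m f k := by rw [← Finset.sum_mul, hw1, one_mul]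
  have h3 := Finset.sum_le_sum h1
  have h4 := Finset.sum_le_sum h2
  have h5 := dotProduct_weights (f := f) k w
  have h6 : ∑ ρ, k ρ * x ρ = m f k := hxm
  have e1 := (Finset.sum_eq_sum_iff_of_le h1).1 (by linarith)
  have e2 := (Finset.sum_eq_sum_iff_of_le h2).1 (by linarith)
  refine ⟨w, hw, hw1, hwx, fun ω hω h => ?_, fun ρ h => ?_⟩
  · exact (mul_left_cancel₀ h (e1 ω hω)).symm
  · exact mul_left_cancel₀ h (e2 ρ (Finset.mem_univ ρ))

theorem convex_firstMeet (k : Fin n → ℝ) : Convex ℝ (firstMeet f k) := by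
  have h : Convex ℝ {x : Fin n → ℝ | k ⬝ᵥ x = m f k} :=
    convex_hyperplane ⟨fun a b => dotProduct_add _ a b, fun c a => by simp [dotProduct_smul]⟩ _
  exact (convex_convexHull ℝ _).inter h

/-- The exponents of `f` that lie on `τ`. -/
def faceSupp (f : MvPolynomial (Fin n) ℂ) (τ : Set (Fin n → ℝ)) : Set (Fin n →₀ ℕ) :=
  {ω | ω ∈ f.support ∧ expVec ω ∈ τ}

/-- For `k > 0`, the first meet locus is the convex hull of the exponents on it, so it is compact.
-/
theorem firstMeet_eq_convexHull (hf : f ≠ 0) {k : Fin n → ℝ} (hk : ∀ ρ, 0 < k ρ) :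
    firstMeet f k = convexHull ℝ (expVec '' faceSupp f (firstMeet f k)) := by
  apply Set.Subset.antisymm
  · intro x hx
    obtain ⟨w, hw, hw1, -, hwm, hwx⟩ :=
      exists_weights_of_mem_firstMeet hf (fun ρ => (hk ρ).le) hx
    have hx' : x = ∑ ω ∈ f.support, w ω • expVec ω := by
      ext ρ
      rw [Finset.sum_apply, ← hwx ρ (hk ρ).ne']
      rfl
    rw [hx', ← Finset.sum_subset (Finset.filter_subset (fun ω => w ω ≠ 0) _) (by
      intro ω hω h
      have : w ω = 0 := by
        by_contra h0
        exact h (Finset.mem_filter.2 ⟨hω, h0⟩)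
      rw [this, zero_smul])]
    refine (convex_convexHull ℝ _).sum_mem (fun ω _ => hw ω) ?_ fun ω hω => ?_
    · rw [Finset.sum_filter_ne_zero, hw1]
    · obtain ⟨h1, h2⟩ := Finset.mem_filter.1 hω
      exact subset_convexHull ℝ _ ⟨ω, ⟨h1, expVec_mem_newton h1, hwm ω h1 h2⟩, rfl⟩
  · refine convexHull_min ?_ (convex_firstMeet k)
    rintro _ ⟨ω, hω, rfl⟩
    exact hω.2

theorem finite_faceSupp (τ : Set (Fin n → ℝ)) : (faceSupp f τ).Finite :=
  f.support.finite_toSet.subset fun _ h => h.1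

/-- A compact face is the first meet locus of a vector with positive coordinates. -/
theorem CompactFace.exists_pos (τ : CompactFace f) :
    ∃ k : Fin n → ℝ, (∀ ρ, 0 < k ρ) ∧ τ.1 = firstMeet f k := by
  classical
  obtain ⟨τ, hexp, ⟨x₀, hx₀⟩, hcomp⟩ := τ
  obtain ⟨l, hl⟩ := hexp ⟨x₀, hx₀⟩
  set k : Fin n → ℝ := fun ρ => - l (Pi.single ρ 1) with hk
  have hlk : ∀ x, l x = - (k ⬝ᵥ x) := by
    intro x
    conv_lhs => rw [pi_eq_sum_univ' x]
    rw [map_sum, dotProduct, ← Finset.sum_neg_distrib]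
    refine Finset.sum_congr rfl fun ρ _ => ?_
    rw [map_smul, hk, smul_eq_mul]
    ring
  have hx₀' := hl ▸ hx₀
  have hmem : ∀ x, x ∈ τ ↔ x ∈ newton f ∧ ∀ y ∈ newton f, k ⬝ᵥ x ≤ k ⬝ᵥ y := by
    intro x
    rw [hl]
    refine and_congr_right fun _ => forall₂_congr fun y _ => ?_
    rw [hlk, hlk, neg_le_neg_iff]
  have hsingle : ∀ ρ (t : ℝ), 0 ≤ t → x₀ + Pi.single ρ t ∈ newton f := fun ρ t ht =>
    newton_add ((hmem x₀).1 hx₀).1 fun ρ' => by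
      by_cases h : ρ' = ρ
      · subst h; simpa using ht
      · simp [h]
  -- if a coordinate of `k` were zero, the face would contain a half line in this direction
  have hk0 : ∀ ρ, 0 < k ρ := by
    intro ρ
    have h1 : 0 ≤ k ρ := by
      have := ((hmem x₀).1 hx₀).2 _ (hsingle ρ 1 zero_le_one)
      rw [dotProduct_add, dotProduct_single] at this
      linarith
    refine lt_of_le_of_ne h1 fun h0 => ?_
    obtain ⟨R, hR⟩ := hcomp.isBounded.subset_closedBall 0
    have h2 : ∀ t : ℝ, 0 ≤ t → x₀ + Pi.single ρ t ∈ τ := by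
      intro t ht
      refine (hmem _).2 ⟨hsingle ρ t ht, fun y hy => ?_⟩
      rw [dotProduct_add, dotProduct_single, ← h0, zero_mul, add_zero]
      exact ((hmem x₀).1 hx₀).2 y hy
    have h3 := hR (h2 (|R| + |x₀ ρ| + 1) (by positivity))
    rw [mem_closedBall_zero_iff] at h3
    have h4 := (norm_le_pi_norm (x₀ + Pi.single ρ (|R| + |x₀ ρ| + 1)) ρ).trans h3
    simp only [Pi.add_apply, Pi.single_eq_same, Real.norm_eq_abs] at h4
    have := le_abs_self R
    have := neg_abs_le (x₀ ρ)
    have := (le_abs_self _).trans h4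
    linarith
  refine ⟨k, hk0, ?_⟩
  have hm : m f k = k ⬝ᵥ x₀ := by
    refine IsLeast.csInf_eq ⟨⟨_, ((hmem x₀).1 hx₀).1, rfl⟩, ?_⟩
    rintro _ ⟨x, hx, rfl⟩
    exact ((hmem x₀).1 hx₀).2 x hx
  ext x
  rw [hmem, firstMeet]
  refine and_congr_right fun hx => ⟨fun h => ?_, fun h y hy => ?_⟩
  · exact le_antisymm ((h _ ((hmem x₀).1 hx₀).1).trans hm.ge)
      (hm.le.trans (((hmem x₀).1 hx₀).2 x hx))
  · rw [show k ⬝ᵥ x = m f k from h, hm]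
    exact ((hmem x₀).1 hx₀).2 y hy

theorem CompactFace.eq_convexHull (hf : f ≠ 0) (τ : CompactFace f) :
    τ.1 = convexHull ℝ (expVec '' faceSupp f τ.1) := by
  obtain ⟨k, hk, h⟩ := τ.exists_pos
  rw [h]
  exact firstMeet_eq_convexHull hf hk

/-- A compact face is determined by the exponents on it. -/
theorem finite_compactFace (hf : f ≠ 0) : Finite (CompactFace f) := by
  have h : (f.support : Set (Fin n →₀ ℕ)).powerset.Finite := f.support.finite_toSet.powerset
  have := h.to_subtype
  refine Finite.of_injective (β := (f.support : Set (Fin n →₀ ℕ)).powerset)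
    (fun τ => ⟨faceSupp f τ.1, fun _ h => h.1⟩) fun τ τ' h => Subtype.ext ?_
  rw [τ.eq_convexHull hf, τ'.eq_convexHull hf,
      show faceSupp f τ.1 = faceSupp f τ'.1 from congrArg Subtype.val h]

/-- The first meet locus of a vector with positive coordinates is a compact face. -/
def compactFaceOf (hf : f ≠ 0) {k : Fin n → ℝ} (hk : ∀ ρ, 0 < k ρ) : CompactFace f :=
  ⟨firstMeet f k, by
    obtain ⟨α, hα, hαm, hmin⟩ := exists_isLeast hf fun ρ => (hk ρ).le
    refine ⟨fun _ => ⟨-(LinearMap.toContinuousLinearMap (dotProductBilin ℝ ℝ k)), ?_⟩,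
      ⟨_, expVec_mem_newton hα, hαm⟩, ?_⟩
    · ext x
      refine and_congr_right fun hx => ⟨fun h y hy => ?_, fun h => ?_⟩
      · have h1 := hmin y hy
        rw [← show k ⬝ᵥ x = m f k from h] at h1
        exact neg_le_neg h1
      · have h1 : k ⬝ᵥ x ≤ k ⬝ᵥ expVec α := neg_le_neg_iff.1 (h _ (expVec_mem_newton hα))
        exact le_antisymm (h1.trans hαm.le) (hmin x hx)
    · rw [firstMeet_eq_convexHull hf hk]
      exact ((finite_faceSupp _).image _).isCompact_convexHull ℝ⟩

theorem CompactFace.nonempty_faceSupp (hf : f ≠ 0) (τ : CompactFace f) :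
    (faceSupp f τ.1).Nonempty := by
  obtain ⟨x, hx⟩ := τ.2.2.1
  rw [τ.eq_convexHull hf] at hx
  by_contra h
  rw [Set.not_nonempty_iff_eq_empty.1 h, Set.image_empty, convexHull_empty] at hx
  exact hx

/-- A compact face lies in `x_ρ = 0` if and only if the exponents on it do not involve `x_ρ`. -/
theorem mem_P_iff (hf : f ≠ 0) (τ : CompactFace f) (ρ : Fin n) :
    ρ ∈ P τ.1 ↔ ∀ ω ∈ faceSupp f τ.1, ω ρ = 0 := by
  simp only [P, Finset.mem_filter, Finset.mem_univ, true_and]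
  constructor
  · intro h ω hω
    exact_mod_cast h _ hω.2
  · intro h x hx
    rw [τ.eq_convexHull hf] at hx
    refine convexHull_min (t := {x | x ρ = 0}) ?_ ?_ hx
    · rintro _ ⟨ω, hω, rfl⟩
      exact Nat.cast_eq_zero.2 (h ω hω)
    · exact convex_hyperplane (f := fun x : Fin n → ℝ => x ρ)
        ⟨fun _ _ => rfl, fun _ _ => rfl⟩ 0

/-- Otherwise the compact face would be the origin, and `f` would have a constant term. -/
theorem card_P_lt (hf : f ≠ 0) (hf0 : MvPolynomial.eval 0 f = 0) (τ : CompactFace f) :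
    (P τ.1).card + 1 ≤ n := by
  by_contra! h
  have hP : P τ.1 = Finset.univ := by
    rw [← Finset.card_eq_iff_eq_univ, Fintype.card_fin]
    have := Finset.card_le_univ (P τ.1)
    rw [Fintype.card_fin] at this
    omega
  obtain ⟨ω, hω⟩ := τ.nonempty_faceSupp hf
  have h0 : ω = 0 := by
    ext ρ
    exact (mem_P_iff hf τ ρ).1 (hP ▸ Finset.mem_univ ρ) ω hω
  have h1 := hω.1
  rw [h0, MvPolynomial.mem_support_iff] at h1
  refine h1 ?_
  rw [← MvPolynomial.constantCoeff_eq, ← MvPolynomial.eval_zero]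
  exact hf0

theorem disjoint_vars_facePoly (hf : f ≠ 0) (τ : CompactFace f) :
    Disjoint (facePoly f τ).vars (P τ.1) := by
  classical
  rw [Finset.disjoint_left]
  intro ρ hρ hP
  obtain ⟨ω, hω, hωρ⟩ := (MvPolynomial.mem_vars_iff_mem_support ρ).1 hρ
  have h1 := MvPolynomial.support_sum hω
  simp only [Finset.mem_biUnion, Finset.mem_filter] at h1
  obtain ⟨ν, ⟨hν, hντ⟩, hων⟩ := h1
  have h2 := Finset.mem_singleton.1 (MvPolynomial.support_monomial_subset hων)
  subst h2
  exact (Finsupp.mem_support_iff.1 hωρ) ((mem_P_iff hf τ ρ).1 hP ω ⟨hν, hντ⟩)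

/-- For `k` in the cone dual to `τ`, the face polynomial is the initial part of `f` for the
weights `k`. -/
theorem facePoly_eq_initPart (hf : f ≠ 0) {τ : Set (Fin n → ℝ)} {k : Fin n → ℕ}
    (hk : toReal k ∈ dualCone f τ) : facePoly f τ = initPart f k (mNat f k) := by
  classical
  unfold facePoly initPart
  refine Finset.sum_congr (Finset.filter_congr fun ω hω => ?_) fun _ _ => rfl
  rw [← hk.2, firstMeet, Set.mem_ofPred_eq, m_toReal hf, and_iff_right (expVec_mem_newton hω)]
  have : toReal k ⬝ᵥ expVec ω = ((∑ ρ, k ρ * ω ρ : ℕ) : ℝ) := by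
    push_cast
    rfl
  rw [this, Nat.cast_inj]

/-- The inequalities defining the cone of the `k ≥ 0` that are minimal at the exponent `α` on the
Newton polyhedron. -/
def faceIneq (f : MvPolynomial (Fin n) ℂ) (α : Fin n →₀ ℕ) :
    {ω // ω ∈ f.support} ⊕ Fin n → Fin n → ℤ :=
  Sum.elim (fun ω ρ => (ω.1 ρ : ℤ) - α ρ) fun ρ => Pi.single ρ 1

open Classical in
/-- The inequalities that are equalities on the cone dual to `τ`. -/
def faceAct (f : MvPolynomial (Fin n) ℂ) (τ : Set (Fin n → ℝ)) :
    Finset ({ω // ω ∈ f.support} ⊕ Fin n) :=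
  Finset.univ.filter (Sum.elim (fun ω => expVec ω.1 ∈ τ) fun _ => False)

variable {α : Fin n →₀ ℕ}

theorem inl_mem_faceAct {τ : Set (Fin n → ℝ)} {ω : {ω // ω ∈ f.support}} :
    Sum.inl ω ∈ faceAct f τ ↔ expVec ω.1 ∈ τ := by simp [faceAct]

theorem inr_notMem_faceAct {τ : Set (Fin n → ℝ)} {ρ : Fin n} :
    Sum.inr ρ ∉ faceAct f τ := by simp [faceAct]

theorem faceIneq_inl_eq (ω : {ω // ω ∈ f.support}) :
    (fun ρ => (faceIneq f α (Sum.inl ω) ρ : ℝ)) = expVec ω.1 - expVec α := by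
  ext ρ
  simp [faceIneq]

theorem faceIneq_inr_eq (ρ : Fin n) :
    (fun ρ' => (faceIneq f α (Sum.inr ρ) ρ' : ℝ)) = Pi.single ρ 1 := by
  ext ρ'
  by_cases h : ρ' = ρ
  · subst h; simp [faceIneq]
  · simp [faceIneq, h]

theorem faceIneq_inl_dot (ω : {ω // ω ∈ f.support}) (x : Fin n → ℝ) :
    (fun ρ => (faceIneq f α (Sum.inl ω) ρ : ℝ)) ⬝ᵥ x = x ⬝ᵥ expVec ω.1 - x ⬝ᵥ expVec α := by
  rw [faceIneq_inl_eq, sub_dotProduct, dotProduct_comm, dotProduct_comm (expVec α)]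

theorem faceIneq_inr_dot (ρ : Fin n) (x : Fin n → ℝ) :
    (fun ρ' => (faceIneq f α (Sum.inr ρ) ρ' : ℝ)) ⬝ᵥ x = x ρ := by
  rw [faceIneq_inr_eq, single_one_dotProduct]

theorem hasOrthant_faceIneq : HasOrthant (faceIneq f α) := fun ρ => ⟨Sum.inr ρ, rfl⟩

theorem mem_HCone_faceIneq {x : Fin n → ℝ} : x ∈ HCone (faceIneq f α) ↔
    (∀ ρ, 0 ≤ x ρ) ∧ ∀ ω ∈ f.support, x ⬝ᵥ expVec α ≤ x ⬝ᵥ expVec ω := by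
  constructor
  · intro h
    refine ⟨fun ρ => hasOrthant_faceIneq.nonneg h ρ, fun ω hω => ?_⟩
    have := h (Sum.inl ⟨ω, hω⟩)
    rw [faceIneq_inl_dot] at this
    linarith
  · rintro ⟨h1, h2⟩ (ω | ρ)
    · rw [faceIneq_inl_dot]
      linarith [h2 ω.1 ω.2]
    · rw [faceIneq_inr_dot]
      exact h1 ρ

theorem inl_mem_act {x : Fin n → ℝ} {ω : {ω // ω ∈ f.support}} :
    Sum.inl ω ∈ act (faceIneq f α) x ↔ x ⬝ᵥ expVec ω.1 = x ⬝ᵥ expVec α := by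
  rw [mem_act, faceIneq_inl_dot, sub_eq_zero]

theorem inr_mem_act {x : Fin n → ℝ} {ρ : Fin n} :
    Sum.inr ρ ∈ act (faceIneq f α) x ↔ x ρ = 0 := by
  rw [mem_act, faceIneq_inr_dot]

/-- On the cone of `faceIneq f α`, the function `m` is linear, given by the exponent `α`. -/
theorem m_eq_of_mem_HCone (hf : f ≠ 0) (hα : α ∈ f.support) {x : Fin n → ℝ}
    (hx : x ∈ HCone (faceIneq f α)) : m f x = x ⬝ᵥ expVec α := by
  obtain ⟨h1, h2⟩ := mem_HCone_faceIneq.1 hx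
  obtain ⟨β, hβ, hβm, hmin⟩ := exists_isLeast hf h1
  exact le_antisymm (hmin _ (expVec_mem_newton hα)) (hβm ▸ h2 β hβ)

/-- A vector is in the cone dual to a compact face if and only if its coordinates are positive,
and the exponents at which it is minimal are those on the face. -/
theorem mem_dualCone_iff (hf : f ≠ 0) (τ : CompactFace f) (hα : α ∈ faceSupp f τ.1)
    {x : Fin n → ℝ} :
    x ∈ dualCone f τ.1 ↔ x ∈ HCone (faceIneq f α) ∧ act (faceIneq f α) x = faceAct f τ.1 := by
  constructor
  · rintro ⟨h0, hx⟩
    have hαx : expVec α ∈ firstMeet f x := hx ▸ hα.2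
    have hK : x ∈ HCone (faceIneq f α) := mem_HCone_faceIneq.2 ⟨h0, fun ω hω => by
      rw [show x ⬝ᵥ expVec α = m f x from hαx.2]
      exact m_le hf h0 (expVec_mem_newton hω)⟩
    refine ⟨hK, ?_⟩
    ext i
    rcases i with ω | ρ
    · rw [inl_mem_act, inl_mem_faceAct, ← hx, show x ⬝ᵥ expVec α = m f x from hαx.2]
      exact ⟨fun h => ⟨expVec_mem_newton ω.2, h⟩, fun h => h.2⟩
    · rw [inr_mem_act]
      refine iff_of_false (fun hρ => ?_) inr_notMem_faceAct
      -- otherwise `α + e_ρ` would be on the face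
      obtain ⟨k, hk, hkτ⟩ := τ.exists_pos
      have h1 : expVec α + Pi.single ρ 1 ∈ τ.1 := by
        rw [← hx]
        refine ⟨newton_add (expVec_mem_newton hα.1) fun ρ' => ?_, ?_⟩
        · by_cases h : ρ' = ρ
          · subst h; simp
          · simp [h]
        · rw [dotProduct_add, dotProduct_single, hρ, zero_mul, add_zero]
          exact hαx.2
      have h2 := hα.2
      rw [hkτ] at h1 h2
      have h3 := h1.2
      rw [dotProduct_add, dotProduct_single, show k ⬝ᵥ expVec α = m f k from h2.2] at h3
      linarith [hk ρ]
  · rintro ⟨hK, hA⟩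
    have hpos : ∀ ρ, 0 < x ρ := fun ρ => by
      refine lt_of_le_of_ne ((mem_HCone_faceIneq.1 hK).1 ρ) fun h => ?_
      exact inr_notMem_faceAct (hA ▸ inr_mem_act.2 h.symm)
    refine ⟨fun ρ => (hpos ρ).le, ?_⟩
    have hm := m_eq_of_mem_HCone hf hα.1 hK
    have hS : faceSupp f (firstMeet f x) = faceSupp f τ.1 := by
      ext ω
      refine and_congr_right fun hω => ?_
      have h1 := Finset.ext_iff.1 hA (Sum.inl ⟨ω, hω⟩)
      rw [inl_mem_act, inl_mem_faceAct, ← hm] at h1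
      exact ⟨fun h => h1.1 h.2, fun h => ⟨expVec_mem_newton hω, h1.2 h⟩⟩
    rw [firstMeet_eq_convexHull hf hpos, hS, ← τ.eq_convexHull hf]

theorem dualCone_pos (hf : f ≠ 0) (τ : CompactFace f) {x : Fin n → ℝ} (hx : x ∈ dualCone f τ.1)
    (ρ : Fin n) : 0 < x ρ := by
  obtain ⟨α, hα⟩ := τ.nonempty_faceSupp hf
  obtain ⟨hK, hA⟩ := (mem_dualCone_iff hf τ hα).1 hx
  refine lt_of_le_of_ne ((mem_HCone_faceIneq.1 hK).1 ρ) fun h => ?_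
  exact inr_notMem_faceAct (hA ▸ inr_mem_act.2 h.symm)

/-- The direction space of the first meet locus of `x` is spanned by the inequalities active at
`x`: the differences `ω - α` with exponents on the locus, and the `e_ρ` with `x_ρ = 0`. -/
theorem vectorSpan_firstMeet (hf : f ≠ 0) (hα : α ∈ f.support) {x : Fin n → ℝ}
    (hx : x ∈ HCone (faceIneq f α)) :
    vectorSpan ℝ (firstMeet f x) = normalSpan (faceIneq f α) (act (faceIneq f α) x) := by
  have hm := m_eq_of_mem_HCone hf hα hx
  have hαF : expVec α ∈ firstMeet f x := ⟨expVec_mem_newton hα, hm.symm⟩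
  have h0 := (mem_HCone_faceIneq.1 hx).1
  rw [vectorSpan_eq_span_vsub_set_right ℝ hαF, normalSpan]
  apply le_antisymm
  · refine Submodule.span_le.2 ?_
    rintro _ ⟨y, hy, rfl⟩
    obtain ⟨w, hw, hw1, -, hwm, hwx⟩ := exists_weights_of_mem_firstMeet hf h0 hy
    have hy' : y -ᵥ expVec α = ∑ ω ∈ f.support, w ω • (expVec ω - expVec α) +
        ∑ ρ, (y ρ - ∑ ω ∈ f.support, w ω * ω ρ) • (Pi.single ρ 1 : Fin n → ℝ) := by
      ext ρ
      simp only [vsub_eq_sub, Pi.sub_apply, Pi.add_apply, Finset.sum_apply, Pi.smul_apply,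
        smul_eq_mul, mul_sub, Finset.sum_sub_distrib, Pi.single_apply, mul_ite, mul_one, mul_zero,
        Finset.sum_ite_eq, Finset.mem_univ, if_true]
      rw [← Finset.sum_mul, hw1]
      ring
    simp only [SetLike.mem_coe]
    rw [hy']
    refine Submodule.add_mem _ (Submodule.sum_mem _ fun ω hω => ?_)
      (Submodule.sum_mem _ fun ρ _ => ?_)
    · by_cases h : w ω = 0
      · rw [h, zero_smul]
        exact Submodule.zero_mem _
      · refine Submodule.smul_mem _ _ (Submodule.subset_span ⟨Sum.inl ⟨ω, hω⟩, ?_, ?_⟩)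
        · exact inl_mem_act.2 ((hwm ω hω h).trans hm)
        · exact faceIneq_inl_eq _
    · by_cases h : x ρ = 0
      · exact Submodule.smul_mem _ _ (Submodule.subset_span
          ⟨Sum.inr ρ, inr_mem_act.2 h, faceIneq_inr_eq ρ⟩)
      · rw [hwx ρ h, sub_self, zero_smul]
        exact Submodule.zero_mem _
  · refine Submodule.span_le.2 ?_
    rintro _ ⟨i, hi, rfl⟩
    refine Submodule.subset_span ?_
    rcases i with ω | ρ
    · beta_reduce
      rw [faceIneq_inl_eq]
      exact ⟨_, ⟨expVec_mem_newton ω.2, (inl_mem_act.1 hi).trans hm.symm⟩, rfl⟩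
    · beta_reduce
      rw [faceIneq_inr_eq]
      refine ⟨expVec α + Pi.single ρ 1, ⟨newton_add (expVec_mem_newton hα) fun ρ' => ?_, ?_⟩, ?_⟩
      · by_cases h : ρ' = ρ
        · subst h; simp
        · simp [h]
      · rw [dotProduct_add, dotProduct_single, inr_mem_act.1 hi, zero_mul, add_zero]
        exact hm.symm
      · simp

/-- The rays of the cone dual to `τ` are the extremal rays of the cone of `faceIneq f α` that lie
in its closure: a facet is a first meet locus whose direction space is a hyperplane. -/
theorem mem_rays_iff (hf : f ≠ 0) (τ : CompactFace f) (hα : α ∈ faceSupp f τ.1)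
    (v : Fin n → ℕ) : v ∈ rays f τ.1 ↔
      IsRay (faceIneq f α) v ∧ faceAct f τ.1 ⊆ act (faceIneq f α) (toReal v) := by
  have hv0 : ∀ ρ, 0 ≤ toReal v ρ := fun ρ => Nat.cast_nonneg _
  have key : τ.1 ⊆ firstMeet f (toReal v) ↔ toReal v ∈ HCone (faceIneq f α) ∧
      faceAct f τ.1 ⊆ act (faceIneq f α) (toReal v) := by
    constructor
    · intro h
      have hαm := (h hα.2).2
      refine ⟨mem_HCone_faceIneq.2 ⟨hv0, fun ω hω => ?_⟩, fun i hi => ?_⟩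
      · rw [hαm]
        exact m_le hf hv0 (expVec_mem_newton hω)
      · rcases i with ω | ρ
        · rw [inl_mem_act, hαm]
          exact (h (inl_mem_faceAct.1 hi)).2
        · exact absurd hi inr_notMem_faceAct
    · rintro ⟨hK, hA⟩
      have hm := m_eq_of_mem_HCone hf hα.1 hK
      rw [τ.eq_convexHull hf]
      refine convexHull_min ?_ (convex_firstMeet _)
      rintro _ ⟨ω, hω, rfl⟩
      refine ⟨expVec_mem_newton hω.1, ?_⟩
      rw [hm]
      exact inl_mem_act.1 (hA (inl_mem_faceAct (ω := ⟨ω, hω.1⟩).2 hω.2))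
  constructor
  · rintro ⟨h1, h2, h3⟩
    obtain ⟨hK, hA⟩ := key.1 h3
    rw [vectorSpan_firstMeet hf hα.1 hK] at h2
    exact ⟨⟨h1, hK, h2⟩, hA⟩
  · rintro ⟨⟨h1, hK, h2⟩, hA⟩
    refine ⟨h1, ?_, key.2 ⟨hK, hA⟩⟩
    rw [vectorSpan_firstMeet hf hα.1 hK]
    exact h2

theorem finite_rays (hf : f ≠ 0) (τ : CompactFace f) : (rays f τ.1).Finite := by
  obtain ⟨α, hα⟩ := τ.nonempty_faceSupp hf
  exact (finite_isRay (faceIneq f α)).subset fun v hv => ((mem_rays_iff hf τ hα v).1 hv).1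

theorem dualCone_nonempty (τ : CompactFace f) : (dualCone f τ.1).Nonempty := by
  obtain ⟨k, hk, h⟩ := τ.exists_pos
  exact ⟨k, fun ρ => (hk ρ).le, h.symm⟩

/-- The cone dual to a compact face is strictly positively spanned by its rays. -/
theorem dualCone_eq_cone (hf : f ≠ 0) (τ : CompactFace f) {V : Finset (Fin n → ℕ)}
    (hV : (V : Set (Fin n → ℕ)) = rays f τ.1) : dualCone f τ.1 = cone V := by
  obtain ⟨α, hα⟩ := τ.nonempty_faceSupp hf
  obtain ⟨k, hk⟩ := dualCone_nonempty τ
  obtain ⟨hK, hA⟩ := (mem_dualCone_iff hf τ hα).1 hk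
  ext x
  rw [mem_dualCone_iff hf τ hα, mem_cone_rays_iff hasOrthant_faceIneq hK hA]
  intro v
  rw [← mem_rays_iff hf τ hα, ← hV, Finset.mem_coe]

theorem gcd_stdVec (ρ : Fin n) : Finset.univ.gcd (stdVec ρ) = 1 := by
  have := Finset.gcd_dvd (s := Finset.univ) (f := stdVec ρ) (Finset.mem_univ ρ)
  rw [stdVec, Pi.single_eq_same] at this
  exact Nat.dvd_one.1 this

theorem toReal_stdVec (ρ : Fin n) : toReal (stdVec ρ) = Pi.single ρ 1 := by
  ext ρ'
  by_cases h : ρ' = ρ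
  · subst h; simp [toReal, stdVec]
  · simp [toReal, stdVec, h]

/-- For `ρ ∈ P_τ`, the facet perpendicular to `e_ρ` is the intersection of the Newton polyhedron
with `x_ρ = 0`. -/
theorem stdVec_mem_rays (hf : f ≠ 0) (τ : CompactFace f) {ρ : Fin n} (hρ : ρ ∈ P τ.1) :
    stdVec ρ ∈ rays f τ.1 := by
  obtain ⟨α, hα⟩ := τ.nonempty_faceSupp hf
  have hP := (mem_P_iff hf τ ρ).1 hρ
  rw [mem_rays_iff hf τ hα]
  refine ⟨isRay_of_forall (gcd_stdVec ρ) ?_ fun y hy => ⟨y ρ, ?_⟩, fun i hi => ?_⟩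
  · rw [mem_HCone_faceIneq, toReal_stdVec]
    refine ⟨fun ρ' => ?_, fun ω _ => ?_⟩
    · by_cases h : ρ' = ρ
      · subst h; simp
      · simp [h]
    · rw [single_one_dotProduct, single_one_dotProduct, expVec, hP α hα, Nat.cast_zero]
      exact Nat.cast_nonneg _
  · ext ρ'
    rw [toReal_stdVec]
    by_cases h : ρ' = ρ
    · subst h; simp
    · have := inr_mem_act.1 (hy (inr_mem_act.2 (by rw [toReal_stdVec]; simp [h])) :
        Sum.inr ρ' ∈ act (faceIneq f α) y)
      simp [h, this]
  · rcases i with ω | ρ'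
    · rw [inl_mem_act, toReal_stdVec, single_one_dotProduct, single_one_dotProduct, expVec, expVec,
        hP α hα, hP ω.1 ⟨ω.2, inl_mem_faceAct.1 hi⟩]
    · exact absurd hi inr_notMem_faceAct

/-- A ray on which `m` vanishes is a standard basis vector. -/
theorem exists_stdVec_of_mNat_eq_zero (hf : f ≠ 0) (τ : CompactFace f) {v : Fin n → ℕ}
    (hv : v ∈ rays f τ.1) (h0 : mNat f v = 0) : ∃ ρ ∈ P τ.1, stdVec ρ = v := by
  obtain ⟨α, hα⟩ := τ.nonempty_faceSupp hf
  obtain ⟨hr, hA⟩ := (mem_rays_iff hf τ hα v).1 hv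
  have hm := m_eq_of_mem_HCone hf hα.1 hr.2.1
  rw [m_toReal hf, h0, Nat.cast_zero] at hm
  obtain ⟨ρ, hρ⟩ := Function.ne_iff.1 (isRay_ne_zero hr)
  have hρpos : 0 < toReal v ρ := lt_of_le_of_ne (Nat.cast_nonneg _) (Ne.symm hρ)
  -- an exponent on which `v` vanishes does not involve the variable `x_ρ`
  have hzero : ∀ ω : Fin n →₀ ℕ, toReal v ⬝ᵥ expVec ω = 0 → ω ρ = 0 := by
    intro ω h
    have := (Finset.sum_eq_zero_iff_of_nonneg fun ρ _ =>
      mul_nonneg (Nat.cast_nonneg (v ρ)) (Nat.cast_nonneg (ω ρ))).1 h ρ (Finset.mem_univ ρ)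
    rcases mul_eq_zero.1 this with h | h
    · exact absurd h hρpos.ne'
    · exact_mod_cast h
  have hact : act (faceIneq f α) (toReal v) ⊆ act (faceIneq f α) (toReal (stdVec ρ)) := by
    intro i hi
    rcases i with ω | ρ'
    · rw [inl_mem_act, ← hm] at hi
      rw [inl_mem_act, toReal_stdVec, single_one_dotProduct, single_one_dotProduct, expVec, expVec,
        hzero _ hi, hzero _ hm.symm]
    · rw [inr_mem_act] at hi ⊢
      have : ρ' ≠ ρ := by
        rintro rfl
        exact hρpos.ne' hi
      rw [toReal_stdVec]
      simp [this]
  obtain ⟨c, hc⟩ := hr.exists_smul hact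
  refine ⟨ρ, (mem_P_iff hf τ ρ).2 fun ω hω => hzero ω ?_,
    (eq_of_toReal_eq_smul hr.1 (gcd_stdVec ρ) hc).symm⟩
  rw [hm]
  exact inl_mem_act.1 (hA (inl_mem_faceAct (ω := ⟨ω, hω.1⟩).2 hω.2))

theorem mNat_pos_of_mem_cellJ (hf : f ≠ 0) (τ : CompactFace f) {V : Finset (Fin n → ℕ)}
    (hV : (V : Set (Fin n → ℕ)) ⊆ rays f τ.1) : ∀ v ∈ cellJ τ.1 V, 0 < mNat f v := by
  intro v hv
  obtain ⟨h1, h2⟩ := Finset.mem_sdiff.1 hv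
  refine Nat.pos_of_ne_zero fun h0 => h2 ?_
  obtain ⟨ρ, hρ, h⟩ := exists_stdVec_of_mNat_eq_zero hf τ (hV h1) h0
  exact Finset.mem_image.2 ⟨ρ, hρ, h⟩

/-- A cone spanned by some `e_ρ`, `ρ ∈ P_τ`, contains no vector with positive coordinates, because
some coordinate is not in `P_τ`. -/
theorem cellJ_nonempty (hf : f ≠ 0) (hf0 : MvPolynomial.eval 0 f = 0) (τ : CompactFace f)
    {V : Finset (Fin n → ℕ)} (hV : cone V ⊆ dualCone f τ.1) : (cellJ τ.1 V).Nonempty := by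
  by_contra h
  have hsub : V ⊆ (P τ.1).image stdVec :=
    Finset.sdiff_eq_empty_iff_subset.1 (Finset.not_nonempty_iff_eq_empty.1 h)
  obtain ⟨ρ, hρ⟩ : ∃ ρ, ρ ∉ P τ.1 := by
    by_contra! hall
    have h1 := card_P_lt hf hf0 τ
    rw [(Finset.eq_univ_iff_forall.2 hall), Finset.card_univ, Fintype.card_fin] at h1
    omega
  have h1 := dualCone_pos hf τ (hV ⟨fun _ => 1, fun _ _ => one_pos, rfl⟩) ρ
  refine h1.ne' ?_
  rw [Finset.sum_apply]
  refine Finset.sum_eq_zero fun v hv => ?_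
  obtain ⟨ρ', hρ', rfl⟩ := Finset.mem_image.1 (hsub hv)
  have : ρ ≠ ρ' := by
    rintro rfl
    exact hρ hρ'
  rw [toReal_stdVec]
  simp [this]

/-- The pulling triangulation of the cone dual to a compact face. -/
theorem nonempty_simplicialDecomp (hf : f ≠ 0) (τ : CompactFace f) :
    Nonempty (SimplicialDecomp f τ.1) := by
  classical
  obtain ⟨α, hα⟩ := τ.nonempty_faceSupp hf
  set R := (finite_rays hf τ).toFinset
  have hR : ∀ V, Cell (faceIneq f α) (faceAct f τ.1) V → V ⊆ R := fun V hV v hv =>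
    (finite_rays hf τ).mem_toFinset.2 ((mem_rays_iff hf τ hα v).2 (hV.isRay v hv))
  have hmem : ∀ V, V ∈ R.powerset.filter (Cell (faceIneq f α) (faceAct f τ.1)) ↔
      Cell (faceIneq f α) (faceAct f τ.1) V := fun V => by
    rw [Finset.mem_filter, Finset.mem_powerset]
    exact ⟨fun h => h.2, fun h => ⟨hR V h, h⟩⟩
  refine ⟨⟨R.powerset.filter (Cell (faceIneq f α) (faceAct f τ.1)), fun V hV v hv => ?_,
    fun V hV => ((hmem V).1 hV).linearIndepOn, fun V hV W hW hne => ?_, ?_⟩⟩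
  · exact (finite_rays hf τ).mem_toFinset.1 (hR V ((hmem V).1 hV) hv)
  · rw [Function.onFun, Set.disjoint_left]
    intro x hxV hxW
    exact hne (((hmem V).1 hV).unique ((hmem W).1 hW) hxV hxW)
  · ext x
    rw [mem_dualCone_iff hf τ hα]
    simp only [Set.mem_iUnion, exists_prop]
    constructor
    · rintro ⟨V, hV, hx⟩
      exact ((hmem V).1 hV).cone_subset x hx
    · rintro ⟨hx, hA⟩
      obtain ⟨V, hV, hxV⟩ := exists_cell hasOrthant_faceIneq hx
      exact ⟨V, (hmem V).2 (hA ▸ hV), hxV⟩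

theorem SimplicialDecomp.cone_subset {τ : Set (Fin n → ℝ)} (D : SimplicialDecomp f τ)
    {V : Finset (Fin n → ℕ)} (hV : V ∈ D.cells) : cone V ⊆ dualCone f τ := by
  rw [← D.iUnion_eq]
  exact Set.subset_biUnion_of_mem (u := cone) hV

end Newton

/-! ### Lattice sums over simplicial cones -/

section Lattice

variable {n : ℕ}

/-- The value of the exponent `α` on an integral vector. -/
def wt (α : Fin n →₀ ℕ) (k : Fin n → ℕ) : ℕ := ∑ ρ, k ρ * α ρ

theorem cast_wt (α : Fin n →₀ ℕ) (k : Fin n → ℕ) : (wt α k : ℝ) = toReal k ⬝ᵥ expVec α := by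
  simp [wt, toReal, dotProduct]

theorem wt_add (α : Fin n →₀ ℕ) (k k' : Fin n → ℕ) : wt α (k + k') = wt α k + wt α k' := by
  simp [wt, add_mul, Finset.sum_add_distrib]

theorem sigma_add (k k' : Fin n → ℕ) : sigma (k + k') = sigma k + sigma k' := by
  simp [sigma, Finset.sum_add_distrib]

theorem toReal_add (k k' : Fin n → ℕ) : toReal (k + k') = toReal k + toReal k' := by
  ext ρ
  simp [toReal]

/-- The integral points of the cone spanned by `V` whose coefficients at the elements of `V`
outside `J` are at most `1`. -/
def boxPoints (V J : Finset (Fin n → ℕ)) : Set (Fin n → ℕ) :=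
  {k | ∃ c : (Fin n → ℕ) → ℝ, (∀ v ∈ V, 0 < c v) ∧ (∀ v ∈ V, v ∉ J → c v ≤ 1) ∧
    toReal k = ∑ v ∈ V, c v • toReal v}

theorem parPoints_eq (V : Finset (Fin n → ℕ)) : parPoints V = boxPoints V ∅ := by
  ext h
  refine exists_congr fun c => ?_
  simp only [Finset.notMem_empty, not_false_eq_true, forall_const, forall₂_and, and_assoc]

theorem boxPoints_self (V : Finset (Fin n → ℕ)) : boxPoints V V = {k | toReal k ∈ cone V} := by
  ext h
  refine exists_congr fun c => ?_
  simp +contextual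

theorem boxPoints_mono {V J J' : Finset (Fin n → ℕ)} (h : J ⊆ J') :
    boxPoints V J ⊆ boxPoints V J' := fun _ ⟨c, h0, h1, hk⟩ =>
  ⟨c, h0, fun v hv hJ => h1 v hv fun h' => hJ (h h'), hk⟩

theorem coeff_unique {V : Finset (Fin n → ℕ)}
    (hV : LinearIndepOn ℝ toReal (V : Set (Fin n → ℕ))) {c d : (Fin n → ℕ) → ℝ}
    (h : ∑ v ∈ V, c v • toReal v = ∑ v ∈ V, d v • toReal v) : ∀ v ∈ V, c v = d v := by
  intro v hv
  have := linearIndepOn_finset_iff.1 hV (fun v => c v - d v) (by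
    simp only [sub_smul, Finset.sum_sub_distrib, h, sub_self]) v hv
  linarith

/-- Splitting off the points at which the coefficient of `v` exceeds `1`. -/
theorem boxPoints_insert [DecidableEq (Fin n → ℕ)] {V J : Finset (Fin n → ℕ)} {v : Fin n → ℕ}
    (hv : v ∈ V) (hJ : v ∉ J) :
    boxPoints V (insert v J) = boxPoints V J ∪ (fun k => k + v) '' boxPoints V (insert v J) := by
  ext k
  constructor
  · rintro ⟨c, h0, h1, hk⟩
    rcases le_or_gt (c v) 1 with h | h
    · refine Or.inl ⟨c, h0, fun w hw hwJ => ?_, hk⟩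
      by_cases hwv : w = v
      · rwa [hwv]
      · exact h1 w hw (by simp [hwv, hwJ])
    · -- the coefficient of `v` exceeds `1`, so that `v` can be subtracted
      have hvk : ∀ ρ, v ρ ≤ k ρ := by
        intro ρ
        have e := congrFun hk ρ
        rw [Finset.sum_apply] at e
        have h2 : c v * v ρ ≤ k ρ := by
          rw [show (k ρ : ℝ) = _ from e]
          exact Finset.single_le_sum (f := fun w => (c w • toReal w) ρ)
            (fun w hw => mul_nonneg (h0 w hw).le (Nat.cast_nonneg _)) hv
        have h3 : (v ρ : ℝ) ≤ c v * v ρ := le_mul_of_one_le_left (Nat.cast_nonneg _) h.le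
        exact_mod_cast h3.trans h2
      have hsub : (k - v) + v = k := by
        ext ρ
        exact Nat.sub_add_cancel (hvk ρ)
      refine Or.inr ⟨k - v, ⟨Function.update c v (c v - 1), fun w hw => ?_, fun w hw hwJ => ?_, ?_⟩,
        hsub⟩
      · by_cases hwv : w = v
        · subst hwv
          simpa using h
        · simpa [hwv] using h0 w hw
      · have hwv : w ≠ v := fun h => hwJ (by simp [h])
        simpa [hwv] using h1 w hw hwJ
      · have e1 : toReal (k - v) + toReal v = toReal k := by rw [← toReal_add, hsub]
        rw [eq_sub_of_add_eq e1, hk, ← Finset.add_sum_erase V _ hv, ← Finset.add_sum_erase V _ hv,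
          Function.update_self, sub_smul, one_smul, add_sub_right_comm]
        congr 1
        refine Finset.sum_congr rfl fun w hw => ?_
        rw [Function.update_of_ne (Finset.ne_of_mem_erase hw)]
  · rintro (h | ⟨k, ⟨c, h0, h1, hk⟩, rfl⟩)
    · exact boxPoints_mono (Finset.subset_insert v J) h
    · refine ⟨Function.update c v (c v + 1), fun w hw => ?_, fun w hw hwJ => ?_, ?_⟩
      · by_cases hwv : w = v
        · subst hwv
          have := h0 w hw
          simp only [Function.update_self]
          linarith
        · simpa [hwv] using h0 w hw
      · have hwv : w ≠ v := fun h => hwJ (by simp [h])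
        simpa [hwv] using h1 w hw hwJ
      · beta_reduce
        rw [toReal_add, hk, ← Finset.add_sum_erase V _ hv, ← Finset.add_sum_erase V _ hv,
          Function.update_self, add_smul, one_smul, add_right_comm]
        congr 1
        refine Finset.sum_congr rfl fun w hw => ?_
        rw [Function.update_of_ne (Finset.ne_of_mem_erase hw)]

/-- By linear independence, the coefficient of `v` is determined by the point. -/
theorem disjoint_boxPoints_insert [DecidableEq (Fin n → ℕ)] {V J : Finset (Fin n → ℕ)}
    {v : Fin n → ℕ} (hV : LinearIndepOn ℝ toReal (V : Set (Fin n → ℕ))) (hv : v ∈ V) (hJ : v ∉ J) :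
    Disjoint (boxPoints V J) ((fun k => k + v) '' boxPoints V (insert v J)) := by
  rw [Set.disjoint_left]
  rintro _ ⟨c, h0, h1, hk⟩ ⟨k, ⟨d, h0', h1', hk'⟩, rfl⟩
  rw [toReal_add, hk', ← Finset.add_sum_erase V _ hv, add_right_comm] at hk
  have e := coeff_unique hV (c := Function.update d v (d v + 1)) (d := c) (by
    rw [← hk, ← Finset.add_sum_erase V _ hv, Function.update_self, add_smul, one_smul]
    congr 1
    refine Finset.sum_congr rfl fun w hw => ?_
    rw [Function.update_of_ne (Finset.ne_of_mem_erase hw)]) v hv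
  rw [Function.update_self] at e
  have := h0' v hv
  have := h1 v hv hJ
  linarith

/-- The value at `α` bounds the coefficients of the `v ∈ J`, and the other coefficients are at
most `1`. -/
theorem finite_boxPoints {V J : Finset (Fin n → ℕ)} (α : Fin n →₀ ℕ)
    (hJ : ∀ v ∈ J, 0 < wt α v) (l : ℕ) : {k | k ∈ boxPoints V J ∧ wt α k = l}.Finite := by
  refine (Set.finite_Iic (∑ v ∈ V, (l + 1) • v)).subset ?_
  rintro k ⟨⟨c, h0, h1, hk⟩, hl⟩
  have hc : ∀ v ∈ V, c v ≤ l + 1 := by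
    intro v hv
    by_cases hvJ : v ∈ J
    · have h2 : c v * wt α v ≤ l := by
        have e : (wt α k : ℝ) = ∑ w ∈ V, c w * (wt α w : ℝ) := by
          rw [cast_wt, hk, sum_dotProduct]
          exact Finset.sum_congr rfl fun w _ => by rw [smul_dotProduct, cast_wt, smul_eq_mul]
        rw [← hl, e]
        exact Finset.single_le_sum (f := fun w => c w * (wt α w : ℝ))
          (fun w hw => mul_nonneg (h0 w hw).le (Nat.cast_nonneg _)) hv
      have h3 : (1 : ℝ) ≤ wt α v := by exact_mod_cast hJ v hvJ
      have h4 := le_mul_of_one_le_right (h0 v hv).le h3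
      linarith
    · have := h1 v hv hvJ
      have : (0 : ℝ) ≤ l := Nat.cast_nonneg l
      linarith
  intro ρ
  have e := congrFun hk ρ
  rw [Finset.sum_apply] at e
  have : (k ρ : ℝ) ≤ ∑ v ∈ V, ((l : ℝ) + 1) * v ρ := by
    rw [show (k ρ : ℝ) = _ from e]
    exact Finset.sum_le_sum fun v hv => mul_le_mul_of_nonneg_right (hc v hv) (Nat.cast_nonneg _)
  rw [Finset.sum_apply]
  simp only [Pi.smul_apply, smul_eq_mul]
  exact_mod_cast this

/-- The generating series of a set of integral vectors. -/
def latSum (α : Fin n →₀ ℕ) (A : Set (Fin n → ℕ)) : PowerSeries MC :=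
  PowerSeries.mk fun l => ∑ᶠ k ∈ {k | k ∈ A ∧ wt α k = l}, Linv ^ sigma k

theorem latSum_union {α : Fin n →₀ ℕ} {A B : Set (Fin n → ℕ)} (h : Disjoint A B)
    (hA : ∀ l, {k | k ∈ A ∧ wt α k = l}.Finite) (hB : ∀ l, {k | k ∈ B ∧ wt α k = l}.Finite) :
    latSum α (A ∪ B) = latSum α A + latSum α B := by
  ext l
  rw [map_add]
  simp only [latSum, PowerSeries.coeff_mk]
  have hu : {k | k ∈ A ∪ B ∧ wt α k = l} =
      {k | k ∈ A ∧ wt α k = l} ∪ {k | k ∈ B ∧ wt α k = l} := by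
    ext k
    exact or_and_right
  rw [hu, finsum_mem_union _ (hA l) (hB l)]
  exact h.mono (fun _ h => h.1) fun _ h => h.1

open PowerSeries in
theorem latSum_image_add {α : Fin n →₀ ℕ} {A : Set (Fin n → ℕ)}
    (hA : ∀ l, {k | k ∈ A ∧ wt α k = l}.Finite) (v : Fin n → ℕ) :
    latSum α ((fun k => k + v) '' A) = C (Linv ^ sigma v) * X ^ wt α v * latSum α A := by
  ext l
  rw [mul_assoc, coeff_C_mul, coeff_X_pow_mul']
  simp only [latSum, coeff_mk]
  split_ifs with h
  · have hi : {k | k ∈ (fun k => k + v) '' A ∧ wt α k = l} =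
        (fun k => k + v) '' {k | k ∈ A ∧ wt α k = l - wt α v} := by
      ext k
      constructor
      · rintro ⟨⟨k, hk, rfl⟩, hl⟩
        rw [wt_add] at hl
        exact ⟨k, ⟨hk, by omega⟩, rfl⟩
      · rintro ⟨k, ⟨hk, hl⟩, rfl⟩
        exact ⟨⟨k, hk, rfl⟩, by rw [wt_add]; omega⟩
    rw [hi, finsum_mem_image (add_left_injective v).injOn, mul_finsum_mem' _ _ (hA _)]
    refine finsum_mem_congr rfl fun k _ => ?_
    rw [sigma_add, pow_add, mul_comm]
  · rw [mul_zero]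
    have hi : {k | k ∈ (fun k => k + v) '' A ∧ wt α k = l} = ∅ := by
      rw [Set.eq_empty_iff_forall_notMem]
      rintro _ ⟨⟨k, hk, rfl⟩, hl⟩
      rw [wt_add] at hl
      omega
    rw [hi, finsum_mem_empty]

theorem finite_image_add {α : Fin n →₀ ℕ} {A : Set (Fin n → ℕ)}
    (hA : ∀ l, {k | k ∈ A ∧ wt α k = l}.Finite) (v : Fin n → ℕ) (l : ℕ) :
    {k | k ∈ (fun k => k + v) '' A ∧ wt α k = l}.Finite := by
  refine ((hA (l - wt α v)).image fun k => k + v).subset ?_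
  rintro _ ⟨⟨k, hk, rfl⟩, hl⟩
  rw [wt_add] at hl
  exact ⟨k, ⟨hk, by omega⟩, rfl⟩

open PowerSeries in
/-- The generating series of a box, with the multiples of `v ∈ J` summed as geometric series. -/
theorem latSum_boxPoints {α : Fin n →₀ ℕ} {V : Finset (Fin n → ℕ)}
    (hV : LinearIndepOn ℝ toReal (V : Set (Fin n → ℕ))) {J : Finset (Fin n → ℕ)} (hJV : J ⊆ V)
    (hJ : ∀ v ∈ J, 0 < wt α v) :
    latSum α (boxPoints V J) = latSum α (boxPoints V ∅) *
      ∏ v ∈ J, invOfUnit (1 - C (Linv ^ sigma v) * X ^ wt α v) 1 := by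
  classical
  induction J using Finset.induction_on with
  | empty => simp
  | insert v J hv ih =>
    have hvV : v ∈ V := hJV (Finset.mem_insert_self v J)
    have hfin : ∀ l, {k | k ∈ boxPoints V (insert v J) ∧ wt α k = l}.Finite :=
      finite_boxPoints α hJ
    -- splitting off `v` gives the functional equation of a geometric series
    have hstep : latSum α (boxPoints V (insert v J)) = latSum α (boxPoints V J) +
        C (Linv ^ sigma v) * X ^ wt α v * latSum α (boxPoints V (insert v J)) := by
      conv_lhs => rw [boxPoints_insert hvV hv]
      rw [latSum_union (disjoint_boxPoints_insert hV hvV hv)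
        (finite_boxPoints α fun w hw => hJ w (Finset.mem_insert_of_mem hw))
        (finite_image_add hfin v), latSum_image_add hfin]
    have hinv : (1 - C (Linv ^ sigma v) * X ^ wt α v : PowerSeries MC) *
        invOfUnit (1 - C (Linv ^ sigma v) * X ^ wt α v) 1 = 1 := by
      refine mul_invOfUnit _ 1 ?_
      have := hJ v (Finset.mem_insert_self v J)
      simp [this.ne']
    rw [Finset.prod_insert hv, mul_left_comm,
      ← ih (fun w hw => hJV (Finset.mem_insert_of_mem hw))
        fun w hw => hJ w (Finset.mem_insert_of_mem hw)]
    have hstep' : latSum α (boxPoints V J) = (1 - C (Linv ^ sigma v) * X ^ wt α v) *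
        latSum α (boxPoints V (insert v J)) := by
      rw [sub_mul, one_mul]
      exact eq_sub_of_add_eq hstep.symm
    rw [hstep', ← mul_assoc, mul_comm (invOfUnit _ _), hinv, one_mul]

theorem finite_parPoints (V : Finset (Fin n → ℕ)) : (parPoints V).Finite := by
  have h := finite_boxPoints (V := V) (J := ∅) 0 (by simp) 0
  rw [parPoints_eq]
  refine h.subset fun k hk => ⟨hk, by simp [wt]⟩

open PowerSeries in
/-- The polynomial `Σ̃` is the generating series of the half-open parallelepiped, if `m` is given
by the exponent `α` on the cone. -/
theorem parSum_eq_latSum {f : MvPolynomial (Fin n) ℂ} {α : Fin n →₀ ℕ}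
    {V : Finset (Fin n → ℕ)} (h : ∀ k ∈ boxPoints V V, mNat f k = wt α k) :
    parSum f V = latSum α (boxPoints V ∅) := by
  classical
  ext l
  have hfin := finite_parPoints V
  rw [parSum, finsum_mem_eq_finite_toFinset_sum _ hfin, map_sum]
  have hl : {k | k ∈ boxPoints V ∅ ∧ wt α k = l} =
      (hfin.toFinset.filter fun k => wt α k = l : Finset (Fin n → ℕ)) := by
    ext k
    simp [parPoints_eq]
  rw [latSum, coeff_mk, hl, finsum_mem_coe_finset, Finset.sum_filter]
  refine Finset.sum_congr rfl fun k hk => ?_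
  rw [h k (boxPoints_mono (Finset.empty_subset V) (parPoints_eq V ▸ hfin.mem_toFinset.1 hk)),
    coeff_C_mul, coeff_X_pow]
  simp [eq_comm]

end Lattice

section FaceLattice

variable {n : ℕ} {f : MvPolynomial (Fin n) ℂ} {α : Fin n →₀ ℕ}

theorem mNat_eq_wt (hf : f ≠ 0) (hα : α ∈ f.support) {k : Fin n → ℕ}
    (hk : toReal k ∈ HCone (faceIneq f α)) : mNat f k = wt α k := by
  have h := m_eq_of_mem_HCone hf hα hk
  rw [m_toReal hf, ← cast_wt] at h
  exact_mod_cast h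

theorem mNat_eq_wt_of_mem_boxPoints (hf : f ≠ 0) (τ : CompactFace f) (hα : α ∈ faceSupp f τ.1)
    {V : Finset (Fin n → ℕ)} (hV : (V : Set (Fin n → ℕ)) ⊆ rays f τ.1) :
    ∀ k ∈ boxPoints V V, mNat f k = wt α k := by
  rintro k ⟨c, h0, -, hk⟩
  refine mNat_eq_wt hf hα.1 (hk ▸ sum_mem_HCone (fun v hv => ?_) fun v hv => (h0 v hv).le)
  exact ((mem_rays_iff hf τ hα v).1 (hV hv)).1.2.1

theorem mNat_eq_wt_of_mem_rays (hf : f ≠ 0) (τ : CompactFace f) (hα : α ∈ faceSupp f τ.1)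
    {v : Fin n → ℕ} (hv : v ∈ rays f τ.1) : mNat f v = wt α v :=
  mNat_eq_wt hf hα.1 ((mem_rays_iff hf τ hα v).1 hv).1.2.1

theorem cellJ_subset (τ : Set (Fin n → ℝ)) (V : Finset (Fin n → ℕ)) : cellJ τ V ⊆ V :=
  Finset.sdiff_subset

theorem wt_pos_of_mem_cellJ (hf : f ≠ 0) (τ : CompactFace f) (hα : α ∈ faceSupp f τ.1)
    {V : Finset (Fin n → ℕ)} (hV : (V : Set (Fin n → ℕ)) ⊆ rays f τ.1) :
    ∀ v ∈ cellJ τ.1 V, 0 < wt α v := fun v hv => by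
  rw [← mNat_eq_wt_of_mem_rays hf τ hα (hV (cellJ_subset _ _ hv))]
  exact mNat_pos_of_mem_cellJ hf τ hV v hv

/-- The generating series of the integral points of the truncated cone: `m` is linear on the cone,
and positive on the generators in `cellJ τ V`. -/
theorem cellS'_eq_latSum (hf : f ≠ 0) (τ : CompactFace f) (hα : α ∈ faceSupp f τ.1)
    {V : Finset (Fin n → ℕ)} (hV : (V : Set (Fin n → ℕ)) ⊆ rays f τ.1)
    (hli : LinearIndepOn ℝ toReal (V : Set (Fin n → ℕ))) :
    cellS' f τ.1 V = latSum α (boxPoints V (cellJ τ.1 V)) := by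
  rw [latSum_boxPoints hli (cellJ_subset _ _) (wt_pos_of_mem_cellJ hf τ hα hV), cellS',
    parSum_eq_latSum (mNat_eq_wt_of_mem_boxPoints hf τ hα hV), invProd]
  congr 1
  refine Finset.prod_congr rfl fun v hv => ?_
  rw [mNat_eq_wt_of_mem_rays hf τ hα (hV (cellJ_subset _ _ hv))]

theorem stdVec_injective : Function.Injective (stdVec : Fin n → Fin n → ℕ) := by
  intro ρ ρ' h
  by_contra hne
  have := congrFun h ρ
  simp [stdVec, hne] at this

theorem notMem_cellJ_iff {τ : Set (Fin n → ℝ)} {V : Finset (Fin n → ℕ)} {v : Fin n → ℕ}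
    (hv : v ∈ V) : v ∉ cellJ τ V ↔ ∃ ρ ∈ cellP τ V, stdVec ρ = v := by
  simp only [cellJ, Finset.mem_sdiff, hv, true_and, not_not, Finset.mem_image, cellP,
    Finset.mem_filter, and_assoc]
  refine exists_congr fun ρ => and_congr_right fun _ => ⟨fun h => ⟨h ▸ hv, h⟩, fun h => h.2⟩

theorem sdiff_cellJ (τ : Set (Fin n → ℝ)) (V : Finset (Fin n → ℕ)) :
    V \ cellJ τ V = (cellP τ V).image stdVec := by
  ext v
  rw [Finset.mem_sdiff, Finset.mem_image]
  constructor
  · rintro ⟨h1, h2⟩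
    exact (notMem_cellJ_iff h1).1 h2
  · rintro ⟨ρ, hρ, rfl⟩
    have h1 := (Finset.mem_filter.1 hρ).2
    exact ⟨h1, (notMem_cellJ_iff h1).2 ⟨ρ, hρ, rfl⟩⟩

theorem sum_cell (τ : Set (Fin n → ℝ)) (V : Finset (Fin n → ℕ)) (c : (Fin n → ℕ) → ℝ) :
    ∑ v ∈ V, c v • toReal v = ∑ ρ ∈ cellP τ V, c (stdVec ρ) • toReal (stdVec ρ) +
      ∑ v ∈ cellJ τ V, c v • toReal v := by
  rw [← Finset.sum_sdiff (cellJ_subset τ V), sdiff_cellJ,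
    Finset.sum_image fun _ _ _ _ h => stdVec_injective h]

/-- The integral points of the truncated cone are the box points in which only the coefficients of
the generators other than the `e_ρ`, `ρ ∈ P_τ`, are unbounded. -/
theorem truncCone_iff {τ : Set (Fin n → ℝ)} {V : Finset (Fin n → ℕ)} {k : Fin n → ℕ} :
    toReal k ∈ truncCone τ V ↔ k ∈ boxPoints V (cellJ τ V) := by
  classical
  constructor
  · rintro ⟨h, c, hh, hc, hk⟩
    set d : (Fin n → ℕ) → ℝ := fun v => if v ∈ cellJ τ V then c v else ∑ ρ, h ρ * v ρ with hd
    have hP : ∀ ρ ∈ cellP τ V, d (stdVec ρ) = h ρ := by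
      intro ρ hρ
      have h1 := (Finset.mem_filter.1 hρ).2
      rw [hd]
      beta_reduce
      rw [if_neg ((notMem_cellJ_iff h1).2 ⟨ρ, hρ, rfl⟩)]
      simp [stdVec, Pi.single_apply]
    have hJ : ∀ v ∈ cellJ τ V, d v = c v := fun v hv => if_pos hv
    refine ⟨d, fun v hv => ?_, fun v hv hvJ => ?_, ?_⟩
    · by_cases hvJ : v ∈ cellJ τ V
      · rw [hJ v hvJ]
        exact hc v hvJ
      · obtain ⟨ρ, hρ, rfl⟩ := (notMem_cellJ_iff hv).1 hvJ
        rw [hP ρ hρ]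
        exact (hh ρ hρ).1
    · obtain ⟨ρ, hρ, rfl⟩ := (notMem_cellJ_iff hv).1 hvJ
      rw [hP ρ hρ]
      exact (hh ρ hρ).2
    · rw [hk, sum_cell τ V d]
      congr 1
      · exact Finset.sum_congr rfl fun ρ hρ => by rw [hP ρ hρ]
      · exact Finset.sum_congr rfl fun v hv => by rw [hJ v hv]
  · rintro ⟨c, h0, h1, hk⟩
    refine ⟨fun ρ => c (stdVec ρ), c, fun ρ hρ => ?_, fun v hv => h0 v (cellJ_subset _ _ hv), ?_⟩
    · have h2 := (Finset.mem_filter.1 hρ).2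
      exact ⟨h0 _ h2, h1 _ h2 ((notMem_cellJ_iff h2).2 ⟨ρ, hρ, rfl⟩)⟩
    · rw [hk, sum_cell τ V c]

theorem isLatticeSum_of_latSum {A : Set (Fin n → ℝ)}
    (hA : ∀ k, toReal k ∈ A → mNat f k = wt α k)
    (hfin : ∀ l, {k | k ∈ {k | toReal k ∈ A} ∧ wt α k = l}.Finite) :
    IsLatticeSum f A (latSum α {k | toReal k ∈ A}) := by
  intro l
  have h : {k : Fin n → ℕ | toReal k ∈ A ∧ mNat f k = l} =
      {k | k ∈ {k | toReal k ∈ A} ∧ wt α k = l} := by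
    ext k
    refine and_congr_right fun hk => ?_
    rw [hA k hk]
  rw [h]
  exact ⟨hfin l, by rw [latSum, PowerSeries.coeff_mk]⟩

theorem isLatticeSum_truncCone (hf : f ≠ 0) (τ : CompactFace f) {V : Finset (Fin n → ℕ)}
    (hV : (V : Set (Fin n → ℕ)) ⊆ rays f τ.1)
    (hli : LinearIndepOn ℝ toReal (V : Set (Fin n → ℕ))) :
    IsLatticeSum f (truncCone τ.1 V) (cellS' f τ.1 V) := by
  obtain ⟨α, hα⟩ := τ.nonempty_faceSupp hf
  have hset : {k | toReal k ∈ truncCone τ.1 V} = boxPoints V (cellJ τ.1 V) := by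
    ext k
    exact truncCone_iff
  rw [cellS'_eq_latSum hf τ hα hV hli, ← hset]
  refine isLatticeSum_of_latSum (fun k hk => ?_) ?_
  · exact mNat_eq_wt_of_mem_boxPoints hf τ hα hV k
      (boxPoints_mono (cellJ_subset _ _) (truncCone_iff.1 hk))
  · rw [hset]
    exact finite_boxPoints α (wt_pos_of_mem_cellJ hf τ hα hV)

theorem cellJ_of_P_eq_empty {τ : Set (Fin n → ℝ)} (hP : P τ = ∅) (V : Finset (Fin n → ℕ)) :
    cellJ τ V = V := by
  simp [cellJ, hP]

theorem cellP_of_P_eq_empty {τ : Set (Fin n → ℝ)} (hP : P τ = ∅) (V : Finset (Fin n → ℕ)) :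
    cellP τ V = ∅ := by
  simp [cellP, hP]

theorem cellS_eq_cellS' {τ : Set (Fin n → ℝ)} (hP : P τ = ∅) (V : Finset (Fin n → ℕ)) :
    cellS f V = cellS' f τ V := by
  rw [cellS, cellS', cellJ_of_P_eq_empty hP]

theorem coneS_eq_coneS' {τ : Set (Fin n → ℝ)} (hP : P τ = ∅) (D : SimplicialDecomp f τ) :
    coneS D = coneS' D := by
  rw [coneS, coneS']
  refine Finset.sum_congr rfl fun V _ => ?_
  rw [cellS_eq_cellS' hP, cellP_of_P_eq_empty hP, hP]
  simp

theorem truncCone_eq_cone {τ : Set (Fin n → ℝ)} (hP : P τ = ∅) (V : Finset (Fin n → ℕ)) :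
    truncCone τ V = cone V := by
  ext x
  constructor
  · rintro ⟨h, c, -, hc, rfl⟩
    rw [cellJ_of_P_eq_empty hP] at hc ⊢
    rw [cellP_of_P_eq_empty hP, Finset.sum_empty, zero_add]
    exact ⟨c, hc, rfl⟩
  · rintro ⟨c, hc, rfl⟩
    refine ⟨0, c, ?_, ?_, ?_⟩
    · simp [cellP_of_P_eq_empty hP]
    · rwa [cellJ_of_P_eq_empty hP]
    · rw [cellJ_of_P_eq_empty hP, cellP_of_P_eq_empty hP, Finset.sum_empty, zero_add]

theorem isLatticeSum_cone (hf : f ≠ 0) (τ : CompactFace f) (hP : P τ.1 = ∅)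
    {V : Finset (Fin n → ℕ)} (hV : (V : Set (Fin n → ℕ)) ⊆ rays f τ.1)
    (hli : LinearIndepOn ℝ toReal (V : Set (Fin n → ℕ))) :
    IsLatticeSum f (cone V) (cellS f V) := by
  rw [← truncCone_eq_cone hP, cellS_eq_cellS' hP]
  exact isLatticeSum_truncCone hf τ hV hli

theorem isLatticeSum_biUnion {I : Finset (Finset (Fin n → ℕ))}
    {A : Finset (Fin n → ℕ) → Set (Fin n → ℝ)} {S : Finset (Fin n → ℕ) → PowerSeries MC}
    (hd : (I : Set (Finset (Fin n → ℕ))).PairwiseDisjoint A)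
    (h : ∀ V ∈ I, IsLatticeSum f (A V) (S V)) :
    IsLatticeSum f (⋃ V ∈ I, A V) (∑ V ∈ I, S V) := by
  intro l
  have hset : {k : Fin n → ℕ | toReal k ∈ ⋃ V ∈ I, A V ∧ mNat f k = l} =
      ⋃ V ∈ (I : Set (Finset (Fin n → ℕ))), {k | toReal k ∈ A V ∧ mNat f k = l} := by
    ext k
    simp only [Set.mem_iUnion, Set.mem_ofPred_eq, exists_prop, SetLike.mem_coe]
    exact ⟨fun ⟨⟨V, hV, hk⟩, hl⟩ => ⟨V, hV, hk, hl⟩, fun ⟨V, hV, hk, hl⟩ => ⟨⟨V, hV, hk⟩, hl⟩⟩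
  have hfin : ∀ V ∈ (I : Set (Finset (Fin n → ℕ))),
      {k : Fin n → ℕ | toReal k ∈ A V ∧ mNat f k = l}.Finite := fun V hV => (h V hV l).1
  rw [hset]
  refine ⟨I.finite_toSet.biUnion hfin, ?_⟩
  rw [finsum_mem_biUnion _ I.finite_toSet hfin, finsum_mem_coe_finset, map_sum]
  · exact Finset.sum_congr rfl fun V hV => (h V hV l).2
  · intro V hV W hW hne
    have := hd hV hW hne
    rw [Function.onFun, Set.disjoint_left] at this ⊢
    exact fun k hk hk' => this hk.1 hk'.1

theorem isLatticeSum_dualCone (hf : f ≠ 0) (τ : CompactFace f) (hP : P τ.1 = ∅)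
    (D : SimplicialDecomp f τ.1) : IsLatticeSum f (dualCone f τ.1) (coneS D) := by
  rw [← D.iUnion_eq, coneS]
  exact isLatticeSum_biUnion D.disjoint fun V hV =>
    isLatticeSum_cone hf τ hP (D.subset_rays V hV) (D.linearIndependent V hV)

end FaceLattice

/-! ### Capped sums over the integral points of a dual cone -/

section Capped

variable {n : ℕ} {f : MvPolynomial (Fin n) ℂ}

/-- The weights `(1 - 𝕃⁻¹) 𝕃^{-j}` for `j < N`, with the tail `∑_{j ≥ N} = 𝕃^{-N}` at `N`. -/
def capW (N j : ℕ) : MC := if j < N then (1 - Linv) * Linv ^ j else Linv ^ N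

/-- The capped weights from `a` on telescope to `𝕃^{-a}`. -/
theorem sum_capW {a M : ℕ} (h : a ≤ M) : ∑ j ∈ Finset.Icc a M, capW M j = Linv ^ a := by
  have h1 : ∑ j ∈ Finset.Ico a M, (1 - Linv) * Linv ^ j = Linv ^ a - Linv ^ M := by
    induction M, h using Nat.le_induction with
    | base => simp
    | succ M hM ih =>
      rw [Finset.sum_Ico_succ_top hM, ih]
      ring
  rw [← Finset.Ico_insert_right h, Finset.sum_insert Finset.right_notMem_Ico,
    Finset.sum_congr rfl (g := fun j => (1 - Linv) * Linv ^ j), h1]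
  · simp [capW]
  · intro j hj
    rw [capW, if_pos (Finset.mem_Ico.1 hj).2]

/-- The weight of an integral vector whose coordinates in `P` are capped at `N`. -/
def faceW (P : Finset (Fin n)) (N : ℕ) (k : Fin n → ℕ) : MC :=
  ∏ ρ, if ρ ∈ P then capW N (k ρ) else Linv ^ k ρ

theorem sum_faceW_piFinset (P : Finset (Fin n)) (N : ℕ) (s : Fin n → Finset ℕ) :
    ∑ k ∈ Fintype.piFinset s, faceW P N k =
      ∏ ρ, ∑ j ∈ s ρ, if ρ ∈ P then capW N j else Linv ^ j :=
  (Finset.prod_univ_sum s fun ρ j => if ρ ∈ P then capW N j else Linv ^ j).symm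

/-- The integral vectors in the cone dual to `τ` with `m = i`, in terms of their values on
exponents. -/
theorem mem_dualCone_nat (hf : f ≠ 0) (τ : CompactFace f) (k : Fin n → ℕ) (i : ℕ) :
    (toReal k ∈ dualCone f τ.1 ∧ mNat f k = i) ↔ (∀ ρ, 1 ≤ k ρ) ∧
      (∀ ω ∈ faceSupp f τ.1, wt ω k = i) ∧
      ∀ ω ∈ f.support, ω ∉ faceSupp f τ.1 → i < wt ω k := by
  obtain ⟨α, hα⟩ := τ.nonempty_faceSupp hf
  have hwt : ∀ ω, toReal k ⬝ᵥ expVec ω = (wt ω k : ℝ) := fun ω => (cast_wt ω k).symm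
  constructor
  · rintro ⟨hk, hm⟩
    obtain ⟨hK, hA⟩ := (mem_dualCone_iff hf τ hα).1 hk
    rw [mNat_eq_wt hf hα.1 hK] at hm
    subst hm
    have hiff : ∀ ω (hω : ω ∈ f.support), wt ω k = wt α k ↔ ω ∈ faceSupp f τ.1 := by
      intro ω hω
      have h1 := Finset.ext_iff.1 hA (Sum.inl ⟨ω, hω⟩)
      rw [inl_mem_act, inl_mem_faceAct, hwt, hwt, Nat.cast_inj] at h1
      rw [h1]
      exact ⟨fun h => ⟨hω, h⟩, fun h => h.2⟩
    refine ⟨fun ρ => ?_, fun ω hω => (hiff ω hω.1).2 hω, fun ω hω hωτ => ?_⟩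
    · have := dualCone_pos hf τ hk ρ
      exact Nat.cast_pos.1 this
    · have h1 := (mem_HCone_faceIneq.1 hK).2 ω hω
      rw [hwt, hwt, Nat.cast_le] at h1
      exact lt_of_le_of_ne h1 fun h => hωτ ((hiff ω hω).1 h.symm)
  · rintro ⟨h0, h1, h2⟩
    have hK : toReal k ∈ HCone (faceIneq f α) := by
      refine mem_HCone_faceIneq.2 ⟨fun ρ => Nat.cast_nonneg _, fun ω hω => ?_⟩
      rw [hwt, hwt, Nat.cast_le, h1 α hα]
      by_cases h : ω ∈ faceSupp f τ.1
      · exact (h1 ω h).ge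
      · exact (h2 ω hω h).le
    refine ⟨(mem_dualCone_iff hf τ hα).2 ⟨hK, ?_⟩, by rw [mNat_eq_wt hf hα.1 hK, h1 α hα]⟩
    ext j
    rcases j with ω | ρ
    · rw [inl_mem_act, inl_mem_faceAct, hwt, hwt, Nat.cast_inj, h1 α hα]
      constructor
      · intro h
        by_contra hω
        exact (h2 ω.1 ω.2 fun h' => hω h'.2).ne' h
      · exact fun h => h1 ω.1 ⟨ω.2, h⟩
    · rw [inr_mem_act]
      refine iff_of_false (fun h => ?_) inr_notMem_faceAct
      have h3 : k ρ = 0 := Nat.cast_eq_zero.1 h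
      have := h0 ρ
      omega

/-- A variable `x_ρ` with `ρ ∉ P_τ` occurs in an exponent on `τ`, where the value of `k` is `i`.
-/
theorem le_of_notMem_P (hf : f ≠ 0) (τ : CompactFace f) {k : Fin n → ℕ} {i : ℕ}
    (hk : toReal k ∈ dualCone f τ.1 ∧ mNat f k = i) {ρ : Fin n} (hρ : ρ ∉ P τ.1) : k ρ ≤ i := by
  rw [mem_P_iff hf] at hρ
  push Not at hρ
  obtain ⟨ω, hω, hωρ⟩ := hρ
  rw [← ((mem_dualCone_nat hf τ k i).1 hk).2.1 ω hω]
  calc k ρ ≤ k ρ * ω ρ := Nat.le_mul_of_pos_right _ (Nat.pos_of_ne_zero hωρ)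
    _ ≤ wt ω k := Finset.single_le_sum (f := fun ρ => k ρ * ω ρ) (fun _ _ => Nat.zero_le _)
        (Finset.mem_univ ρ)

/-- Beyond the value `i` of `m`, the coordinates in `P` may be changed freely. -/
theorem mem_dualCone_of_cap (hf : f ≠ 0) (τ : CompactFace f) {k k' : Fin n → ℕ} {i N : ℕ}
    (hiN : i < N) (hk : toReal k ∈ dualCone f τ.1 ∧ mNat f k = i)
    (h : ∀ ρ, k' ρ = k ρ ∨ ρ ∈ P τ.1 ∧ N ≤ k' ρ) :
    toReal k' ∈ dualCone f τ.1 ∧ mNat f k' = i := by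
  rw [mem_dualCone_nat hf] at hk ⊢
  obtain ⟨h0, h1, h2⟩ := hk
  refine ⟨fun ρ => ?_, fun ω hω => ?_, fun ω hω hωτ => ?_⟩
  · rcases h ρ with h | h
    · rw [h]
      exact h0 ρ
    · omega
  · rw [← h1 ω hω]
    refine Finset.sum_congr rfl fun ρ _ => ?_
    rcases h ρ with h | h
    · rw [h]
    · rw [(mem_P_iff hf τ ρ).1 h.1 ω hω, mul_zero, mul_zero]
  · by_cases hex : ∃ ρ, N ≤ k' ρ ∧ ω ρ ≠ 0
    · obtain ⟨ρ, hρ, hωρ⟩ := hex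
      calc i < N := hiN
        _ ≤ k' ρ := hρ
        _ ≤ k' ρ * ω ρ := Nat.le_mul_of_pos_right _ (Nat.pos_of_ne_zero hωρ)
        _ ≤ wt ω k' := Finset.single_le_sum (f := fun ρ => k' ρ * ω ρ) (fun _ _ => Nat.zero_le _)
            (Finset.mem_univ ρ)
    · push Not at hex
      have : wt ω k' = wt ω k := by
        refine Finset.sum_congr rfl fun ρ _ => ?_
        rcases h ρ with h | h
        · rw [h]
        · rw [hex ρ h.2, mul_zero, mul_zero]
      rw [this]
      exact h2 ω hω hωτ

open Classical in
/-- The integral vectors in the dual cone of `τ` with coordinates at most `N` and `m = i`. -/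
def capPoints (f : MvPolynomial (Fin n) ℂ) (τ : Set (Fin n → ℝ)) (N i : ℕ) :
    Finset (Fin n → ℕ) :=
  (Fintype.piFinset fun _ => Finset.Icc 1 N).filter fun k =>
    toReal k ∈ dualCone f τ ∧ mNat f k = i

theorem mem_capPoints {τ : Set (Fin n → ℝ)} {N i : ℕ} {k : Fin n → ℕ} :
    k ∈ capPoints f τ N i ↔ (∀ ρ, 1 ≤ k ρ ∧ k ρ ≤ N) ∧ toReal k ∈ dualCone f τ ∧ mNat f k = i := by
  simp [capPoints, Fintype.mem_piFinset]

/-- The capped sum does not depend on the cap. -/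
theorem sum_capPoints_eq (hf : f ≠ 0) (τ : CompactFace f) {i N M : ℕ} (hiN : i < N)
    (hNM : N ≤ M) :
    ∑ k ∈ capPoints f τ.1 M i, faceW (P τ.1) M k =
      ∑ k ∈ capPoints f τ.1 N i, faceW (P τ.1) N k := by
  classical
  have hmaps : ∀ k ∈ capPoints f τ.1 M i, (fun ρ => min (k ρ) N) ∈ capPoints f τ.1 N i := by
    intro k hk
    obtain ⟨h1, h2⟩ := mem_capPoints.1 hk
    refine mem_capPoints.2 ⟨fun ρ => ⟨le_min (h1 ρ).1 (by omega), min_le_right _ _⟩,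
      mem_dualCone_of_cap hf τ hiN h2 fun ρ => ?_⟩
    by_cases hρ : ρ ∈ P τ.1
    · rcases le_total (k ρ) N with h | h
      · exact Or.inl (min_eq_left h)
      · exact Or.inr ⟨hρ, (min_eq_right h).ge⟩
    · have := le_of_notMem_P hf τ h2 hρ
      exact Or.inl (min_eq_left (by omega))
  rw [← Finset.sum_fiberwise_of_maps_to hmaps]
  refine Finset.sum_congr rfl fun k hk => ?_
  obtain ⟨h1, h2⟩ := mem_capPoints.1 hk
  -- lowering the cap is the map `min · N`; in its fibers only coordinates equal to `N` vary,
  -- and these lie in `P_τ` because `i < N`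
  have hfib : (capPoints f τ.1 M i).filter (fun k' => (fun ρ => min (k' ρ) N) = k) =
      Fintype.piFinset fun ρ => if k ρ < N then {k ρ} else Finset.Icc N M := by
    ext k'
    rw [Finset.mem_filter, Fintype.mem_piFinset, mem_capPoints, funext_iff]
    constructor
    · rintro ⟨⟨h3, -⟩, h4⟩ ρ
      have := h4 ρ
      have := h3 ρ
      split_ifs with h
      · rw [Finset.mem_singleton]
        omega
      · rw [Finset.mem_Icc]
        have := (h1 ρ).2
        omega
    · intro h
      have hρ : ∀ ρ, k' ρ = k ρ ∧ k ρ < N ∨ k ρ = N ∧ N ≤ k' ρ ∧ k' ρ ≤ M := by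
        intro ρ
        have h3 := h ρ
        have h4 := (h1 ρ).2
        split_ifs at h3 with h5
        · exact Or.inl ⟨Finset.mem_singleton.1 h3, h5⟩
        · rw [Finset.mem_Icc] at h3
          exact Or.inr ⟨by omega, h3⟩
      refine ⟨⟨fun ρ => ?_, mem_dualCone_of_cap hf τ hiN h2 fun ρ => ?_⟩, fun ρ => ?_⟩
      · have := hρ ρ
        have := h1 ρ
        omega
      · rcases hρ ρ with h3 | h3
        · exact Or.inl h3.1
        · refine Or.inr ⟨by_contra fun hP => ?_, h3.2.1⟩
          have := le_of_notMem_P hf τ h2 hP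
          omega
      · have := hρ ρ
        omega
  rw [hfib, sum_faceW_piFinset, faceW]
  refine Finset.prod_congr rfl fun ρ _ => ?_
  have h3 := (h1 ρ).2
  by_cases hP : ρ ∈ P τ.1
  · simp only [if_pos hP]
    by_cases h : k ρ < N
    · rw [if_pos h, Finset.sum_singleton, capW, capW, if_pos h, if_pos (by omega)]
    · rw [if_neg h, sum_capW hNM, capW, if_neg h]
  · have := le_of_notMem_P hf τ h2 hP
    simp only [if_neg hP]
    rw [if_pos (by omega), Finset.sum_singleton]

end Capped

section CappedCell

variable {n : ℕ} {f : MvPolynomial (Fin n) ℂ}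

/-- The coefficients of a vector supported on `cellP τ V` with respect to `V`. -/
def cellCoef (τ : Set (Fin n → ℝ)) (V : Finset (Fin n → ℕ)) (b : Fin n → ℝ) (v : Fin n → ℕ) : ℝ :=
  if v ∈ cellJ τ V then 0 else ∑ ρ, b ρ * v ρ

theorem cellCoef_stdVec {τ : Set (Fin n → ℝ)} {V : Finset (Fin n → ℕ)} (b : Fin n → ℝ) {ρ : Fin n}
    (hρ : ρ ∈ cellP τ V) : cellCoef τ V b (stdVec ρ) = b ρ := by
  have h1 := (Finset.mem_filter.1 hρ).2
  rw [cellCoef, if_neg ((notMem_cellJ_iff h1).2 ⟨ρ, hρ, rfl⟩)]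
  simp [stdVec, Pi.single_apply]

theorem sum_cellCoef {τ : Set (Fin n → ℝ)} {V : Finset (Fin n → ℕ)} {b : Fin n → ℝ}
    (hb : ∀ ρ ∉ cellP τ V, b ρ = 0) : ∑ v ∈ V, cellCoef τ V b v • toReal v = b := by
  rw [sum_cell τ V, Finset.sum_eq_zero (s := cellJ τ V) (fun v hv => by
    rw [cellCoef, if_pos hv, zero_smul]), add_zero]
  ext ρ
  rw [Finset.sum_apply]
  simp only [Pi.smul_apply, toReal_stdVec, smul_eq_mul, Pi.single_apply, mul_ite, mul_one, mul_zero]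
  rw [Finset.sum_ite_eq]
  split_ifs with h
  · exact cellCoef_stdVec b h
  · exact (hb ρ h).symm

/-- Every integral point of the cone differs from a point of the truncated cone by a
nonnegative integral combination of the `e_ρ`, `ρ ∈ cellP τ V`. -/
theorem mem_cone_iff_exists_boxPoints {τ : Set (Fin n → ℝ)} {V : Finset (Fin n → ℕ)}
    {k : Fin n → ℕ} : toReal k ∈ cone V ↔ ∃ h ∈ boxPoints V (cellJ τ V),
      (∀ ρ, h ρ ≤ k ρ) ∧ ∀ ρ ∉ cellP τ V, k ρ = h ρ := by
  classical
  constructor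
  · rintro ⟨c, h0, hk⟩
    have hck : ∀ ρ ∈ cellP τ V, c (stdVec ρ) ≤ k ρ := by
      intro ρ hρ
      have h1 := (Finset.mem_filter.1 hρ).2
      have e := congrFun hk ρ
      rw [Finset.sum_apply] at e
      rw [show (k ρ : ℝ) = _ from e]
      have := Finset.single_le_sum (f := fun w => (c w • toReal w) ρ)
        (fun w hw => mul_nonneg (h0 w hw).le (Nat.cast_nonneg _)) h1
      simpa [toReal_stdVec] using this
    -- the integral part to be split off leaves a coefficient in `(0, 1]`
    set a : Fin n → ℕ := fun ρ => if ρ ∈ cellP τ V then ⌈c (stdVec ρ)⌉₊ - 1 else 0 with ha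
    have hak : ∀ ρ, a ρ ≤ k ρ := by
      intro ρ
      rw [ha]
      beta_reduce
      split_ifs with h
      · have := Nat.ceil_le.2 (hck ρ h)
        omega
      · exact Nat.zero_le _
    have ha0 : ∀ ρ ∉ cellP τ V, a ρ = 0 := fun ρ h => if_neg h
    have ha1 : ∀ ρ ∈ cellP τ V, 0 < c (stdVec ρ) - a ρ ∧ c (stdVec ρ) - a ρ ≤ 1 := by
      intro ρ hρ
      have h1 := h0 _ (Finset.mem_filter.1 hρ).2
      have h2 : 0 < ⌈c (stdVec ρ)⌉₊ := Nat.ceil_pos.2 h1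
      have h3 : (a ρ : ℝ) = ⌈c (stdVec ρ)⌉₊ - 1 := by
        rw [ha]
        beta_reduce
        rw [if_pos hρ, Nat.cast_sub h2, Nat.cast_one]
      have h4 := Nat.ceil_lt_add_one h1.le
      have h5 := Nat.le_ceil (c (stdVec ρ))
      rw [h3]
      constructor <;> linarith
    refine ⟨fun ρ => k ρ - a ρ, ⟨fun v => c v - cellCoef τ V (toReal a) v, fun v hv => ?_,
      fun v hv hvJ => ?_, ?_⟩, fun ρ => Nat.sub_le _ _, fun ρ hρ => ?_⟩
    · by_cases hvJ : v ∈ cellJ τ V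
      · beta_reduce
        rw [cellCoef, if_pos hvJ, sub_zero]
        exact h0 v hv
      · obtain ⟨ρ, hρ, rfl⟩ := (notMem_cellJ_iff hv).1 hvJ
        beta_reduce
        rw [cellCoef_stdVec _ hρ]
        exact (ha1 ρ hρ).1
    · obtain ⟨ρ, hρ, rfl⟩ := (notMem_cellJ_iff hv).1 hvJ
      beta_reduce
      rw [cellCoef_stdVec _ hρ]
      exact (ha1 ρ hρ).2
    · simp only [sub_smul, Finset.sum_sub_distrib]
      rw [← hk, sum_cellCoef fun ρ hρ => by simp [toReal, ha0 ρ hρ]]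
      ext ρ
      simp only [toReal, Pi.sub_apply, Nat.cast_sub (hak ρ)]
    · beta_reduce
      rw [ha0 ρ hρ, Nat.sub_zero]
  · rintro ⟨h, ⟨c, h0, -, hh⟩, hle, heq⟩
    refine ⟨fun v => c v + cellCoef τ V (fun ρ => (k ρ : ℝ) - h ρ) v, fun v hv => ?_, ?_⟩
    · refine add_pos_of_pos_of_nonneg (h0 v hv) ?_
      rw [cellCoef]
      split_ifs
      · exact le_rfl
      · exact Finset.sum_nonneg fun ρ _ =>
          mul_nonneg (sub_nonneg.2 (Nat.cast_le.2 (hle ρ))) (Nat.cast_nonneg _)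
    · simp only [add_smul, Finset.sum_add_distrib]
      rw [← hh, sum_cellCoef fun ρ hρ => by rw [heq ρ hρ, sub_self]]
      ext ρ
      simp [toReal]

/-- The decomposition of an integral point of a cone in `mem_cone_iff_exists_boxPoints` is unique:
two numbers in `(0, 1]` with integral difference are equal. -/
theorem boxPoints_unique {τ : Set (Fin n → ℝ)} {V : Finset (Fin n → ℕ)}
    (hV : LinearIndepOn ℝ toReal (V : Set (Fin n → ℕ))) {k h h' : Fin n → ℕ}
    (hh : h ∈ boxPoints V (cellJ τ V)) (hh' : h' ∈ boxPoints V (cellJ τ V))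
    (hk : ∀ ρ ∉ cellP τ V, k ρ = h ρ) (hk' : ∀ ρ ∉ cellP τ V, k ρ = h' ρ) : h = h' := by
  obtain ⟨c, h0, h1, hc⟩ := hh
  obtain ⟨c', h0', h1', hc'⟩ := hh'
  have e := coeff_unique hV (c := fun v => c v + cellCoef τ V (fun ρ => (k ρ : ℝ) - h ρ) v)
    (d := fun v => c' v + cellCoef τ V (fun ρ => (k ρ : ℝ) - h' ρ) v) (by
      simp only [add_smul, Finset.sum_add_distrib]
      rw [← hc, ← hc', sum_cellCoef fun ρ hρ => by rw [hk ρ hρ, sub_self],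
        sum_cellCoef fun ρ hρ => by rw [hk' ρ hρ, sub_self]]
      ext ρ
      simp [toReal])
  ext ρ
  by_cases hρ : ρ ∈ cellP τ V
  · have h2 := (Finset.mem_filter.1 hρ).2
    have h3 := (notMem_cellJ_iff h2).2 ⟨ρ, hρ, rfl⟩
    have e1 := e _ h2
    rw [cellCoef_stdVec _ hρ, cellCoef_stdVec _ hρ] at e1
    have b1 := h0 _ h2
    have b2 := h1 _ h2 h3
    have b3 := h0' _ h2
    have b4 := h1' _ h2 h3
    have l1 : (h ρ : ℝ) < h' ρ + 1 := by linarith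
    have l2 : (h' ρ : ℝ) < h ρ + 1 := by linarith
    have l3 : h ρ < h' ρ + 1 := by exact_mod_cast l1
    have l4 : h' ρ < h ρ + 1 := by exact_mod_cast l2
    omega
  · rw [← hk ρ hρ, ← hk' ρ hρ]

theorem cellP_subset (τ : Set (Fin n → ℝ)) (V : Finset (Fin n → ℕ)) : cellP τ V ⊆ P τ :=
  Finset.filter_subset _ _

/-- Exponents on `τ` do not involve the variables in `P_τ`. -/
theorem wt_eq_of_cellP (hf : f ≠ 0) (τ : CompactFace f) {α : Fin n →₀ ℕ}
    (hα : α ∈ faceSupp f τ.1) {V : Finset (Fin n → ℕ)} {k h : Fin n → ℕ}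
    (hk : ∀ ρ ∉ cellP τ.1 V, k ρ = h ρ) : wt α k = wt α h := by
  refine Finset.sum_congr rfl fun ρ _ => ?_
  by_cases hρ : ρ ∈ cellP τ.1 V
  · rw [(mem_P_iff hf τ ρ).1 (cellP_subset _ _ hρ) α hα, mul_zero, mul_zero]
  · rw [hk ρ hρ]

/-- The sum of the capped weights over a simplicial cell, for a sufficiently large cap: the sums in
the directions `e_ρ`, `ρ ∈ cellP τ V`, telescope, and the other `ρ ∈ P_τ` contribute a factor
`1 - 𝕃⁻¹` each. -/
theorem exists_cap_sum_cell (hf : f ≠ 0) (τ : CompactFace f) {V : Finset (Fin n → ℕ)}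
    (hV : (V : Set (Fin n → ℕ)) ⊆ rays f τ.1)
    (hli : LinearIndepOn ℝ toReal (V : Set (Fin n → ℕ)))
    (hcone : cone V ⊆ dualCone f τ.1) (i : ℕ) :
    ∃ M₀, ∀ M, M₀ ≤ M → ∀ S : Finset (Fin n → ℕ),
      (∀ k, k ∈ S ↔ k ∈ capPoints f τ.1 M i ∧ toReal k ∈ cone V) →
      ∑ k ∈ S, faceW (P τ.1) M k = (1 - Linv) ^ ((P τ.1).card - (cellP τ.1 V).card) *
        PowerSeries.coeff i (cellS' f τ.1 V) := by
  classical
  obtain ⟨α, hα⟩ := τ.nonempty_faceSupp hf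
  have hfin := finite_boxPoints (V := V) α (wt_pos_of_mem_cellJ hf τ hα hV) i
  set F := hfin.toFinset with hF
  have hmF : ∀ h, h ∈ F ↔ h ∈ boxPoints V (cellJ τ.1 V) ∧ wt α h = i := fun h =>
    hfin.mem_toFinset
  -- a cap that exceeds all coordinates of the finitely many points of the truncated cone with
  -- `m = i`
  refine ⟨∑ h ∈ F, ∑ ρ, (h ρ + 1), fun M hM S hS => ?_⟩
  have hlt : ∀ h ∈ F, ∀ ρ, h ρ < M := by
    intro h hh ρ
    have h1 : ∑ ρ, (h ρ + 1) ≤ ∑ h ∈ F, ∑ ρ, (h ρ + 1) :=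
      Finset.single_le_sum (f := fun h : Fin n → ℕ => ∑ ρ, (h ρ + 1))
        (fun _ _ => Nat.zero_le _) hh
    have h2 : h ρ + 1 ≤ ∑ ρ, (h ρ + 1) :=
      Finset.single_le_sum (f := fun ρ => h ρ + 1) (fun _ _ => Nat.zero_le _) (Finset.mem_univ ρ)
    omega
  -- the points of the cell that differ from a point `h` of the truncated cone in the directions
  -- `e_ρ`, `ρ ∈ cellP τ V`
  let box : (Fin n → ℕ) → Finset (Fin n → ℕ) := fun h =>
    Fintype.piFinset fun ρ => if ρ ∈ cellP τ.1 V then Finset.Icc (h ρ) M else {h ρ}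
  have hbox : ∀ h, h ∈ F → ∀ k, k ∈ box h ↔
      (∀ ρ, h ρ ≤ k ρ ∧ k ρ ≤ M) ∧ ∀ ρ ∉ cellP τ.1 V, k ρ = h ρ := by
    intro h hh k
    rw [Fintype.mem_piFinset, ← forall_and]
    refine forall_congr' fun ρ => ?_
    have := hlt h hh ρ
    split_ifs with hρ
    · simp [hρ]
    · simp only [Finset.mem_singleton, hρ, not_false_eq_true, forall_const]
      omega
  have hSb : S = F.biUnion box := by
    ext k
    rw [hS, Finset.mem_biUnion]
    constructor
    · rintro ⟨hk, hkV⟩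
      obtain ⟨h1, -, h2⟩ := mem_capPoints.1 hk
      obtain ⟨h, hh, hle, heq⟩ := (mem_cone_iff_exists_boxPoints (τ := τ.1)).1 hkV
      have hkb : k ∈ boxPoints V V := by
        rw [boxPoints_self]
        exact hkV
      rw [mNat_eq_wt_of_mem_boxPoints hf τ hα hV k hkb, wt_eq_of_cellP hf τ hα heq] at h2
      exact ⟨h, (hmF h).2 ⟨hh, h2⟩,
        (hbox h ((hmF h).2 ⟨hh, h2⟩) k).2 ⟨fun ρ => ⟨hle ρ, (h1 ρ).2⟩, heq⟩⟩
    · rintro ⟨h, hh, hk⟩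
      obtain ⟨h1, heq⟩ := (hbox h hh k).1 hk
      obtain ⟨h2, h3⟩ := (hmF h).1 hh
      have hkV : toReal k ∈ cone V :=
        (mem_cone_iff_exists_boxPoints (τ := τ.1)).2 ⟨h, h2, fun ρ => (h1 ρ).1, heq⟩
      have hkb : k ∈ boxPoints V V := by
        rw [boxPoints_self]
        exact hkV
      have hm : mNat f k = i := by
        rw [mNat_eq_wt_of_mem_boxPoints hf τ hα hV k hkb, wt_eq_of_cellP hf τ hα heq, h3]
      have hpos := ((mem_dualCone_nat hf τ k i).1 ⟨hcone hkV, hm⟩).1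
      exact ⟨mem_capPoints.2 ⟨fun ρ => ⟨hpos ρ, (h1 ρ).2⟩, hcone hkV, hm⟩, hkV⟩
  have hdisj : (F : Set (Fin n → ℕ)).PairwiseDisjoint box := by
    intro h hh h' hh' hne
    rw [Function.onFun, Finset.disjoint_left]
    intro k hk hk'
    exact hne (boxPoints_unique hli ((hmF h).1 hh).1 ((hmF h').1 hh').1 ((hbox h hh k).1 hk).2
      ((hbox h' hh' k).1 hk').2)
  have hterm : ∀ h ∈ F, ∑ k ∈ box h, faceW (P τ.1) M k =
      (1 - Linv) ^ ((P τ.1).card - (cellP τ.1 V).card) * Linv ^ sigma h := by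
    intro h hh
    rw [sum_faceW_piFinset, ← Finset.card_sdiff_of_subset (cellP_subset τ.1 V), sigma,
      ← Finset.prod_pow_eq_pow_sum, ← Finset.prod_const,
      ← Finset.prod_ite_mem_eq (P τ.1 \ cellP τ.1 V) fun _ => 1 - Linv,
      ← Finset.prod_mul_distrib]
    refine Finset.prod_congr rfl fun ρ _ => ?_
    have hlt' := hlt h hh ρ
    by_cases hρ : ρ ∈ cellP τ.1 V
    · simp only [if_pos (cellP_subset τ.1 V hρ), if_pos hρ]
      rw [sum_capW hlt'.le, if_neg (by simp [hρ]), one_mul]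
    · rw [if_neg hρ, Finset.sum_singleton]
      by_cases hP : ρ ∈ P τ.1
      · rw [if_pos hP, if_pos (by simp [hP, hρ]), capW, if_pos hlt']
      · rw [if_neg hP, if_neg (by simp [hP]), one_mul]
  rw [hSb, Finset.sum_biUnion hdisj, Finset.sum_congr rfl hterm, ← Finset.mul_sum,
    cellS'_eq_latSum hf τ hα hV hli, latSum, PowerSeries.coeff_mk,
    finsum_mem_eq_finite_toFinset_sum _ hfin]

/-- The coefficients of `S(Δ_τ)'` are capped sums over the integral points of the dual cone. -/
theorem coeff_coneS' (hf : f ≠ 0) (τ : CompactFace f) (D : SimplicialDecomp f τ.1) {i N : ℕ}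
    (hiN : i < N) : PowerSeries.coeff i (coneS' D) =
      ∑ k ∈ capPoints f τ.1 N i, faceW (P τ.1) N k := by
  classical
  choose! M₀ hM₀ using fun V (hV : V ∈ D.cells) =>
    exists_cap_sum_cell hf τ (D.subset_rays V hV) (D.linearIndependent V hV) (D.cone_subset hV) i
  -- a cap that is large enough for all cells at once
  set M := N + ∑ V ∈ D.cells, M₀ V with hM
  rw [← sum_capPoints_eq hf τ hiN (by omega : N ≤ M)]
  have hun : capPoints f τ.1 M i =
      D.cells.biUnion fun V => (capPoints f τ.1 M i).filter fun k => toReal k ∈ cone V := by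
    ext k
    simp only [Finset.mem_biUnion, Finset.mem_filter]
    refine ⟨fun hk => ?_, fun ⟨V, _, h⟩ => h.1⟩
    have h1 := (mem_capPoints.1 hk).2.1
    rw [← D.iUnion_eq] at h1
    simp only [Set.mem_iUnion, exists_prop] at h1
    obtain ⟨V, hV, hkV⟩ := h1
    exact ⟨V, hV, hk, hkV⟩
  conv_rhs => rw [hun]
  rw [Finset.sum_biUnion, coneS', map_sum]
  · refine Finset.sum_congr rfl fun V hV => ?_
    have hle : M₀ V ≤ M := by
      have := Finset.single_le_sum (f := M₀) (fun _ _ => Nat.zero_le _) hV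
      omega
    rw [hM₀ V hV M hle _ fun k => Finset.mem_filter, PowerSeries.coeff_C_mul]
  · intro V hV W hW hne
    have := D.disjoint hV hW hne
    rw [Function.onFun, Set.disjoint_left] at this
    rw [Function.onFun, Finset.disjoint_left]
    exact fun k hk hk' => this (Finset.mem_filter.1 hk).2 (Finset.mem_filter.1 hk').2

end CappedCell

/-! ### Comparison of the coefficients -/

section Compare

variable {n : ℕ} {f : MvPolynomial (Fin n) ℂ}

theorem eval_monomial_congr {P : Finset (Fin n)} {e : Fin n →₀ ℕ} (he : ∀ ρ ∈ P, e ρ = 0) (c : ℂ)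
    {x y : Fin n → ℂ} (hxy : ∀ ρ ∉ P, x ρ = y ρ) :
    MvPolynomial.eval x (MvPolynomial.monomial e c) =
      MvPolynomial.eval y (MvPolynomial.monomial e c) := by
  rw [MvPolynomial.eval_monomial, MvPolynomial.eval_monomial]
  congr 1
  refine Finset.prod_congr rfl fun ρ hρ => ?_
  beta_reduce
  rw [hxy ρ fun h => Finsupp.mem_support_iff.1 hρ (he ρ h)]

theorem eval_facePoly_congr (hf : f ≠ 0) (τ : CompactFace f) {x y : Fin n → ℂ}
    (hxy : ∀ ρ ∉ P τ.1, x ρ = y ρ) :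
    MvPolynomial.eval x (facePoly f τ) = MvPolynomial.eval y (facePoly f τ) := by
  classical
  rw [facePoly, map_sum, map_sum]
  refine Finset.sum_congr rfl fun ω hω => eval_monomial_congr (P := P τ.1) (fun ρ hρ => ?_) _ hxy
  exact (mem_P_iff hf τ ρ).1 hρ ω (Finset.mem_filter.1 hω)

theorem eval_pderiv_facePoly_congr (hf : f ≠ 0) (τ : CompactFace f) {x y : Fin n → ℂ}
    (hxy : ∀ ρ ∉ P τ.1, x ρ = y ρ) (ρ₀ : Fin n) :
    MvPolynomial.eval x (MvPolynomial.pderiv ρ₀ (facePoly f τ)) =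
      MvPolynomial.eval y (MvPolynomial.pderiv ρ₀ (facePoly f τ)) := by
  classical
  rw [facePoly, map_sum, map_sum, map_sum]
  refine Finset.sum_congr rfl fun ω hω => ?_
  rw [MvPolynomial.pderiv_monomial]
  refine eval_monomial_congr (P := P τ.1) (fun ρ hρ => ?_) _ hxy
  rw [Finsupp.tsub_apply, (mem_P_iff hf τ ρ).1 hρ ω (Finset.mem_filter.1 hω), Nat.zero_sub]

/-- Non-degeneracy for points whose coordinates in `P_τ` are arbitrary, since `f_τ` does not
involve these coordinates. -/
theorem exists_pderiv_ne_zero (hf : f ≠ 0) (hnd : NonDegenerate f) (τ : CompactFace f)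
    {x : Fin n → ℂ} (hx : ∀ ρ ∉ P τ.1, x ρ ≠ 0) (h0 : MvPolynomial.eval x (facePoly f τ) = 0) :
    ∃ ρ₀ ∉ P τ.1, MvPolynomial.eval x (MvPolynomial.pderiv ρ₀ (facePoly f τ)) ≠ 0 := by
  classical
  -- the point of the torus with coordinates `1` in `P_τ`
  set y : Fin n → ℂ := fun ρ => if ρ ∈ P τ.1 then 1 else x ρ with hy
  have hxy : ∀ ρ ∉ P τ.1, x ρ = y ρ := fun ρ hρ => (if_neg hρ).symm
  have hy0 : ∀ ρ, y ρ ≠ 0 := by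
    intro ρ
    rw [hy]
    beta_reduce
    split_ifs with h
    · exact one_ne_zero
    · exact hx ρ h
  have h1 := hnd τ y hy0
  rw [← eval_facePoly_congr hf τ hxy] at h1
  push Not at h1
  obtain ⟨ρ₀, hρ₀⟩ := h1 h0
  refine ⟨ρ₀, fun hP => hρ₀ ?_, by rwa [eval_pderiv_facePoly_congr hf τ hxy]⟩
  rw [MvPolynomial.pderiv_eq_zero_of_notMem_vars, map_zero]
  exact fun h => Finset.disjoint_left.1 (disjoint_vars_facePoly hf τ) h hP

theorem torusLocus'_eq (τ : Set (Fin n → ℝ)) :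
    torusLocus' f τ = torusPart (P τ) {x | MvPolynomial.eval x (facePoly f τ) = 0} := rfl

theorem isCons_torusLocus (τ : Set (Fin n → ℝ)) : IsCons (torusLocus f τ) :=
  isCons_setOf_and isCons_torus (isCons_zero _)

theorem isCons_torusLocus' (τ : Set (Fin n → ℝ)) : IsCons (torusLocus' f τ) :=
  isCons_torusPart (P τ) (isCons_zero _)

theorem Linv_pow_mul_Lm_pow {j l : ℕ} (h : j ≤ l) : Linv ^ l * Lm ^ (l - j) = Linv ^ j := by
  obtain ⟨d, rfl⟩ := Nat.exists_eq_add_of_le h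
  rw [Nat.add_sub_cancel_left, pow_add, mul_assoc, ← mul_pow, mul_comm Linv, Lm_mul_Linv, one_pow,
    mul_one]

/-- The normalized class of the free part of a jet stratum is the capped weight. -/
theorem weight_jetStratum {P : Finset (Fin n)} {k : Fin n → ℕ} {l : ℕ} (hk : ∀ ρ, k ρ ≤ l + 1)
    (hkP : ∀ ρ ∉ P, k ρ ≤ l) :
    Linv ^ n * (Lm ^ (freeCoords l k).card * (Lm - 1) ^ (P.filter fun ρ => k ρ ≤ l).card) *
      (Linv ^ n) ^ l = faceW P (l + 1) k * Linv ^ (n - P.card) := by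
  classical
  have hq : Linv * (Lm - 1) = 1 - Linv := by
    rw [mul_sub, mul_comm, Lm_mul_Linv, mul_one]
  have e1 : Linv ^ n = ∏ _ρ : Fin n, Linv := by simp
  have e2 : Lm ^ (freeCoords l k).card = ∏ ρ, Lm ^ (l - k ρ) := by
    rw [card_freeCoords, Finset.prod_pow_eq_pow_sum]
  have e3 : (Lm - 1) ^ (P.filter fun ρ => k ρ ≤ l).card =
      ∏ ρ, if ρ ∈ P.filter fun ρ => k ρ ≤ l then Lm - 1 else 1 := by
    rw [Finset.prod_ite_mem_eq _ fun _ => Lm - 1, Finset.prod_const]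
  have e4 : Linv ^ (n - P.card) = ∏ ρ, if ρ ∈ Pᶜ then Linv else 1 := by
    rw [Finset.prod_ite_mem_eq _ fun _ => Linv, Finset.prod_const, Finset.card_compl,
      Fintype.card_fin]
  rw [e4, e3, e2, e1, faceW, ← Finset.prod_pow, ← Finset.prod_mul_distrib,
    ← Finset.prod_mul_distrib, ← Finset.prod_mul_distrib, ← Finset.prod_mul_distrib]
  refine Finset.prod_congr rfl fun ρ _ => ?_
  simp only [Finset.mem_filter, Finset.mem_compl]
  by_cases hP : ρ ∈ P
  · by_cases hl : k ρ ≤ l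
    · simp only [hP, hl, and_self, if_true, not_true_eq_false, if_false, mul_one]
      rw [capW, if_pos (by omega), ← hq, ← Linv_pow_mul_Lm_pow hl]
      ring
    · have hkl : k ρ = l + 1 := by have := hk ρ; omega
      simp only [hP, hl, and_false, if_true, not_true_eq_false, if_false, mul_one]
      rw [capW, if_neg (by omega), Nat.sub_eq_zero_of_le (by omega), pow_zero, mul_one, pow_succ']
  · have hl := hkP ρ hP
    simp only [hP, false_and, if_false, not_false_eq_true, if_true, mul_one]
    rw [← Linv_pow_mul_Lm_pow hl]
    ring

open PowerSeries in
/-- The expansion of `(1 - T) / (1 - 𝕃⁻¹ T)`. -/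
theorem tFactor_eq : tFactor = (1 - X) * mk fun j => Linv ^ j := by
  have h1 : (1 - C Linv * X : PowerSeries MC) * mk (fun j => Linv ^ j) = 1 := by
    ext j
    rw [sub_mul, one_mul, map_sub, mul_assoc, coeff_C_mul]
    cases j with
    | zero => simp
    | succ j =>
      rw [coeff_succ_X_mul, coeff_mk, coeff_mk, coeff_one, if_neg (Nat.succ_ne_zero j), pow_succ']
      ring
  have h2 : invOfUnit (1 - C Linv * X : PowerSeries MC) 1 * (1 - C Linv * X) = 1 :=
    invOfUnit_mul _ 1 (by simp)
  rw [tFactor]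
  congr 1
  calc invOfUnit (1 - C Linv * X : PowerSeries MC) 1
      = invOfUnit (1 - C Linv * X : PowerSeries MC) 1 *
          ((1 - C Linv * X) * mk fun j => Linv ^ j) := by rw [h1, mul_one]
    _ = mk fun j => Linv ^ j := by rw [← mul_assoc, h2, one_mul]

theorem coeff_zero_faceL' (τ : Set (Fin n → ℝ)) : PowerSeries.coeff 0 (faceL' f τ) =
    Linv ^ (n - (P τ).card) * ((Lm - 1) ^ (n - (P τ).card) - cls (torusLocus' f τ)) := by
  have hq : 1 - Linv = Linv * (Lm - 1) := by
    rw [mul_sub, mul_comm, Lm_mul_Linv, mul_one]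
  rw [faceL', map_sub, PowerSeries.coeff_C_mul, PowerSeries.coeff_C, if_pos rfl, tFactor_eq, hq,
    mul_pow, sub_mul, one_mul, map_sub, PowerSeries.coeff_zero_X_mul, PowerSeries.coeff_mk]
  ring

theorem coeff_faceL'_of_pos (τ : Set (Fin n → ℝ)) {j : ℕ} (hj : 0 < j) :
    PowerSeries.coeff j (faceL' f τ) =
      Linv ^ (n - (P τ).card) * (cls (torusLocus' f τ) * ((Lm - 1) * Linv ^ j)) := by
  obtain ⟨j, rfl⟩ := Nat.exists_eq_succ_of_ne_zero hj.ne'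
  have h1 : Linv ^ j = Lm * Linv ^ (j + 1) := by
    rw [pow_succ', ← mul_assoc, Lm_mul_Linv, one_mul]
  rw [faceL', map_sub, PowerSeries.coeff_C_mul, PowerSeries.coeff_C, if_neg (Nat.succ_ne_zero j),
    tFactor_eq, sub_mul, one_mul, map_sub, PowerSeries.coeff_succ_X_mul, PowerSeries.coeff_mk,
    PowerSeries.coeff_mk, Nat.succ_eq_add_one, h1]
  ring

/-- The normalized class of a jet stratum, in terms of the face dual to the orders `k`. -/
theorem cls_jetStratum (hf : f ≠ 0) (hnd : NonDegenerate f) (τ : CompactFace f) {k : Fin n → ℕ}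
    {l : ℕ} (hk : ∀ ρ, 1 ≤ k ρ ∧ k ρ ≤ l + 1) (hkτ : toReal k ∈ dualCone f τ.1) :
    Linv ^ n * cls (jetStratum f l k) * (Linv ^ n) ^ l = if mNat f k ≤ l then
      faceW (P τ.1) (l + 1) k * PowerSeries.coeff (l - mNat f k) (faceL' f τ.1) else 0 := by
  have hk1 : ∀ ρ, 1 ≤ k ρ := fun ρ => (hk ρ).1
  have hm : ∀ ω ∈ f.support, mNat f k ≤ ∑ ρ, k ρ * ω ρ := fun ω hω => Nat.sInf_le ⟨ω, hω, rfl⟩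
  have hkP : ∀ ρ ∉ P τ.1, k ρ ≤ mNat f k := fun ρ hρ => le_of_notMem_P hf τ ⟨hkτ, rfl⟩ hρ
  have hinit := facePoly_eq_initPart hf hkτ
  have hdep : ∀ x y : Fin n → ℂ, (∀ ρ ∉ P τ.1, x ρ = y ρ) →
      MvPolynomial.eval x (initPart f k (mNat f k)) =
        MvPolynomial.eval y (initPart f k (mNat f k)) := fun x y hxy => by
    rw [← hinit]
    exact eval_facePoly_congr hf τ hxy
  have hX : torusPart (P τ.1) {x | MvPolynomial.eval x (initPart f k (mNat f k)) = 0} =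
      torusLocus' f τ.1 := by rw [torusLocus'_eq, hinit]
  rcases lt_trichotomy l (mNat f k) with h | h | h
  · rw [cls_jetStratum_of_lt hm h, if_neg (by omega), mul_zero, zero_mul]
  · have hw := weight_jetStratum (fun ρ => (hk ρ).2) (P := P τ.1) fun ρ hρ => (hkP ρ hρ).trans h.ge
    rw [← h] at hm hkP hdep hX
    rw [if_pos h.ge, ← h, Nat.sub_self, coeff_zero_faceL', ← mul_assoc (faceW _ _ _), ← hw,
      cls_jetStratum_self hk1 hm hkP hdep, hX]
    ring
  · have hw := weight_jetStratum (fun ρ => (hk ρ).2) (P := P τ.1) fun ρ hρ => (hkP ρ hρ).trans h.le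
    have hc := cls_jetStratum_of_gt hk1 hm h hkP hdep fun x hx h0 => by
      rw [← hinit] at h0 ⊢
      exact exists_pderiv_ne_zero hf hnd τ hx h0
    rw [if_pos h.le, coeff_faceL'_of_pos _ (by omega), ← mul_assoc (faceW _ _ _), ← hw, ← hX]
    -- the factor `𝕃^{l-m}` is invertible
    have hc' : cls (jetStratum f l k) =
        Linv ^ (l - mNat f k) * (Lm ^ (l - mNat f k) * cls (jetStratum f l k)) := by
      rw [← mul_assoc, ← mul_pow, mul_comm Linv, Lm_mul_Linv, one_pow, one_mul]
    rw [hc', hc]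
    ring

/-- For `P_τ = ∅` the two torus loci only differ by the names of the coordinates. -/
theorem cls_torusLocus_eq {τ : Set (Fin n → ℝ)} (hP : P τ = ∅) :
    cls (torusLocus f τ) = cls (torusLocus' f τ) := by
  have hn : ∀ ρ, ρ ∉ P τ := fun ρ => by simp [hP]
  have hext : ∀ x : {ρ // ρ ∉ P τ} → ℂ, extZero (P τ) x = fun ρ => x ⟨ρ, hn ρ⟩ := fun x => by
    ext ρ
    simp [extZero, hn ρ]
  refine cls_congr (isCons_torusLocus τ) (isCons_torusLocus' τ) (fun x ρ => x ρ.1)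
    (fun (y : {ρ // ρ ∉ P τ} → ℂ) ρ => y ⟨ρ, hn ρ⟩) (fun ρ => regOn_coord _ ρ.1) (fun ρ =>
      regOn_coord _ (⟨ρ, hn ρ⟩ : {ρ // ρ ∉ P τ}))
    (fun x hx => ?_) (fun y hy => ?_) (fun _ _ => rfl) fun _ _ => rfl
  · rw [torusLocus'_eq]
    refine ⟨fun ρ => hx.1 ρ.1, ?_⟩
    rw [hext]
    exact hx.2
  · rw [torusLocus'_eq] at hy
    refine ⟨fun ρ => hy.1 ⟨ρ, hn ρ⟩, ?_⟩
    have := hy.2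
    rw [hext] at this
    exact this

theorem faceL_eq_faceL' {τ : Set (Fin n → ℝ)} (hP : P τ = ∅) : faceL f τ = faceL' f τ := by
  have h0 : (P τ).card = 0 := Finset.card_eq_zero.2 hP
  rw [faceL, faceL', cls_torusLocus_eq hP, h0, Nat.sub_zero]

open Classical in
/-- The coefficient of `T^l` of `L'_τ S(Δ_τ)'` is a sum over the possible orders of jets: all the
coefficients of `S(Δ_τ)'` up to `T^l` are computed with the same cap `l + 1`. -/
theorem coeff_faceL'_mul_coneS' (hf : f ≠ 0) (τ : CompactFace f) (D : SimplicialDecomp f τ.1)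
    (l : ℕ) : PowerSeries.coeff l (faceL' f τ.1 * coneS' D) =
      ∑ k ∈ Fintype.piFinset fun _ => Finset.Icc 1 (l + 1),
        if toReal k ∈ dualCone f τ.1 ∧ mNat f k ≤ l then
          faceW (P τ.1) (l + 1) k * PowerSeries.coeff (l - mNat f k) (faceL' f τ.1) else 0 := by
  have h1 : ∀ p ∈ Finset.HasAntidiagonal.antidiagonal l,
      PowerSeries.coeff p.1 (faceL' f τ.1) * PowerSeries.coeff p.2 (coneS' D) =
      ∑ k ∈ Fintype.piFinset fun _ => Finset.Icc 1 (l + 1),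
        if toReal k ∈ dualCone f τ.1 ∧ mNat f k = p.2 then
          faceW (P τ.1) (l + 1) k * PowerSeries.coeff p.1 (faceL' f τ.1) else 0 := by
    intro p hp
    have hle : p.2 < l + 1 := by
      have := Finset.HasAntidiagonal.mem_antidiagonal.1 hp
      omega
    rw [coeff_coneS' hf τ D hle, capPoints, mul_comm, Finset.sum_mul, Finset.sum_filter]
  rw [PowerSeries.coeff_mul, Finset.sum_congr rfl h1, Finset.sum_comm]
  refine Finset.sum_congr rfl fun k _ => ?_
  split_ifs with h
  · rw [Finset.sum_eq_single (l - mNat f k, mNat f k)]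
    · rw [if_pos ⟨h.1, rfl⟩]
    · rintro ⟨i, j⟩ hp hne
      refine if_neg fun h' => hne ?_
      have := Finset.HasAntidiagonal.mem_antidiagonal.1 hp
      simp only at this h'
      rw [h'.2, ← this, Nat.add_sub_cancel]
    · intro hp
      exact absurd (Finset.HasAntidiagonal.mem_antidiagonal.2 (Nat.sub_add_cancel h.2)) hp
  · refine Finset.sum_eq_zero fun p hp => if_neg fun h' => h ⟨h'.1, ?_⟩
    have := Finset.HasAntidiagonal.mem_antidiagonal.1 hp
    omega

/-- This makes the constant term of the formula vanish. -/
theorem mNat_pos (hf : f ≠ 0) (hf0 : MvPolynomial.eval 0 f = 0) (τ : CompactFace f)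
    {k : Fin n → ℕ} (hk : toReal k ∈ dualCone f τ.1) : 0 < mNat f k := by
  refine Nat.pos_of_ne_zero fun h0 => ?_
  obtain ⟨ρ, hρ⟩ : ∃ ρ, ρ ∉ P τ.1 := by
    by_contra! hall
    have h1 := card_P_lt hf hf0 τ
    rw [Finset.eq_univ_iff_forall.2 hall, Finset.card_univ, Fintype.card_fin] at h1
    omega
  have h1 := le_of_notMem_P hf τ ⟨hk, h0⟩ hρ
  have h2 := ((mem_dualCone_nat hf τ k 0).1 ⟨hk, h0⟩).1 ρ
  omega

/-- Every vector `k` of orders is in the dual cone of exactly one compact face, its first meet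
locus. The terms with `P_τ = ∅` are not treated separately here. -/
theorem motivicZeta_eq_sum [Fintype (CompactFace f)] (hf : f ≠ 0)
    (hf0 : MvPolynomial.eval 0 f = 0) (hnd : NonDegenerate f)
    (D : (τ : CompactFace f) → SimplicialDecomp f τ.1) :
    motivicZeta f = ∑ τ, faceL' f τ.1 * coneS' (D τ) := by
  classical
  ext l
  rw [map_sum, Finset.sum_congr rfl fun τ _ => coeff_faceL'_mul_coneS' hf τ (D τ) l,
    Finset.sum_comm, motivicZeta, PowerSeries.coeff_mk]
  split_ifs with hl
  · symm
    refine Finset.sum_eq_zero fun k _ => Finset.sum_eq_zero fun τ _ => if_neg fun h => ?_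
    have := mNat_pos hf hf0 τ h.1
    omega
  · rw [cls_jetLocus, Finset.mul_sum, Finset.sum_mul]
    refine Finset.sum_congr rfl fun k hk => ?_
    have hk1 : ∀ ρ, 1 ≤ k ρ ∧ k ρ ≤ l + 1 := fun ρ =>
      Finset.mem_Icc.1 (Fintype.mem_piFinset.1 hk ρ)
    have hpos : ∀ ρ, 0 < toReal k ρ := fun ρ => Nat.cast_pos.2 (hk1 ρ).1
    have hkτ : toReal k ∈ dualCone f (compactFaceOf hf hpos).1 := ⟨fun ρ => (hpos ρ).le, rfl⟩
    rw [Finset.sum_eq_single (compactFaceOf hf hpos), cls_jetStratum hf hnd _ hk1 hkτ]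
    · simp only [hkτ, true_and]
    · intro τ _ hne
      exact if_neg fun h => hne (Subtype.ext h.1.2.symm)
    · exact fun h => absurd (Finset.mem_univ _) h

end Compare

end MotivicZeta

end

theorem theorem9p3 {n : ℕ} (f : MvPolynomial (Fin n) ℂ) (hf : f ≠ 0)
    (hf0 : MvPolynomial.eval 0 f = 0) (hnd : MotivicZeta.NonDegenerate f) :
    -- the classes that occur are well defined
    (∀ l : ℕ, 1 ≤ l → ∃! c, MotivicZeta.HasClass (MotivicZeta.jetLocus f l) c) ∧
    (∀ τ : MotivicZeta.CompactFace f,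
      (∃! c, MotivicZeta.HasClass (MotivicZeta.torusLocus f τ) c) ∧
      (∃! c, MotivicZeta.HasClass (MotivicZeta.torusLocus' f τ) c)) ∧
    -- the compact faces and their cones
    Finite (MotivicZeta.CompactFace f) ∧
    (∀ τ : MotivicZeta.CompactFace f,
      (MotivicZeta.P τ.1).card + 1 ≤ n ∧
      Disjoint (MotivicZeta.facePoly f τ).vars (MotivicZeta.P τ.1) ∧
      (∃ V : Finset (Fin n → ℕ), (V : Set (Fin n → ℕ)) = MotivicZeta.rays f τ ∧
        MotivicZeta.dualCone f τ = MotivicZeta.cone V ∧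
        (∀ ρ ∈ MotivicZeta.P τ.1, MotivicZeta.stdVec ρ ∈ V) ∧
        (MotivicZeta.cellJ τ V).Nonempty ∧
        ∀ v ∈ MotivicZeta.cellJ τ V, 0 < MotivicZeta.mNat f v) ∧
      Nonempty (MotivicZeta.SimplicialDecomp f τ)) ∧
    -- the formula, for every choice of simplicial decompositions
    ∀ D : (τ : MotivicZeta.CompactFace f) → MotivicZeta.SimplicialDecomp f τ,
      (∀ τ : MotivicZeta.CompactFace f, MotivicZeta.P τ.1 = ∅ →
        MotivicZeta.IsLatticeSum f (MotivicZeta.dualCone f τ) (MotivicZeta.coneS (D τ)) ∧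
        ∀ V ∈ (D τ).cells,
          MotivicZeta.IsLatticeSum f (MotivicZeta.cone V) (MotivicZeta.cellS f V)) ∧
      (∀ τ : MotivicZeta.CompactFace f, MotivicZeta.P τ.1 ≠ ∅ →
        ∀ V ∈ (D τ).cells,
          (MotivicZeta.cellJ τ V).Nonempty ∧
          MotivicZeta.IsLatticeSum f (MotivicZeta.truncCone τ V)
            (MotivicZeta.cellS' f τ V)) ∧
      MotivicZeta.motivicZeta f =
        (∑ᶠ (τ : MotivicZeta.CompactFace f) (_ : MotivicZeta.P τ.1 = ∅),
          MotivicZeta.faceL f τ * MotivicZeta.coneS (D τ)) +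
        ∑ᶠ (τ : MotivicZeta.CompactFace f) (_ : MotivicZeta.P τ.1 ≠ ∅),
          MotivicZeta.faceL' f τ * MotivicZeta.coneS' (D τ) := by
  classical
  have hfin := MotivicZeta.finite_compactFace hf
  refine ⟨fun l _ => (MotivicZeta.isCons_jetLocus f l).existsUnique_hasClass,
    fun τ => ⟨(MotivicZeta.isCons_torusLocus τ.1).existsUnique_hasClass,
      (MotivicZeta.isCons_torusLocus' τ.1).existsUnique_hasClass⟩, hfin, fun τ =>
    ⟨MotivicZeta.card_P_lt hf hf0 τ, MotivicZeta.disjoint_vars_facePoly hf τ, ?_,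
      MotivicZeta.nonempty_simplicialDecomp hf τ⟩, fun D => ⟨fun τ hP => ⟨?_, fun V hV => ?_⟩,
    fun τ _ V hV => ⟨?_, ?_⟩, ?_⟩⟩
  · have hR := (MotivicZeta.finite_rays hf τ).coe_toFinset
    have hcone := MotivicZeta.dualCone_eq_cone hf τ hR
    refine ⟨(MotivicZeta.finite_rays hf τ).toFinset, hR, hcone, fun ρ hρ => ?_,
      MotivicZeta.cellJ_nonempty hf hf0 τ hcone.ge, MotivicZeta.mNat_pos_of_mem_cellJ hf τ hR.le⟩
    exact (MotivicZeta.finite_rays hf τ).mem_toFinset.2 (MotivicZeta.stdVec_mem_rays hf τ hρ)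
  · exact MotivicZeta.isLatticeSum_dualCone hf τ hP (D τ)
  · exact MotivicZeta.isLatticeSum_cone hf τ hP ((D τ).subset_rays V hV)
      ((D τ).linearIndependent V hV)
  · exact MotivicZeta.cellJ_nonempty hf hf0 τ ((D τ).cone_subset hV)
  · exact MotivicZeta.isLatticeSum_truncCone hf τ ((D τ).subset_rays V hV)
      ((D τ).linearIndependent V hV)
  · have := Fintype.ofFinite (MotivicZeta.CompactFace f)
    rw [finsum_eq_sum_of_fintype, finsum_eq_sum_of_fintype, ← Finset.sum_add_distrib,
      MotivicZeta.motivicZeta_eq_sum hf hf0 hnd D]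
    refine Finset.sum_congr rfl fun τ _ => ?_
    -- each face contributes to one of the two sums, and for `P_τ = ∅` the two kinds of terms agree
    rw [finsum_eq_if, finsum_eq_if]
    by_cases hP : MotivicZeta.P τ.1 = ∅
    · rw [if_pos hP, if_neg (not_not.2 hP), add_zero, MotivicZeta.faceL_eq_faceL' hP,
        MotivicZeta.coneS_eq_coneS' hP]
    · rw [if_neg hP, if_pos hP, zero_add]
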